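/- **Conventions.** Let $d\ge 1$ and let $\widehat f(\xi)=\int_{\mathbb R^d}e^{-ix\cdot\xi}f(x)\,dx$. Fix a smooth radial $\chi:\mathbb R^d\to\mathbb R$ supported in the ball $B(0,4/3)$ with $\chi=1$ on $B(0,3/4)$, put $\varphi(\xi)=\chi(\xi/2)-\chi(\xi)$, and for $j\in\mathbb Z$ let $\dot\Delta_j=\varphi(2^{-j}D)$ and $\dot S_j=\chi(2^{-j}D)$, acting on complex-valued tempered distributions. Let $\mathcal S'_h$ be the set of $f\in\mathcal S'(\mathbb R^d)$ with $\|\dot S_jf\|_{L^\infty}\to0$ as $j\to-\infty$, let $$\|f\|_{\dot B^{s}_{p,1}}=\sum_{j\in\mathbb Z}2^{js}\|\dot\Delta_jf\|_{L^p},$$ and let $\dot B^s_{p,1}$ be the set of $f\in\mathcal S'_h$ for which this is finite. Let $\Lambda_1$ be the Fourier multiplier with symbol $|\xi|_1=\sum_{i=1}^d|\xi_i|$. For $a\ge0$, the operator $e^{-a\Lambda_1}$ acts on bounded functions (as convolution with the inverse Fourier transform of $e^{-a|\xi|_1}$), and for $f,F\in\mathcal S'_h$ we write $F=e^{a\Lambda_1}f$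 if for all $j\in\mathbb Z$ the distribution $\dot\Delta_jF$ is a bounded function and $\dot\Delta_jf=e^{-a\Lambda_1}\dot\Delta_jF$. The product $fg$ of two tempered distributions is the limit in $\mathcal S'$ of $\dot S_nf\,\dot S_ng$ as $n\to+\infty$, whenever $\dot S_nf,\dot S_ng$ are bounded functions for all $n\ge 0$ and this limit exists. **Proposition 2.3.** Let $1<p<\infty$. (i) Let $s_1,s_2\in\mathbb R$ with $s_1,s_2\le d/p$ and $s_1+s_2>d\max(0,-1+2/p)$. There exists a constant $C$ (depending only on $d$, $\chi$, $p$, $s_1$, $s_2$) such that for all $c_0>0$, all $t\ge0$ and all $f,g$ for which $F=e^{\sqrt{c_0t}\Lambda_1}f$ and $G=e^{\sqrt{c_0t}\Lambda_1}g$ exist and satisfy $F\in\dot B^{s_1}_{p,1}$ and $G\in\dot B^{s_2}_{p,1}$, the product $fg$ exists, $e^{\sqrt{c_0t}\Lambda_1}(fg)$ exists and belongs to $\dot B^{s_1+s_2-d/p}_{p,1}$, and $$\|e^{\sqrt{c_0t}\Lambda_1}(fg)\|_{\dot B^{s_1+s_2-d/p}_{p,1}}\le C\,\|F\|_{\dot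 B^{s_1}_{p,1}}\|G\|_{\dot B^{s_2}_{p,1}}.$$ (ii) In particular, for all $c_0>0$ and $t\ge0$, the Gevrey version of $\dot B^{d/p}_{p,1}$, namely the space $$\bigl\{f\in\dot B^{d/p}_{p,1}\;:\;e^{\sqrt{c_0t}\Lambda_1}f\text{ exists and belongs to }\dot B^{d/p}_{p,1}\bigr\},$$ consists of bounded continuous functions and is an algebra: it is a complex vector space, closed under pointwise multiplication. Moreover, there is a constant $C$ (depending only on $d$, $\chi$, $p$) such that for all $c_0>0$, $t\ge 0$ and all bounded continuous $f,g$ for which $e^{\sqrt{c_0t}\Lambda_1}f$ and $e^{\sqrt{c_0t}\Lambda_1}g$ exist and belong to $\dot B^{d/p}_{p,1}$, the distribution $e^{\sqrt{c_0t}\Lambda_1}(fg)$ of the pointwise product exists, belongs to $\dot B^{d/p}_{p,1}$, and $$\|e^{\sqrt{c_0t}\Lambda_1}(fg)\|_{\dot B^{d/p}_{p,1}}\le C\|e^{\sqrt{c_0t}\Lambda_1}f\|_{\dot B^{d/p}_{p,1}}\|e^{\sqrt{c_0t}\Lambda_1}g\|_{\dot B^{d/p}_{p,1}}.$$ -/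

import Mathlib

open MeasureTheory Filter Topology
open scoped ENNReal NNReal ContDiff SchwartzMap FourierTransform BoundedContinuousFunction

noncomputable section

namespace GevreyBesov

/-- The space `ℝ^d` with its Euclidean norm. -/
abbrev Rd (d : ℕ) : Type := EuclideanSpace ℝ (Fin d)

/-- Complex-valued tempered distributions on `ℝ^d`, with the weak-star topology. -/
abbrev Tempered (d : ℕ) : Type := 𝓢'(Rd d, ℂ)

variable {d : ℕ}

/-- The distribution `T` is (integration against) the function `u`. Always used together with
`u ∈ L^q` for some `1 ≤ q ≤ ∞`, or with `u` bounded and continuous. -/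
def Represents (u : Rd d → ℂ) (T : Tempered d) : Prop :=
  ∀ φ : 𝓢(Rd d, ℂ), T φ = ∫ x, φ x * u x

/-- The `L^q` norm of a tempered distribution, `1 ≤ q ≤ ∞`; it is `∞` if the distribution is not
an `L^q` function. -/
def lebesgueNorm (q : ℝ≥0∞) (T : Tempered d) : ℝ≥0∞ :=
  ⨅ (u : Rd d → ℂ) (_ : MemLp u q volume ∧ Represents u T), eLpNorm u q volume

/-- The Fourier multiplier `m(D)` for the convention `∫ f(x) e^{-i x·ξ} dx` of the Fourier
transform. The frequency variable of Mathlib's Fourier transform is `ξ / (2π)`, whence the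
rescaling of the symbol. -/
def multiplier (m : Rd d → ℝ) : Tempered d →L[ℂ] Tempered d :=
  TemperedDistribution.fourierMultiplierCLM ℂ (fun ξ => ((m ((2 * Real.pi) • ξ) : ℝ) : ℂ))

/-- The low frequency cut-off functions from which a Littlewood-Paley decomposition is built. -/
structure Cutoff (d : ℕ) where
  /-- the cut-off function -/
  χ : Rd d → ℝ
  smooth : ContDiff ℝ ∞ χ
  radial : ∀ ξ η : Rd d, ‖ξ‖ = ‖η‖ → χ ξ = χ η
  support_subset : Function.support χ ⊆ Metric.closedBall 0 (4 / 3)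
  eq_one : ∀ ξ ∈ Metric.ball (0 : Rd d) (3 / 4), χ ξ = 1

namespace Cutoff

variable (X : Cutoff d)

/-- `φ(ξ) = χ(ξ/2) - χ(ξ)`. -/
def phi (ξ : Rd d) : ℝ := X.χ ((2 : ℝ)⁻¹ • ξ) - X.χ ξ

/-- The dyadic block `Δ_j = φ(2^{-j} D)`. -/
def Delta (j : ℤ) : Tempered d →L[ℂ] Tempered d :=
  multiplier (fun ξ => X.phi ((2 : ℝ) ^ (-j) • ξ))

/-- The low frequency cut-off `S_j = χ(2^{-j} D)`. -/
def S (j : ℤ) : Tempered d →L[ℂ] Tempered d :=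
  multiplier (fun ξ => X.χ ((2 : ℝ) ^ (-j) • ξ))

/-- The space `S'_h` of tempered distributions with `‖S_j f‖_{L^∞} → 0` as `j → -∞`. -/
def MemSh (f : Tempered d) : Prop :=
  Tendsto (fun j : ℤ => lebesgueNorm ⊤ (X.S j f)) atBot (𝓝 0)

/-- The norm of the homogeneous Besov space of regularity `s`, integrability `p` and third
index `1`. -/
def besovNorm (s p : ℝ) (f : Tempered d) : ℝ≥0∞ :=
  ∑' j : ℤ, ENNReal.ofReal ((2 : ℝ) ^ ((j : ℝ) * s)) * lebesgueNorm (ENNReal.ofReal p) (X.Delta j f)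

/-- Membership in the homogeneous Besov space of regularity `s`, integrability `p` and third
index `1`. -/
def MemBesov (s p : ℝ) (f : Tempered d) : Prop :=
  X.MemSh f ∧ X.besovNorm s p f < ⊤

end Cutoff

/-- The `ℓ^1` norm `|ξ|_1` of a frequency, that is the symbol of `Λ_1`. -/
def l1 (ξ : Rd d) : ℝ := ∑ i, |ξ i|

/-- The function `e^{-a Λ_1} φ`, for a Schwartz function `φ` and `a ≥ 0`. It is continuous and
integrable, but in general not a Schwartz function, as the symbol is not smooth. -/
def expNegTest (a : ℝ) (φ : 𝓢(Rd d, ℂ)) : Rd d → ℂ :=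
  𝓕⁻ (fun ξ : Rd d => ((Real.exp (-a * l1 ((2 * Real.pi) • ξ)) : ℝ) : ℂ) * (𝓕 φ) ξ)

/-- `X.IsExp a f F` says that `F = e^{a Λ_1} f`, i.e. that `f = e^{-a Λ_1} F`, for `a ≥ 0`.
As the symbol of `e^{-a Λ_1}` is not smooth, this operator does not act on every tempered
distribution; it acts by duality on bounded functions `u`, through
`⟨e^{-a Λ_1} u, φ⟩ = ⟨u, e^{-a Λ_1} φ⟩`.
So we require that both distributions are in `S'_h` (hence are the sums of their dyadic blocks),
that the dyadic blocks of `F` are bounded functions (as holds in every Besov space), and that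
`Δ_j f = e^{-a Λ_1} Δ_j F` for all `j`. -/
def Cutoff.IsExp (X : Cutoff d) (a : ℝ) (f F : Tempered d) : Prop :=
  X.MemSh f ∧ X.MemSh F ∧ ∀ j : ℤ, ∃ u : Rd d → ℂ, MemLp u ⊤ volume ∧
    Represents u (X.Delta j F) ∧
    ∀ φ : 𝓢(Rd d, ℂ), X.Delta j f φ = ∫ x, expNegTest a φ x * u x

/-- The tempered distribution `h` is the product of `f` and `g`: it is the limit, in the sense of
tempered distributions, of the products of the bounded functions `S_n f` and `S_n g`. -/
def Cutoff.IsProduct (X : Cutoff d) (f g h : Tempered d) : Prop :=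
  ∃ u v : ℕ → Rd d → ℂ,
    (∀ n, MemLp (u n) ⊤ volume ∧ Represents (u n) (X.S n f)) ∧
    (∀ n, MemLp (v n) ⊤ volume ∧ Represents (v n) (X.S n g)) ∧
    ∀ φ : 𝓢(Rd d, ℂ), Tendsto (fun n => ∫ x, φ x * (u n x * v n x)) atTop (𝓝 (h φ))

/-- The Gevrey version of a homogeneous Besov space: the distributions `f` such that both `f` and
`e^{a Λ_1} f` are in the Besov space of regularity `s`, integrability `p` and third index `1`. -/
def Cutoff.MemGevrey (X : Cutoff d) (a s p : ℝ) (f : Tempered d) : Prop :=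
  X.MemBesov s p f ∧ ∃ F, X.IsExp a f F ∧ X.MemBesov s p F

/-- The bounded continuous functions that belong, as distributions, to the Gevrey version of a
homogeneous Besov space. -/
def Cutoff.gevreyFunctions (X : Cutoff d) (a s p : ℝ) : Set (Rd d →ᵇ ℂ) :=
  {u | ∃ f, X.MemGevrey a s p f ∧ Represents u f}

end GevreyBesov

end

/-! Put `a = √(c₀ t)`. On dyadic blocks `u` of `F` and `v` of `G`, the product in the Gevrey
variables is `e^{aΛ₁}(e^{-aΛ₁}u · e^{-aΛ₁}v)`, a bilinear operator with symbol `exp (a(|ξ+η|₁ - |ξ|₁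
- |η|₁))`. The point is to bound it uniformly in `a`.

Since `|·|₁` is a sum over coordinates, the symbol factors into one symbol per coordinate. Once the
signs of `ξ_i`, `η_i` and `ξ_i + η_i` are fixed, the exponent in that coordinate is `0`, `-2a|ξ_i|`
or `-2a|η_i|`, so the factor is a function of `ξ_i` times a function of `η_i` times a function of
`ξ_i + η_i` (`sum_lineSym`, `sum_octant`). The bilinear operator is therefore a sum of `8^d` terms
`Z''(Zu · Z'v)`, where `Z`, `Z'`, `Z''` are compositions of half-space projections and of dampings
`e^{-2a|D_i|}`. The projections are bounded on `L^p` for `1 < p < ∞` by M. Riesz's theorem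
(`exists_ampMul_half`); the dampings are convolutions with Poisson probability densities, of norm at
most one whatever `a`. All of them commute with frequency cut-offs, so localized functions stay
localized, and the Gevrey estimate reduces to the ordinary product law for two localized functions
(`exists_twisted_product`).

The ordinary law (`exists_product_le`) is Bony's analysis. For separated frequencies the output sits
at the higher one, and Bernstein's inequality on the lower factor together with `s_i ≤ d/p`
suffices. For comparable frequencies the product is placed in `L^{q/2}`, `q = max(2, p)`, and
Bernstein's inequality back to `L^p` gives a geometric series in the output frequency, which
converges because `s₁ + s₂ > d max(0, 2/p - 1)`. Summing over all pairs of blocks gives (i)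
(`exists_product_estimate`).

M. Riesz's theorem is proved on `L^{2k}` from `∫ F^{2k} = 0` for `F` with spectrum in a half space,
which bounds `F` by its real part; Marcinkiewicz interpolation gives `p ≥ 2` and duality gives `p <
2`.

Half-space symbols are not smooth and do not preserve Schwartz functions. The test class is
therefore that of amplitudes, smooth and compactly supported off the coordinate hyperplanes. It is
stable under every symbol in use, and its inverse Fourier transforms are dense in `L^p` for `1 < p <
∞`. Multipliers are handled as relations `Rel` tested against this class.

For (ii), the critical space embeds in the bounded continuous functions with `S_n f → f` uniformly
(`MemBesov.exists_boundedContinuous`), so the product of distributions is the pointwise one. The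
operator `e^{-aΛ₁}` is a contraction, so `f` inherits the regularity of `F`. -/

noncomputable section

namespace GevreyBesov

variable {d : ℕ}

/-! ### Averages of translates: `L^p` bounds, transposition and Fourier symbols. -/

section Avg

set_option linter.unusedSectionVars false

variable {Y : Type*} [MeasurableSpace Y]

/-- The weighted average of translates `x ↦ ∫ κ(t) u(x - τ(t)) dν(t)`. -/
def avg (ν : Measure Y) (τ : Y → Rd d) (κ : Y → ℂ) (u : Rd d → ℂ) (x : Rd d) : ℂ :=
  ∫ t, κ t * u (x - τ t) ∂ν

/-- The Fourier symbol of `avg ν τ κ`. -/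
def avgSymbol (ν : Measure Y) (τ : Y → Rd d) (κ : Y → ℂ) (ξ : Rd d) : ℂ :=
  ∫ t, κ t * Complex.exp ((-(2 * Real.pi * inner ℝ (τ t) ξ) : ℝ) * Complex.I) ∂ν

/-- The majorant of `avg ν τ κ u`. -/
def posAvg (ν : Measure Y) (τ : Y → Rd d) (κ : Y → ℂ) (u : Rd d → ℂ) (x : Rd d) : ℝ≥0∞ :=
  ∫⁻ t, ‖κ t‖ₑ * ‖u (x - τ t)‖ₑ ∂ν

variable {ν : Measure Y} [SFinite ν] {τ : Y → Rd d} {κ : Y → ℂ} {u v : Rd d → ℂ} {p q : ℝ≥0∞}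

/-- By translation invariance every slice of the preimage of a null set is null. This gives joint
measurability of the integrand of `avg` for `u` that is only almost everywhere measurable, and lets
almost everywhere statements pass to translates. -/
lemma quasiMeasurePreserving_sub_apply (hτ : Measurable τ) :
    Measure.QuasiMeasurePreserving (fun z : Rd d × Y => z.1 - τ z.2) (volume.prod ν) volume := by
  have hm : Measurable (fun z : Rd d × Y => z.1 - τ z.2) :=
    measurable_fst.sub (hτ.comp measurable_snd)
  refine ⟨hm, Measure.AbsolutelyContinuous.mk fun s hs h0 => ?_⟩
  rw [Measure.map_apply hm hs, Measure.prod_apply_symm (hm hs)]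
  have : ∀ t : Y, volume ((fun x : Rd d => (x, t)) ⁻¹' ((fun z : Rd d × Y => z.1 - τ z.2) ⁻¹' s))
      = 0 := fun t => by
    have := (measurePreserving_sub_right (volume : Measure (Rd d)) (τ t)).measure_preimage
      hs.nullMeasurableSet
    rw [← Set.preimage_comp]
    exact this.trans h0
  simp [this]

lemma ae_ae_comp_sub (hτ : Measurable τ) {P : Rd d → Prop} (h : ∀ᵐ z, P z) :
    ∀ᵐ x : Rd d, ∀ᵐ t ∂ν, P (x - τ t) :=
  Measure.ae_ae_of_ae_prod ((quasiMeasurePreserving_sub_apply (ν := ν) hτ).ae h)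

lemma aestronglyMeasurable_avg_kernel (hτ : Measurable τ) (hκ : AEStronglyMeasurable κ ν)
    (hu : AEStronglyMeasurable u volume) :
    AEStronglyMeasurable (fun z : Rd d × Y => κ z.2 * u (z.1 - τ z.2)) (volume.prod ν) :=
  hκ.comp_snd.mul (hu.comp_quasiMeasurePreserving (quasiMeasurePreserving_sub_apply hτ))

lemma aestronglyMeasurable_avg (hτ : Measurable τ) (hκ : AEStronglyMeasurable κ ν)
    (hu : AEStronglyMeasurable u volume) : AEStronglyMeasurable (avg ν τ κ u) volume :=
  (aestronglyMeasurable_avg_kernel hτ hκ hu).integral_prod_right'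

lemma enorm_avg_le_posAvg (x : Rd d) : ‖avg ν τ κ u x‖ₑ ≤ posAvg ν τ κ u x := by
  refine (enorm_integral_le_lintegral_enorm _).trans_eq ?_
  simp [posAvg, enorm_mul]

/-- For finite `p`, Jensen's inequality for the measure of density `‖κ‖` and mass `M` gives `(posAvg
u)^r ≤ M^(r-1) ∫ ‖κ‖ |u(x - τ)|^r`. Tonelli's theorem and translation invariance then integrate this
in `x`. -/
lemma eLpNorm_posAvg_le (hτ : Measurable τ) (hκ : Integrable κ ν)
    (hu : AEStronglyMeasurable u volume) (hp : 1 ≤ p) :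
    eLpNorm (posAvg ν τ κ u) p volume ≤ (∫⁻ t, ‖κ t‖ₑ ∂ν) * eLpNorm u p volume := by
  rcases eq_or_ne p ⊤ with rfl | hpt
  · rw [eLpNorm_exponent_top]
    refine essSup_le_of_ae_le _ ?_
    have h1 : ∀ᵐ z : Rd d, ‖u z‖ₑ ≤ eLpNorm u ⊤ volume := by
      rw [eLpNorm_exponent_top]; exact enorm_ae_le_eLpNormEssSup u volume
    filter_upwards [ae_ae_comp_sub (ν := ν) hτ h1] with x hx
    simp only [enorm_eq_self, posAvg]
    rw [← lintegral_mul_const'' _ hκ.1.enorm]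
    refine lintegral_mono_ae ?_
    filter_upwards [hx] with t ht
    gcongr
  · set r := p.toReal with hr
    have hr1 : 1 ≤ r := by
      rw [hr]; simpa using ENNReal.toReal_mono hpt hp
    have hp0 : p ≠ 0 := (lt_of_lt_of_le one_pos hp).ne'
    set M := ∫⁻ t, ‖κ t‖ₑ ∂ν with hM
    set ν' := ν.withDensity (fun t => ‖κ t‖ₑ) with hν'
    have hν'u : ν' Set.univ = M := by rw [hν', withDensity_apply _ .univ, Measure.restrict_univ]
    have hac : ν' ≪ ν := withDensity_absolutelyContinuous _ _
    have hmeas : ∀ᵐ x : Rd d, AEStronglyMeasurable (fun t => u (x - τ t)) ν := by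
      have := (hu.comp_quasiMeasurePreserving (quasiMeasurePreserving_sub_apply (ν := ν) hτ))
      exact this.prodMk_left
    have key : ∀ᵐ x : Rd d, (posAvg ν τ κ u x) ^ r ≤
        M ^ (r - 1) * ∫⁻ t, ‖κ t‖ₑ * ‖u (x - τ t)‖ₑ ^ r ∂ν := by
      filter_upwards [hmeas] with x hx
      have h1 := eLpNorm_le_eLpNorm_mul_rpow_measure_univ (μ := ν') (p := 1) (q := p) hp
        (hx.mono_ac hac)
      rw [eLpNorm_one_eq_lintegral_enorm, eLpNorm_eq_lintegral_rpow_enorm_toReal hp0 hpt, hν'u,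
        hν', lintegral_withDensity_eq_lintegral_mul₀ hκ.1.enorm hx.enorm,
        lintegral_withDensity_eq_lintegral_mul₀ hκ.1.enorm (hx.enorm.pow_const _)] at h1
      calc (posAvg ν τ κ u x) ^ r ≤ _ := ENNReal.rpow_le_rpow h1 (by positivity)
        _ = _ := by
          rw [ENNReal.mul_rpow_of_nonneg _ _ (by positivity), ← ENNReal.rpow_mul,
            ← ENNReal.rpow_mul]
          simp only [ENNReal.toReal_one, Pi.mul_apply, ← hr]
          rw [one_div_mul_cancel (by positivity), ENNReal.rpow_one, mul_comm]
          congr 2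
          field_simp
    have hF := aestronglyMeasurable_avg_kernel hτ hκ.1 hu
    rw [eLpNorm_eq_lintegral_rpow_enorm_toReal hp0 hpt, eLpNorm_eq_lintegral_rpow_enorm_toReal hp0 hpt]
    simp only [enorm_eq_self, ← hr]
    have h2 : ∫⁻ x, posAvg ν τ κ u x ^ r ≤ M ^ r * ∫⁻ x, ‖u x‖ₑ ^ r := by
      have hm2 : AEMeasurable (fun z : Rd d × Y => ‖κ z.2‖ₑ * ‖u (z.1 - τ z.2)‖ₑ ^ r)
          (volume.prod ν) :=
        hκ.1.comp_snd.enorm.mul ((hu.comp_quasiMeasurePreserving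
          (quasiMeasurePreserving_sub_apply hτ)).enorm.pow_const _)
      calc ∫⁻ x, posAvg ν τ κ u x ^ r
          ≤ ∫⁻ x, M ^ (r - 1) * ∫⁻ t, ‖κ t‖ₑ * ‖u (x - τ t)‖ₑ ^ r ∂ν := lintegral_mono_ae key
        _ = M ^ (r - 1) * ∫⁻ x, ∫⁻ t, ‖κ t‖ₑ * ‖u (x - τ t)‖ₑ ^ r ∂ν := by
          rw [lintegral_const_mul'' _ hm2.lintegral_prod_right']
        _ = M ^ (r - 1) * ∫⁻ t, ∫⁻ x, ‖κ t‖ₑ * ‖u (x - τ t)‖ₑ ^ r ∂volume ∂ν := by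
          rw [lintegral_lintegral_swap hm2]
        _ = M ^ (r - 1) * ∫⁻ t, ‖κ t‖ₑ * ∫⁻ x, ‖u x‖ₑ ^ r ∂volume ∂ν := by
          congr 1
          refine lintegral_congr fun t => ?_
          rw [lintegral_const_mul' _ _ (by simp)]
          congr 1
          exact lintegral_sub_right_eq_self (fun x => ‖u x‖ₑ ^ r) (τ t)
        _ = M ^ r * ∫⁻ x, ‖u x‖ₑ ^ r := by
          rw [lintegral_mul_const'' _ hκ.1.enorm, ← mul_assoc, ← hM]
          congr 1
          rcases eq_or_ne M 0 with h0 | h0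
          · rw [h0, ENNReal.zero_rpow_of_pos (zero_lt_one.trans_le hr1), mul_zero]
          · nth_rw 2 [← ENNReal.rpow_one M]
            rw [← ENNReal.rpow_add _ _ h0 (by
              have := hκ.2; exact this.ne)]
            congr 1; ring
    calc (∫⁻ x, posAvg ν τ κ u x ^ r) ^ (1 / r) ≤ (M ^ r * ∫⁻ x, ‖u x‖ₑ ^ r) ^ (1 / r) :=
          ENNReal.rpow_le_rpow h2 (by positivity)
      _ = _ := by
        rw [ENNReal.mul_rpow_of_nonneg _ _ (by positivity), ← ENNReal.rpow_mul,
          mul_one_div_cancel (by positivity), ENNReal.rpow_one]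

lemma eLpNorm_avg_le (hτ : Measurable τ) (hκ : Integrable κ ν)
    (hu : AEStronglyMeasurable u volume) (hp : 1 ≤ p) :
    eLpNorm (avg ν τ κ u) p volume ≤ (∫⁻ t, ‖κ t‖ₑ ∂ν) * eLpNorm u p volume :=
  (eLpNorm_mono_enorm fun x => by simpa using enorm_avg_le_posAvg x).trans
    (eLpNorm_posAvg_le hτ hκ hu hp)

lemma memLp_avg (hτ : Measurable τ) (hκ : Integrable κ ν) (hu : MemLp u p volume) (hp : 1 ≤ p) :
    MemLp (avg ν τ κ u) p volume :=
  ⟨aestronglyMeasurable_avg hτ hκ.1 hu.1, (eLpNorm_avg_le hτ hκ hu.1 hp).trans_lt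
    (ENNReal.mul_lt_top hκ.2 hu.2)⟩

lemma lintegral_enorm_mul_le [hpq : ENNReal.HolderConjugate p q] (hu : AEStronglyMeasurable u volume)
    (hv : AEStronglyMeasurable v volume) :
    ∫⁻ x, ‖u x‖ₑ * ‖v x‖ₑ ≤ eLpNorm u p volume * eLpNorm v q volume := by
  have := eLpNorm_smul_le_mul_eLpNorm (p := p) (q := q) (r := 1) hv hu
  rw [eLpNorm_one_eq_lintegral_enorm] at this
  simpa [enorm_mul] using this

lemma enorm_integral_mul_le [hpq : ENNReal.HolderConjugate p q]
    (hu : AEStronglyMeasurable u volume) (hv : AEStronglyMeasurable v volume) :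
    ‖∫ x, u x * v x‖ₑ ≤ eLpNorm u p volume * eLpNorm v q volume :=
  (enorm_integral_le_lintegral_enorm _).trans (by
    simpa [enorm_mul] using lintegral_enorm_mul_le hu hv)

lemma integrable_mul_of_holder [hpq : ENNReal.HolderConjugate p q] (hu : MemLp u p volume)
    (hv : MemLp v q volume) : Integrable (fun x => u x * v x) volume :=
  hu.integrable_mul hv

lemma integrable_avg_pairing [hpq : ENNReal.HolderConjugate p q] (hτ : Measurable τ)
    (hκ : Integrable κ ν) (hu : MemLp u p volume) (hv : MemLp v q volume) :
    Integrable (fun z : Rd d × Y => κ z.2 * u (z.1 - τ z.2) * v z.1) (volume.prod ν) := by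
  have hm : AEStronglyMeasurable (fun z : Rd d × Y => κ z.2 * u (z.1 - τ z.2) * v z.1)
    (volume.prod ν) := (aestronglyMeasurable_avg_kernel hτ hκ.1 hu.1).mul hv.1.comp_fst
  refine ⟨hm, ?_⟩
  rw [HasFiniteIntegral, lintegral_prod_symm _ hm.enorm]
  have : ∀ t : Y, ∫⁻ x : Rd d, ‖κ t * u (x - τ t) * v x‖ₑ ≤
      ‖κ t‖ₑ * (eLpNorm u p volume * eLpNorm v q volume) := fun t => by
    simp only [enorm_mul, mul_assoc]
    rw [lintegral_const_mul' _ _ (by simp)]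
    gcongr
    have hmp := measurePreserving_sub_right (volume : Measure (Rd d)) (τ t)
    rw [← eLpNorm_comp_measurePreserving hu.1 hmp]
    exact lintegral_enorm_mul_le (u := u ∘ fun x => x - τ t)
      (hu.1.comp_measurePreserving hmp) hv.1
  refine (lintegral_mono this).trans_lt ?_
  rw [lintegral_mul_const'' _ hκ.1.enorm]
  exact ENNReal.mul_lt_top hκ.2 (ENNReal.mul_lt_top hu.2 hv.2)

/-- Fubini's theorem and the substitution `x ↦ x + τ(t)`: transposition reverses the translations
and keeps the weights. -/
lemma integral_avg_mul [hpq : ENNReal.HolderConjugate p q] (hτ : Measurable τ)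
    (hκ : Integrable κ ν) (hu : MemLp u p volume) (hv : MemLp v q volume) :
    ∫ x, avg ν τ κ u x * v x = ∫ x, u x * avg ν (fun t => -τ t) κ v x := by
  have h1 := integrable_avg_pairing hτ hκ hu hv
  have : ENNReal.HolderConjugate q p := inferInstance
  have h2 := integrable_avg_pairing (p := q) (q := p) (τ := fun t => -τ t) hτ.neg hκ hv hu
  calc ∫ x, avg ν τ κ u x * v x = ∫ x, ∫ t, κ t * u (x - τ t) * v x ∂ν := by
        congr 1; ext x; rw [avg, integral_mul_const]
    _ = ∫ t, ∫ x, κ t * u (x - τ t) * v x ∂volume ∂ν := integral_integral_swap h1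
    _ = ∫ t, ∫ x, κ t * v (x - -τ t) * u x ∂volume ∂ν := by
        congr 1; ext t
        rw [← integral_add_right_eq_self _ (τ t)]
        congr 1; ext x
        simp only [add_sub_cancel_right, sub_neg_eq_add]
        ring
    _ = ∫ x, ∫ t, κ t * v (x - -τ t) * u x ∂ν ∂volume := (integral_integral_swap h2).symm
    _ = _ := by
        congr 1; ext x; rw [avg, integral_mul_const, mul_comm]

/-- On the Fourier side each translation is multiplication by a phase; Fubini's theorem collects the
phases into `avgSymbol`. Convolutions on the whole space, along one axis, or with tensor kernels are
all instances. -/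
lemma avg_fourierInv (hτ : Measurable τ) (hκ : Integrable κ ν) {g : Rd d → ℂ}
    (hg : Integrable g) : avg ν τ κ (𝓕⁻ g) = 𝓕⁻ (fun ξ => avgSymbol ν τ κ ξ * g ξ) := by
  ext x
  have hc : AEStronglyMeasurable (fun z : Y × Rd d =>
      Complex.exp ((2 * Real.pi * inner ℝ z.2 (x - τ z.1) : ℝ) * Complex.I)) (ν.prod volume) := by
    refine Measurable.aestronglyMeasurable ?_
    have : Measurable (fun z : Y × Rd d => inner ℝ z.2 (x - τ z.1)) :=
      measurable_snd.inner (measurable_const.sub (hτ.comp measurable_fst))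
    fun_prop
  have hI : Integrable (fun z : Y × Rd d => κ z.1 *
      (Complex.exp ((2 * Real.pi * inner ℝ z.2 (x - τ z.1) : ℝ) * Complex.I) * g z.2))
      (ν.prod volume) := by
    have h0 := (hκ.mul_prod hg).bdd_mul (c := 1) hc (Eventually.of_forall fun z => by
      rw [Complex.norm_exp_ofReal_mul_I])
    refine h0.congr (Eventually.of_forall fun z => ?_)
    ring
  calc avg ν τ κ (𝓕⁻ g) x
      = ∫ t, ∫ ξ, κ t * (Complex.exp ((2 * Real.pi * inner ℝ ξ (x - τ t) : ℝ) * Complex.I) * g ξ)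
          ∂volume ∂ν := by
        simp only [avg, Real.fourierInv_eq', smul_eq_mul]
        congr 1; ext t; rw [integral_const_mul]
    _ = ∫ ξ, ∫ t, κ t * (Complex.exp ((2 * Real.pi * inner ℝ ξ (x - τ t) : ℝ) * Complex.I) * g ξ)
          ∂ν ∂volume := integral_integral_swap hI
    _ = _ := by
        rw [Real.fourierInv_eq']
        congr 1; ext ξ
        rw [smul_eq_mul, avgSymbol, ← integral_mul_const, ← integral_const_mul]
        congr 1; ext t
        rw [inner_sub_right, real_inner_comm (τ t) ξ]
        have : Complex.exp (((2 * Real.pi * (inner ℝ ξ x - inner ℝ (τ t) ξ) : ℝ) : ℂ) * Complex.I)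
          = Complex.exp (((2 * Real.pi * inner ℝ ξ x : ℝ) : ℂ) * Complex.I) *
            Complex.exp (((-(2 * Real.pi * inner ℝ (τ t) ξ) : ℝ) : ℂ) * Complex.I) := by
          rw [← Complex.exp_add]; congr 1; push_cast; ring
        rw [this]; ring

lemma avgSymbol_neg (ξ : Rd d) :
    avgSymbol ν (fun t => -τ t) κ ξ = avgSymbol ν τ κ (-ξ) := by
  simp only [avgSymbol, inner_neg_left, inner_neg_right]

lemma norm_avgSymbol_le (ξ : Rd d) : ‖avgSymbol ν τ κ ξ‖ ≤ ∫ t, ‖κ t‖ ∂ν := by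
  refine (norm_integral_le_integral_norm _).trans_eq ?_
  congr 1; ext t
  rw [norm_mul, Complex.norm_exp_ofReal_mul_I, mul_one]

lemma aestronglyMeasurable_avgSymbol (hτ : Measurable τ) (hκ : AEStronglyMeasurable κ ν) :
    AEStronglyMeasurable (avgSymbol ν τ κ) volume := by
  have : AEStronglyMeasurable (fun z : Rd d × Y => κ z.2 *
      Complex.exp ((-(2 * Real.pi * inner ℝ (τ z.2) z.1) : ℝ) * Complex.I)) (volume.prod ν) := by
    refine hκ.comp_snd.mul (Measurable.aestronglyMeasurable ?_)
    have : Measurable (fun z : Rd d × Y => inner ℝ (τ z.2) z.1) :=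
      (hτ.comp measurable_snd).inner measurable_fst
    fun_prop
  exact this.integral_prod_right'

end Avg

/-! ### Bernstein's inequality and elementary facts on Lebesgue norms. -/

/-- Bernstein's inequality: averaging at scale `r` against an `L^q` kernel maps `L^p` to bounded
functions. -/
lemma enorm_avg_smul_le {p q : ℝ≥0∞} [hpq : ENNReal.HolderConjugate p q] (hpt : p ≠ ⊤)
    {κ u : Rd d → ℂ} (hκ : MemLp κ q volume) (hu : MemLp u p volume) {r : ℝ} (hr : 0 < r)
    (x : Rd d) :
    ‖avg volume (fun y => r • y) κ u x‖ₑ ≤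
      ENNReal.ofReal (r ^ (-(d / p.toReal))) * eLpNorm κ q volume * eLpNorm u p volume := by
  have hp0 : p ≠ 0 := (lt_of_lt_of_le one_pos (ENNReal.HolderConjugate.one_le p q)).ne'
  have hqmp : Measure.QuasiMeasurePreserving (fun y : Rd d => x - r • y) volume volume := by
    refine (Measure.measurePreserving_sub_left volume x).quasiMeasurePreserving.comp ?_
    refine ⟨measurable_const_smul r, ?_⟩
    rw [Measure.map_addHaar_smul _ hr.ne']
    exact Measure.smul_absolutelyContinuous
  have h1 : ‖avg volume (fun y => r • y) κ u x‖ₑ ≤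
      eLpNorm κ q volume * eLpNorm (fun y => u (x - r • y)) p volume :=
    enorm_integral_mul_le (p := q) (q := p) hκ.1 (hu.1.comp_quasiMeasurePreserving hqmp)
  refine h1.trans_eq ?_
  have h2 : eLpNorm (fun y => u (x - r • y)) p volume =
      ENNReal.ofReal (r ^ (-(d / p.toReal))) * eLpNorm u p volume := by
    rw [eLpNorm_eq_lintegral_rpow_enorm_toReal hp0 hpt,
      eLpNorm_eq_lintegral_rpow_enorm_toReal hp0 hpt]
    have hs : ∫⁻ y : Rd d, ‖u (x - r • y)‖ₑ ^ p.toReal =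
        ENNReal.ofReal (r ^ (-(d : ℝ))) * ∫⁻ y, ‖u y‖ₑ ^ p.toReal := by
      have h3 := lintegral_sub_left_eq_self (fun y => ‖u y‖ₑ ^ p.toReal) x (μ := volume)
      rw [← h3]
      have h4 := MeasureTheory.Measure.map_addHaar_smul (volume : Measure (Rd d)) hr.ne'
      have hme : MeasurableEmbedding (fun y : Rd d => r • y) :=
        (Homeomorph.smulOfNeZero r hr.ne').measurableEmbedding
      have h5 := hme.lintegral_map (μ := volume) (fun y : Rd d => ‖u (x - y)‖ₑ ^ p.toReal)
      rw [← h5, h4, lintegral_smul_measure]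
      simp only [smul_eq_mul, finrank_euclideanSpace, Fintype.card_fin]
      congr 2
      rw [abs_of_pos (by positivity), Real.rpow_neg hr.le, Real.rpow_natCast]
    rw [hs, ENNReal.mul_rpow_of_nonneg _ _ (by positivity)]
    congr 1
    rw [ENNReal.ofReal_rpow_of_pos (by positivity), ← Real.rpow_mul hr.le]
    congr 2; ring
  rw [h2]; ring

section General

lemma tendsto_integral_mul_of_eLpNorm {p q : ℝ≥0∞} [hpq : ENNReal.HolderConjugate p q]
    {a : Rd d → ℂ} (ha : MemLp a p volume) {φ : ℕ → Rd d → ℂ} {ψ : Rd d → ℂ}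
    (hφ : ∀ n, MemLp (φ n) q volume) (hψ : MemLp ψ q volume)
    (h : Tendsto (fun n => eLpNorm (φ n - ψ) q volume) atTop (𝓝 0)) :
    Tendsto (fun n => ∫ x, a x * φ n x) atTop (𝓝 (∫ x, a x * ψ x)) := by
  rw [tendsto_iff_edist_tendsto_0]
  have hb : ∀ n, edist (∫ x, a x * φ n x) (∫ x, a x * ψ x) ≤
      eLpNorm a p volume * eLpNorm (φ n - ψ) q volume := fun n => by
    rw [edist_eq_enorm_sub, ← integral_sub (integrable_mul_of_holder ha (hφ n))
      (integrable_mul_of_holder ha hψ)]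
    have := enorm_integral_mul_le (p := p) (q := q) ha.1 ((hφ n).sub hψ).1
    simpa [mul_sub] using this
  have h0 : Tendsto (fun n => eLpNorm a p volume * eLpNorm (φ n - ψ) q volume) atTop (𝓝 0) := by
    have := ENNReal.Tendsto.const_mul h (Or.inr ha.2.ne)
    simpa using this
  exact tendsto_of_tendsto_of_tendsto_of_le_of_le tendsto_const_nhds h0 (fun _ => zero_le) hb

/-- Integrate `|w|^q ≤ |w|^r ‖w‖_∞^(q-r)`. -/
lemma eLpNorm_le_rpow_mul_rpow_top {α : Type*} [MeasurableSpace α] {μ : Measure α} {w : α → ℂ}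
    (hw : AEStronglyMeasurable w μ) {r q : ℝ≥0∞} (hr : r ≠ 0) (hrq : r ≤ q) (hq : q ≠ ⊤) :
    eLpNorm w q μ ≤ eLpNorm w r μ ^ (r.toReal / q.toReal) *
      eLpNorm w ⊤ μ ^ (1 - r.toReal / q.toReal) := by
  have hrt : r ≠ ⊤ := (hrq.trans_lt hq.lt_top).ne
  have hq0 : q ≠ 0 := (lt_of_lt_of_le (pos_iff_ne_zero.2 hr) hrq).ne'
  have hr0 := ENNReal.toReal_pos hr hrt
  have hq0' := ENNReal.toReal_pos hq0 hq
  have hrq' : r.toReal ≤ q.toReal := ENNReal.toReal_mono hq hrq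
  rw [eLpNorm_eq_lintegral_rpow_enorm_toReal hq0 hq, eLpNorm_eq_lintegral_rpow_enorm_toReal hr hrt]
  set M := eLpNorm w ⊤ μ
  have hae : ∀ᵐ x ∂μ, ‖w x‖ₑ ≤ M := by
    simp only [M, eLpNorm_exponent_top]; exact enorm_ae_le_eLpNormEssSup w μ
  have h1 : ∫⁻ x, ‖w x‖ₑ ^ q.toReal ∂μ ≤
      (∫⁻ x, ‖w x‖ₑ ^ r.toReal ∂μ) * M ^ (q.toReal - r.toReal) := by
    rw [← lintegral_mul_const'' _ (hw.enorm.pow_const _)]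
    refine lintegral_mono_ae ?_
    filter_upwards [hae] with x hx
    calc ‖w x‖ₑ ^ q.toReal = ‖w x‖ₑ ^ (r.toReal + (q.toReal - r.toReal)) := by congr 1; ring
      _ = ‖w x‖ₑ ^ r.toReal * ‖w x‖ₑ ^ (q.toReal - r.toReal) :=
        ENNReal.rpow_add_of_nonneg _ _ hr0.le (by linarith)
      _ ≤ _ := by gcongr
  refine (ENNReal.rpow_le_rpow h1 (by positivity)).trans_eq ?_
  rw [ENNReal.mul_rpow_of_nonneg _ _ (by positivity), ← ENNReal.rpow_mul, ← ENNReal.rpow_mul]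
  congr 2 <;> field_simp

lemma tendsto_zero_of_le_mul_rpow {A : ℝ≥0∞} (hA : A ≠ ⊤) {θ : ℝ} (hθ : 0 < θ) {f b : ℕ → ℝ≥0∞}
    (hb : Tendsto b atTop (𝓝 0)) (h : ∀ n, f n ≤ A * b n ^ θ) : Tendsto f atTop (𝓝 0) := by
  have h1 : Tendsto (fun n => b n ^ θ) atTop (𝓝 ((0 : ℝ≥0∞) ^ θ)) :=
    ((ENNReal.continuous_rpow_const (y := θ)).tendsto 0).comp hb
  have h2 : Tendsto (fun n => A * b n ^ θ) atTop (𝓝 (A * (0 : ℝ≥0∞) ^ θ)) :=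
    ENNReal.Tendsto.const_mul h1 (Or.inr hA)
  rw [ENNReal.zero_rpow_of_pos hθ, mul_zero] at h2
  exact tendsto_of_tendsto_of_tendsto_of_le_of_le tendsto_const_nhds h2 (fun _ => zero_le) h

lemma enorm_fourierInv_le (g : Rd d → ℂ) (x : Rd d) : ‖𝓕⁻ g x‖ₑ ≤ ∫⁻ ξ, ‖g ξ‖ₑ := by
  rw [Real.fourierInv_eq']
  refine (enorm_integral_le_lintegral_enorm _).trans_eq ?_
  congr 1; ext ξ
  rw [enorm_smul]
  have : ‖Complex.exp (((2 * Real.pi * inner ℝ ξ x : ℝ) : ℂ) * Complex.I)‖ₑ = 1 := by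
    rw [← ofReal_norm, Complex.norm_exp_ofReal_mul_I, ENNReal.ofReal_one]
  rw [this, one_mul]

lemma integrable_exp_smul {g : Rd d → ℂ} (hg : Integrable g) (x : Rd d) :
    Integrable (fun ξ => Complex.exp (((2 * Real.pi * inner ℝ ξ x : ℝ) : ℂ) * Complex.I) • g ξ) := by
  refine hg.bdd_mul (c := 1) ?_ (Eventually.of_forall fun ξ => ?_)
  · exact Continuous.aestronglyMeasurable (by fun_prop)
  · rw [Complex.norm_exp_ofReal_mul_I]

lemma fourierInv_sub {g h : Rd d → ℂ} (hg : Integrable g) (hh : Integrable h) :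
    𝓕⁻ (g - h) = 𝓕⁻ g - 𝓕⁻ h := by
  ext x
  simp only [Real.fourierInv_eq', Pi.sub_apply, smul_sub]
  exact integral_sub (integrable_exp_smul hg x) (integrable_exp_smul hh x)

lemma fourierInv_add {g h : Rd d → ℂ} (hg : Integrable g) (hh : Integrable h) :
    𝓕⁻ (g + h) = 𝓕⁻ g + 𝓕⁻ h := by
  ext x
  simp only [Real.fourierInv_eq', Pi.add_apply, smul_add]
  exact integral_add (integrable_exp_smul hg x) (integrable_exp_smul hh x)

lemma fourierInv_const_mul (c : ℂ) (g : Rd d → ℂ) :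
    𝓕⁻ (fun ξ => c * g ξ) = fun x => c * 𝓕⁻ g x := by
  ext x
  simp only [Real.fourierInv_eq', ← integral_const_mul, smul_eq_mul]
  congr 1; ext ξ; ring

end General

/-! ### Amplitudes and the symbols that act on them. -/

/-- Frequencies off the coordinate hyperplanes. -/
def offHyper (d : ℕ) : Set (Rd d) := {ξ | ∀ i, ξ i ≠ 0}

lemma isOpen_offHyper : IsOpen (offHyper d) := by
  simp only [offHyper, Set.ofPred_forall]
  exact isOpen_iInter_of_finite fun i =>
    isOpen_ne_fun (by fun_prop) continuous_const

lemma ae_mem_offHyper : ∀ᵐ ξ : Rd d, ξ ∈ offHyper d := by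
  simp only [offHyper, Set.mem_ofPred_eq]
  rw [ae_all_iff]
  intro i
  let L : Submodule ℝ (Rd d) := LinearMap.ker (EuclideanSpace.proj i : Rd d →L[ℝ] ℝ).toLinearMap
  have hL : L ≠ ⊤ := by
    intro h
    have : EuclideanSpace.single i (1 : ℝ) ∈ L := h ▸ Submodule.mem_top
    simp [L] at this
  have h0 := Measure.addHaar_submodule (volume : Measure (Rd d)) L hL
  rw [ae_iff]
  refine measure_mono_null (fun ξ hξ => ?_) h0
  simpa [L] using hξ

lemma contDiff_of_contDiffAt_tsupport {m : Rd d → ℂ} (h : ∀ ξ ∈ tsupport m, ContDiffAt ℝ ∞ m ξ) :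
    ContDiff ℝ ∞ m := by
  rw [contDiff_iff_contDiffAt]
  intro ξ
  by_cases hξ : ξ ∈ tsupport m
  · exact h ξ hξ
  · exact contDiffAt_const.congr_of_eventuallyEq (notMem_tsupport_iff_eventuallyEq.1 hξ)

/-- Amplitudes: smooth functions with compact support off the coordinate hyperplanes. -/
structure IsAmp (g : Rd d → ℂ) : Prop where
  smooth : ContDiff ℝ ∞ g
  compact : HasCompactSupport g
  off : tsupport g ⊆ offHyper d

/-- Symbols that are smooth off the coordinate hyperplanes. -/
def IsSym (m : Rd d → ℂ) : Prop := ContDiffOn ℝ ∞ m (offHyper d)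

lemma IsSym.mul {m n : Rd d → ℂ} (hm : IsSym m) (hn : IsSym n) : IsSym (fun ξ => m ξ * n ξ) :=
  ContDiffOn.mul hm hn

lemma IsSym.neg_arg {m : Rd d → ℂ} (hm : IsSym m) : IsSym (fun ξ => m (-ξ)) :=
  ContDiffOn.comp hm contDiff_neg.contDiffOn (fun ξ hξ i => by simpa using hξ i)

lemma IsSym.prod {ι : Type*} {s : Finset ι} {m : ι → Rd d → ℂ} (hm : ∀ i ∈ s, IsSym (m i)) :
    IsSym (fun ξ => ∏ i ∈ s, m i ξ) :=
  contDiffOn_prod fun i hi => hm i hi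

namespace IsAmp

variable {g h : Rd d → ℂ}

/-- This stability is the reason for avoiding the hyperplanes: `|ξ_i|` and the sign of `ξ_i` are
smooth off them, so Riesz projections and `e^{-aΛ₁}` keep amplitudes smooth. -/
lemma mul_sym (hg : IsAmp g) {m : Rd d → ℂ} (hm : IsSym m) : IsAmp (fun ξ => m ξ * g ξ) where
  smooth := by
    refine contDiff_of_contDiffAt_tsupport fun ξ hξ => ?_
    have hξ' : ξ ∈ offHyper d := hg.off (tsupport_mul_subset_right hξ)
    exact (hm.contDiffAt (isOpen_offHyper.mem_nhds hξ')).mul hg.smooth.contDiffAt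
  compact := hg.compact.mul_left
  off := (tsupport_mul_subset_right).trans hg.off

lemma add (hg : IsAmp g) (hh : IsAmp h) : IsAmp (g + h) :=
  ⟨hg.smooth.add hh.smooth, hg.compact.add hh.compact,
    (tsupport_add g h).trans (Set.union_subset hg.off hh.off)⟩

lemma const_mul (hg : IsAmp g) (c : ℂ) : IsAmp (fun ξ => c * g ξ) :=
  hg.mul_sym (m := fun _ => c) contDiffOn_const

lemma sub (hg : IsAmp g) (hh : IsAmp h) : IsAmp (g - h) := by
  have := hg.add (hh.const_mul (-1))
  convert this using 1
  ext ξ; simp [sub_eq_add_neg]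

lemma neg_arg (hg : IsAmp g) : IsAmp (fun ξ => g (-ξ)) where
  smooth := hg.smooth.comp contDiff_neg
  compact := hg.compact.comp_homeomorph (Homeomorph.neg (Rd d))
  off := by
    intro ξ hξ i
    have h1 : tsupport (fun ξ => g (-ξ)) = (Homeomorph.neg (Rd d)) ⁻¹' tsupport g :=
      tsupport_comp_eq_preimage g (Homeomorph.neg (Rd d))
    rw [h1] at hξ
    have := hg.off hξ i
    simpa using this

lemma conj_neg (hg : IsAmp g) : IsAmp (fun ξ => (starRingEnd ℂ) (g (-ξ))) where
  smooth := Complex.conjCLE.contDiff.comp hg.neg_arg.smooth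
  compact := hg.neg_arg.compact.comp_left (map_zero _)
  off := (closure_mono (fun ξ hξ => by
    simp only [Function.mem_support] at hξ ⊢
    intro h0; exact hξ (by rw [h0, map_zero]))).trans hg.neg_arg.off

/-- The Schwartz function whose Fourier transform is the amplitude. -/
def toS (hg : IsAmp g) : 𝓢(Rd d, ℂ) := 𝓕⁻ (hg.compact.toSchwartzMap hg.smooth)

lemma coe_toS (hg : IsAmp g) : (hg.toS : Rd d → ℂ) = 𝓕⁻ g := by
  rw [toS, SchwartzMap.fourierInv_coe]; rfl

lemma integrable (hg : IsAmp g) : Integrable g :=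
  hg.smooth.continuous.integrable_of_hasCompactSupport hg.compact

lemma memLp (hg : IsAmp g) (p : ℝ≥0∞) : MemLp (𝓕⁻ g) p volume := by
  rw [← hg.coe_toS]; exact hg.toS.memLp p

lemma continuous_fourierInv (hg : IsAmp g) : Continuous (𝓕⁻ g) := by
  rw [← hg.coe_toS]; exact hg.toS.continuous

lemma fourier_fourierInv (hg : IsAmp g) : 𝓕 (𝓕⁻ g) = g := by
  rw [← hg.coe_toS, ← SchwartzMap.fourier_coe, toS, FourierTransform.fourier_fourierInv_eq]
  rfl

end IsAmp

/-! ### Cut-offs near the hyperplanes and density of amplitudes in `L^p`. -/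

/-- `m` is a multiplier of `L^p`, with norm at most `C`, on integrable amplitudes. -/
def MulL (p : ℝ≥0∞) (m : Rd d → ℂ) (C : ℝ≥0∞) : Prop :=
  ∀ g : Rd d → ℂ, Integrable g → MemLp (𝓕⁻ g) p volume →
    Integrable (fun ξ => m ξ * g ξ) ∧ MemLp (𝓕⁻ (fun ξ => m ξ * g ξ)) p volume ∧
    eLpNorm (𝓕⁻ (fun ξ => m ξ * g ξ)) p volume ≤ C * eLpNorm (𝓕⁻ g) p volume

namespace MulL

variable {p : ℝ≥0∞} {m n : Rd d → ℂ} {A B : ℝ≥0∞}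

lemma avgSymbol {Y : Type*} [MeasurableSpace Y] {ν : Measure Y} [SFinite ν] {τ : Y → Rd d}
    {κ : Y → ℂ} (hτ : Measurable τ) (hκ : Integrable κ ν) (hp : 1 ≤ p) :
    MulL p (GevreyBesov.avgSymbol ν τ κ) (∫⁻ t, ‖κ t‖ₑ ∂ν) := by
  intro g hg hgp
  have h1 := avg_fourierInv hτ hκ hg
  refine ⟨?_, ?_, ?_⟩
  · exact hg.bdd_mul (c := ∫ t, ‖κ t‖ ∂ν) (aestronglyMeasurable_avgSymbol hτ hκ.1)
      (Eventually.of_forall norm_avgSymbol_le)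
  · rw [← h1]; exact memLp_avg hτ hκ hgp hp
  · rw [← h1]; exact eLpNorm_avg_le hτ hκ hgp.1 hp

lemma mul (hm : MulL p m A) (hn : MulL p n B) : MulL p (fun ξ => m ξ * n ξ) (A * B) := by
  intro g hg hgp
  obtain ⟨h1, h2, h3⟩ := hn g hg hgp
  obtain ⟨h4, h5, h6⟩ := hm _ h1 h2
  simp only [← mul_assoc] at h4 h5 h6 ⊢
  exact ⟨h4, h5, by
    rw [mul_assoc]
    exact h6.trans (by gcongr)⟩

lemma sub (hp : 1 ≤ p) (hm : MulL p m A) (hn : MulL p n B) :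
    MulL p (fun ξ => m ξ - n ξ) (A + B) := by
  intro g hg hgp
  obtain ⟨h1, h2, h3⟩ := hn g hg hgp
  obtain ⟨h4, h5, h6⟩ := hm g hg hgp
  have e : (fun ξ => (m ξ - n ξ) * g ξ) = (fun ξ => m ξ * g ξ) - fun ξ => n ξ * g ξ := by
    ext ξ; simp [sub_mul]
  rw [e, fourierInv_sub h4 h1]
  refine ⟨h4.sub h1, h5.sub h2, (eLpNorm_sub_le h5.1 h2.1 hp).trans ?_⟩
  rw [add_mul]; gcongr

lemma one : MulL p (fun _ : Rd d => (1 : ℂ)) 1 := fun g hg hgp => by simp [hg, hgp]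

lemma prod {ι : Type*} (s : Finset ι) {m : ι → Rd d → ℂ} {C : ℝ≥0∞}
    (h : ∀ i ∈ s, MulL p (m i) C) : MulL p (fun ξ => ∏ i ∈ s, m i ξ) (C ^ s.card) := by
  classical
  induction s using Finset.induction_on with
  | empty => simpa using one
  | insert a s ha ih =>
    simp only [Finset.prod_insert ha, Finset.card_insert_of_notMem ha, pow_succ']
    exact (h a (by simp)).mul (ih fun i hi => h i (by simp [hi]))

end MulL

/-- A smooth even-scale cut-off on the line. -/
def lineBump : ContDiffBump (0 : ℝ) := ⟨1, 2, one_pos, one_lt_two⟩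

/-- The bump function as a complex valued Schwartz function on the line. -/
def lineBumpS : 𝓢(ℝ, ℂ) :=
  HasCompactSupport.toSchwartzMap (f := fun t => (lineBump t : ℂ))
    (lineBump.hasCompactSupport.comp_left (g := fun t : ℝ => (t : ℂ)) Complex.ofReal_zero)
    (Complex.ofRealCLM.contDiff.comp lineBump.contDiff)

/-- The kernel whose symbol is `lineBump`. -/
def lineKernel : 𝓢(ℝ, ℂ) := 𝓕⁻ lineBumpS

/-- Averaging along the `i`-th axis realizes a symbol depending on `ξ i` only. -/
lemma avgSymbol_line (κ : 𝓢(ℝ, ℂ)) (r : ℝ) (i : Fin d) (ξ : Rd d) :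
    avgSymbol volume (fun t : ℝ => (r * t) • EuclideanSpace.single i (1 : ℝ)) κ ξ =
      𝓕 κ (r * ξ i) := by
  rw [SchwartzMap.fourier_coe, Real.fourier_eq', avgSymbol]
  congr 1; ext t
  rw [smul_eq_mul, mul_comm]
  congr 3
  simp only [inner_smul_left, EuclideanSpace.inner_single_left, map_one, one_mul]
  simp
  ring

/-- The bound does not depend on the scale `r`, which only dilates the translations and leaves the
weights alone. Hence `hyperCut n` is a multiplier of `L^p`, including `L^1`, uniformly in `n`. -/
lemma mulL_lineBump {p : ℝ≥0∞} (hp : 1 ≤ p) (r : ℝ) (i : Fin d) :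
    MulL p (fun ξ : Rd d => (lineBump (r * ξ i) : ℂ)) (∫⁻ t, ‖lineKernel t‖ₑ) := by
  have h := MulL.avgSymbol (d := d) (p := p) (ν := volume)
    (τ := fun t : ℝ => (r * t) • EuclideanSpace.single i (1 : ℝ)) (κ := lineKernel)
    (by fun_prop) lineKernel.integrable hp
  convert h using 2 with ξ
  rw [avgSymbol_line, lineKernel, FourierTransform.fourier_fourierInv_eq]
  rfl

/-- The cut-off away from the coordinate hyperplanes and from infinity. -/
def hyperCut (n : ℕ) (ξ : Rd d) : ℂ :=
  ∏ i, ((lineBump ((n + 1 : ℝ)⁻¹ * ξ i) : ℂ) - (lineBump ((n + 1 : ℝ) * ξ i) : ℂ))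

lemma mulL_hyperCut {p : ℝ≥0∞} (hp : 1 ≤ p) (n : ℕ) :
    MulL p (hyperCut (d := d) n)
      (((∫⁻ t, ‖lineKernel t‖ₑ) + ∫⁻ t, ‖lineKernel t‖ₑ) ^ d) := by
  have := MulL.prod (p := p) (Finset.univ : Finset (Fin d)) (fun i _ =>
    (mulL_lineBump hp (n + 1 : ℝ)⁻¹ i).sub hp (mulL_lineBump hp (n + 1 : ℝ) i))
  simp only [Finset.card_univ, Fintype.card_fin] at this
  exact this

lemma contDiff_hyperCut (n : ℕ) : ContDiff ℝ ∞ (hyperCut (d := d) n) := by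
  unfold hyperCut
  refine contDiff_prod fun i _ => ?_
  have hi : ContDiff ℝ ∞ (fun ξ : Rd d => ξ i) := (EuclideanSpace.proj (𝕜 := ℝ) i).contDiff
  exact (Complex.ofRealCLM.contDiff.comp (lineBump.contDiff.comp (contDiff_const.mul hi))).sub
    (Complex.ofRealCLM.contDiff.comp (lineBump.contDiff.comp (contDiff_const.mul hi)))

/-- A factor is a difference of one bump at two scales: both bumps equal one for small `ξ i` and
both vanish for large `ξ i`. -/
lemma hyperCut_ne_zero {n : ℕ} {ξ : Rd d} (h : hyperCut n ξ ≠ 0) (i : Fin d) :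
    (n + 1 : ℝ)⁻¹ ≤ |ξ i| ∧ |ξ i| ≤ 2 * (n + 1) := by
  have h1 := Finset.prod_ne_zero_iff.1 h i (Finset.mem_univ i)
  have hn : (0 : ℝ) < n + 1 := by positivity
  constructor
  · by_contra! hlt
    apply h1
    have a1 : lineBump ((n + 1 : ℝ)⁻¹ * ξ i) = 1 := by
      apply lineBump.one_of_mem_closedBall
      rw [mem_closedBall_zero_iff, Real.norm_eq_abs, abs_mul, abs_of_pos (by positivity)]
      have : (n + 1 : ℝ)⁻¹ ≤ 1 := inv_le_one_of_one_le₀ (by linarith [n.cast_nonneg (α := ℝ)])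
      show _ ≤ (1 : ℝ)
      nlinarith [abs_nonneg (ξ i), inv_pos.2 hn]
    have a2 : lineBump ((n + 1 : ℝ) * ξ i) = 1 := by
      apply lineBump.one_of_mem_closedBall
      rw [mem_closedBall_zero_iff, Real.norm_eq_abs, abs_mul, abs_of_pos (by positivity)]
      show _ ≤ (1 : ℝ)
      calc (n + 1 : ℝ) * |ξ i| ≤ (n + 1) * (n + 1 : ℝ)⁻¹ := by gcongr
        _ = 1 := mul_inv_cancel₀ hn.ne'
    rw [a1, a2]; simp
  · by_contra! hlt
    apply h1
    have hn1 : (1 : ℝ) ≤ n + 1 := by linarith [n.cast_nonneg (α := ℝ)]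
    have a1 : lineBump ((n + 1 : ℝ)⁻¹ * ξ i) = 0 := by
      apply lineBump.zero_of_le_dist
      rw [dist_zero_right, Real.norm_eq_abs, abs_mul, abs_of_pos (by positivity)]
      show (2 : ℝ) ≤ _
      rw [inv_mul_eq_div, le_div_iff₀ hn]; linarith
    have a2 : lineBump ((n + 1 : ℝ) * ξ i) = 0 := by
      apply lineBump.zero_of_le_dist
      rw [dist_zero_right, Real.norm_eq_abs, abs_mul, abs_of_pos (by positivity)]
      show (2 : ℝ) ≤ _
      nlinarith [abs_nonneg (ξ i)]
    rw [a1, a2]; simp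

lemma isAmp_hyperCut_mul (n : ℕ) {g : Rd d → ℂ} (hg : ContDiff ℝ ∞ g) :
    IsAmp (fun ξ => hyperCut n ξ * g ξ) := by
  let K : Set (Rd d) := {ξ | ∀ i, (n + 1 : ℝ)⁻¹ ≤ |ξ i| ∧ |ξ i| ≤ 2 * (n + 1)}
  have hsub : Function.support (fun ξ => hyperCut n ξ * g ξ) ⊆ K := fun ξ hξ i =>
    hyperCut_ne_zero (left_ne_zero_of_mul hξ) i
  have hKc : IsClosed K := by
    simp only [K, Set.ofPred_forall]
    refine isClosed_iInter fun i => ?_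
    have hi : Continuous fun ξ : Rd d => |ξ i| := by fun_prop
    exact (isClosed_le continuous_const hi).inter (isClosed_le hi continuous_const)
  have hKb : IsCompact K := by
    refine Metric.isCompact_of_isClosed_isBounded hKc ?_
    refine (Metric.isBounded_closedBall (x := (0 : Rd d)) (r := √(d * (2 * (n + 1)) ^ 2))).subset ?_
    intro ξ hξ
    rw [mem_closedBall_zero_iff, EuclideanSpace.norm_eq]
    apply Real.sqrt_le_sqrt
    calc ∑ i, ‖ξ i‖ ^ 2 ≤ ∑ _i : Fin d, (2 * (n + 1 : ℝ)) ^ 2 := by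
          refine Finset.sum_le_sum fun i _ => ?_
          have := (hξ i).2
          rw [Real.norm_eq_abs]; gcongr
      _ = _ := by simp
  have ht : tsupport (fun ξ => hyperCut n ξ * g ξ) ⊆ K := closure_minimal hsub hKc
  refine ⟨(contDiff_hyperCut n).mul hg, hKb.of_isClosed_subset (isClosed_tsupport _) ht, ?_⟩
  intro ξ hξ i h0
  have := (ht hξ i).1
  rw [h0, abs_zero] at this
  have hn : (0 : ℝ) < (n + 1 : ℝ)⁻¹ := by positivity
  linarith

lemma norm_hyperCut_le (n : ℕ) (ξ : Rd d) : ‖hyperCut n ξ‖ ≤ 1 := by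
  rw [hyperCut, norm_prod]
  refine Finset.prod_le_one (fun i _ => norm_nonneg _) fun i _ => ?_
  rw [← Complex.ofReal_sub, Complex.norm_real, Real.norm_eq_abs, abs_le]
  have h1 := lineBump.nonneg (x := (n + 1 : ℝ)⁻¹ * ξ i)
  have h2 := lineBump.le_one (x := (n + 1 : ℝ)⁻¹ * ξ i)
  have h3 := lineBump.nonneg (x := (n + 1 : ℝ) * ξ i)
  have h4 := lineBump.le_one (x := (n + 1 : ℝ) * ξ i)
  constructor <;> linarith

lemma tendsto_hyperCut {ξ : Rd d} (hξ : ξ ∈ offHyper d) :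
    Tendsto (fun n => hyperCut n ξ) atTop (𝓝 1) := by
  refine tendsto_const_nhds.congr' ?_
  have h : ∀ i : Fin d, ∀ᶠ n : ℕ in atTop,
      ((lineBump ((n + 1 : ℝ)⁻¹ * ξ i) : ℂ) - (lineBump ((n + 1 : ℝ) * ξ i) : ℂ)) = 1 := by
    intro i
    have hi := abs_pos.2 (hξ i)
    filter_upwards [tendsto_natCast_atTop_atTop.eventually_ge_atTop |ξ i|,
      tendsto_natCast_atTop_atTop.eventually_ge_atTop (2 / |ξ i|)] with n h1 h2
    have hn : (0 : ℝ) < n + 1 := by positivity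
    have a1 : lineBump ((n + 1 : ℝ)⁻¹ * ξ i) = 1 := by
      apply lineBump.one_of_mem_closedBall
      rw [mem_closedBall_zero_iff, Real.norm_eq_abs, abs_mul, abs_of_pos (by positivity)]
      show _ ≤ (1 : ℝ)
      rw [inv_mul_eq_div, div_le_one hn]; linarith
    have a2 : lineBump ((n + 1 : ℝ) * ξ i) = 0 := by
      apply lineBump.zero_of_le_dist
      rw [dist_zero_right, Real.norm_eq_abs, abs_mul, abs_of_pos (by positivity)]
      show (2 : ℝ) ≤ _
      rw [div_le_iff₀ hi] at h2
      nlinarith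
    rw [a1, a2]; simp
  filter_upwards [eventually_all.2 h] with n hn
  simp [hyperCut, hn]

lemma exists_mulL_hyperCut {p : ℝ≥0∞} (hp : 1 ≤ p) :
    ∃ M : ℝ≥0∞, M ≠ ⊤ ∧ ∀ n, MulL p (hyperCut (d := d) n) M := by
  refine ⟨_, ?_, fun n => mulL_hyperCut hp n⟩
  have := (SchwartzMap.integrable lineKernel (μ := volume)).2.ne
  exact ENNReal.pow_ne_top (ENNReal.add_ne_top.2 ⟨this, this⟩)

lemma exists_fourierInv_eq (φ : 𝓢(Rd d, ℂ)) : ∃ Φ : 𝓢(Rd d, ℂ), ⇑φ = 𝓕⁻ ⇑Φ :=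
  ⟨𝓕 φ, by rw [← SchwartzMap.fourierInv_coe, FourierTransform.fourierInv_fourier_eq]⟩

lemma tendsto_lintegral_hyperCut {G : Rd d → ℂ} (hG : Integrable G) :
    Tendsto (fun n => ∫⁻ ξ, ‖hyperCut n ξ * G ξ - G ξ‖ₑ) atTop (𝓝 0) := by
  have : Tendsto (fun n => ∫⁻ ξ, ‖hyperCut n ξ * G ξ - G ξ‖ₑ) atTop (𝓝 (∫⁻ _ : Rd d, 0)) := by
    refine tendsto_lintegral_of_dominated_convergence' (fun ξ => 2 * ‖G ξ‖ₑ) ?_ ?_ ?_ ?_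
    · intro n
      exact (((contDiff_hyperCut n).continuous.aestronglyMeasurable.mul hG.1).sub hG.1).enorm
    · intro n
      refine Eventually.of_forall fun ξ => ?_
      simp only [two_mul]
      refine enorm_sub_le.trans (add_le_add ?_ le_rfl)
      simp only [enorm_mul]
      refine (mul_le_mul_left ?_ _).trans_eq (one_mul _)
      rw [← ofReal_norm]
      exact ENNReal.ofReal_le_one.2 (norm_hyperCut_le n ξ)
    · rw [lintegral_const_mul'' _ hG.1.enorm]
      exact ENNReal.mul_ne_top (by simp) hG.2.ne
    · filter_upwards [ae_mem_offHyper (d := d)] with ξ hξ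
      have : Tendsto (fun n => hyperCut n ξ * G ξ - G ξ) atTop (𝓝 (1 * G ξ - G ξ)) :=
        ((tendsto_hyperCut hξ).mul_const _).sub_const _
      simpa using this.enorm
  simpa using this

lemma eLpNorm_fourierInv_sub_top_le {g h : Rd d → ℂ} (hg : Integrable g) (hh : Integrable h) :
    eLpNorm (𝓕⁻ g - 𝓕⁻ h) ⊤ volume ≤ ∫⁻ ξ, ‖g ξ - h ξ‖ₑ := by
  rw [← fourierInv_sub hg hh, eLpNorm_exponent_top]
  exact essSup_le_of_ae_le _ (Eventually.of_forall fun x => enorm_fourierInv_le _ x)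

/-- Schwartz functions are approximated by amplitudes, in all `L^q`, `1 < q < ∞`, at once. -/
lemma exists_amp_approx (φ : 𝓢(Rd d, ℂ)) : ∃ g : ℕ → Rd d → ℂ, (∀ n, IsAmp (g n)) ∧
    ∀ q : ℝ≥0∞, 1 < q → q ≠ ⊤ →
      Tendsto (fun n => eLpNorm (𝓕⁻ (g n) - ⇑φ) q volume) atTop (𝓝 0) := by
  obtain ⟨Φ, hφ⟩ := exists_fourierInv_eq φ
  have hg : ∀ n, IsAmp (fun ξ => hyperCut n ξ * Φ ξ) := fun n => isAmp_hyperCut_mul n (Φ.smooth ⊤)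
  refine ⟨fun n ξ => hyperCut n ξ * Φ ξ, hg, fun q hq hqt => ?_⟩
  have hφi : Integrable ⇑Φ := Φ.integrable
  obtain ⟨M, hM, hmul⟩ := exists_mulL_hyperCut (d := d) (p := 1) le_rfl
  have hq1 : 1 / q.toReal < 1 := by
    have : 1 < q.toReal := by simpa using ENNReal.toReal_strict_mono hqt hq
    rw [div_lt_one (by linarith)]; exact this
  have e1 : 0 ≤ 1 / q.toReal := by positivity
  have hφ1 : MemLp (𝓕⁻ ⇑Φ) 1 volume := hφ ▸ φ.memLp 1
  rw [hφ]
  generalize hψ : 𝓕⁻ ⇑Φ = ψ at *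
  have h1 : ∀ n, eLpNorm (𝓕⁻ (fun ξ => hyperCut n ξ * Φ ξ) - ψ) 1 volume ≤
      M * eLpNorm ψ 1 volume + eLpNorm ψ 1 volume := by
    intro n
    have h := (hmul n Φ hφi (hψ ▸ hφ1)).2.2
    rw [hψ] at h
    exact (eLpNorm_sub_le ((hg n).memLp 1).1 hφ1.1 le_rfl).trans (add_le_add h le_rfl)
  -- Interpolation between a uniform `L^1` bound and uniform convergence, the latter coming from
  -- `L^1` convergence on the Fourier side. The power `1 - 1/q` of the second factor is positive
  -- because `q > 1`.
  have h4 : ∀ n, eLpNorm (𝓕⁻ (fun ξ => hyperCut n ξ * Φ ξ) - ψ) q volume ≤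
      (M * eLpNorm ψ 1 volume + eLpNorm ψ 1 volume) ^ (1 / q.toReal) *
      (∫⁻ ξ, ‖hyperCut n ξ * Φ ξ - Φ ξ‖ₑ) ^ (1 - 1 / q.toReal) := by
    intro n
    have := eLpNorm_le_rpow_mul_rpow_top (μ := volume) (((hg n).memLp 1).sub hφ1).1
      (r := 1) (q := q) one_ne_zero hq.le hqt
    rw [ENNReal.toReal_one] at this
    have h3 := eLpNorm_fourierInv_sub_top_le (hg n).integrable hφi
    rw [hψ] at h3
    exact this.trans (mul_le_mul' (ENNReal.rpow_le_rpow (h1 n) e1)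
      (ENNReal.rpow_le_rpow h3 (sub_nonneg.2 hq1.le)))
  exact tendsto_zero_of_le_mul_rpow (ENNReal.rpow_ne_top_of_nonneg e1
    (ENNReal.add_ne_top.2 ⟨ENNReal.mul_ne_top hM hφ1.2.ne, hφ1.2.ne⟩))
    (sub_pos.2 hq1) (tendsto_lintegral_hyperCut hφi) h4

lemma exists_schwartz_approx {p : ℝ≥0∞} (hp : 1 ≤ p) (hpt : p ≠ ⊤) {f : Rd d → ℂ}
    (hf : MemLp f p volume) {ε : ℝ≥0∞} (hε : 0 < ε) :
    ∃ φ : 𝓢(Rd d, ℂ), eLpNorm (⇑φ - f) p volume ≤ ε := by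
  rcases eq_or_ne ε ⊤ with rfl | hεt
  · exact ⟨0, le_top⟩
  obtain ⟨g, h1, h2, h3⟩ := MemLp.exist_eLpNorm_sub_le hpt hp hf (ENNReal.toReal_pos hε.ne' hεt)
  refine ⟨h1.toSchwartzMap h2, ?_⟩
  rw [eLpNorm_sub_comm]
  rwa [ENNReal.ofReal_toReal hεt] at h3

/-- Functions with amplitudes are dense in `L^p`, `1 < p < ∞`. -/
lemma exists_amp_dense {p : ℝ≥0∞} (hp : 1 < p) (hpt : p ≠ ⊤) {f : Rd d → ℂ}
    (hf : MemLp f p volume) : ∃ g : ℕ → Rd d → ℂ, (∀ n, IsAmp (g n)) ∧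
      Tendsto (fun n => eLpNorm (𝓕⁻ (g n) - f) p volume) atTop (𝓝 0) := by
  have key : ∀ n : ℕ, ∃ g : Rd d → ℂ, IsAmp g ∧
      eLpNorm (𝓕⁻ g - f) p volume ≤ (n + 1 : ℝ≥0∞)⁻¹ := by
    intro n
    have hε : (0 : ℝ≥0∞) < (n + 1 : ℝ≥0∞)⁻¹ / 2 := by
      refine ENNReal.half_pos (ENNReal.inv_ne_zero.2 ?_)
      exact ENNReal.add_ne_top.2 ⟨ENNReal.natCast_ne_top n, ENNReal.one_ne_top⟩
    obtain ⟨φ, hφ⟩ := exists_schwartz_approx hp.le hpt hf hε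
    obtain ⟨g, hg, hlim⟩ := exists_amp_approx φ
    obtain ⟨k, hk⟩ := ((hlim p hp hpt).eventually (gt_mem_nhds hε)).exists
    refine ⟨g k, hg k, ?_⟩
    have e : 𝓕⁻ (g k) - f = (𝓕⁻ (g k) - ⇑φ) + (⇑φ - f) := by simp
    rw [e]
    refine (eLpNorm_add_le (((hg k).memLp p).sub (φ.memLp p)).1 ((φ.memLp p).sub hf).1 hp.le).trans ?_
    calc _ ≤ (n + 1 : ℝ≥0∞)⁻¹ / 2 + (n + 1 : ℝ≥0∞)⁻¹ / 2 := add_le_add hk.le hφ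
      _ = _ := ENNReal.add_halves _
  choose g hg hb using key
  refine ⟨g, hg, ?_⟩
  refine tendsto_of_tendsto_of_tendsto_of_le_of_le tendsto_const_nhds ?_ (fun _ => zero_le) hb
  have := ENNReal.tendsto_inv_nat_nhds_zero.comp (tendsto_add_atTop_nat 1)
  refine this.congr fun n => ?_
  simp

lemma ae_eq_zero_of_forall_schwartz {w : Rd d → ℂ} (hw : LocallyIntegrable w volume)
    (h : ∀ φ : 𝓢(Rd d, ℂ), ∫ x, w x * φ x = 0) : w =ᵐ[volume] 0 := by
  refine ae_eq_zero_of_integral_contDiff_smul_eq_zero hw fun g hg hgc => ?_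
  have hg1 : HasCompactSupport (fun x => (g x : ℂ)) :=
    hgc.comp_left (g := fun t : ℝ => (t : ℂ)) Complex.ofReal_zero
  have := h (hg1.toSchwartzMap (Complex.ofRealCLM.contDiff.comp hg))
  rw [← this]
  congr 1; ext x
  rw [Complex.real_smul, mul_comm]; rfl

lemma locallyIntegrable_of_memLp {p : ℝ≥0∞} (hp : 1 ≤ p) {w : Rd d → ℂ}
    (hw : MemLp w p volume) : LocallyIntegrable w volume := hw.locallyIntegrable hp

lemma exists_holderConjugate {p : ℝ≥0∞} (hp : 1 < p) (hpt : p ≠ ⊤) :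
    ∃ q : ℝ≥0∞, ENNReal.HolderConjugate p q ∧ 1 < q ∧ q ≠ ⊤ := by
  refine ⟨p.conjExponent, ENNReal.HolderConjugate.conjExponent hp.le, ?_, ?_⟩
  · have := ENNReal.HolderConjugate.conjExponent hp.le
    exact (ENNReal.HolderConjugate.lt_top_iff_one_lt p _).1 hpt.lt_top
  · have := ENNReal.HolderConjugate.conjExponent hp.le
    exact ((ENNReal.HolderConjugate.lt_top_iff_one_lt p.conjExponent p).2 hp).ne

/-- A sum of two Lebesgue functions is determined by its pairings with amplitudes. -/
lemma ae_eq_zero_of_forall_amp {p q : ℝ≥0∞} (hp : 1 < p) (hpt : p ≠ ⊤) (hq : 1 < q) (hqt : q ≠ ⊤)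
    {a b : Rd d → ℂ} (ha : MemLp a p volume) (hb : MemLp b q volume)
    (h : ∀ g, IsAmp g → ∫ x, (a x + b x) * 𝓕⁻ g x = 0) : a + b =ᵐ[volume] 0 := by
  refine ae_eq_zero_of_forall_schwartz
    ((locallyIntegrable_of_memLp hp.le ha).add (locallyIntegrable_of_memLp hq.le hb)) fun φ => ?_
  obtain ⟨p', hp', hp1, hp2⟩ := exists_holderConjugate hp hpt
  obtain ⟨q', hq', hq1, hq2⟩ := exists_holderConjugate hq hqt
  -- The same amplitudes converge to `φ` in `L^{p'}` and in `L^{q'}`, which is what allows `a` and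
  -- `b` to have different exponents.
  obtain ⟨g, hg, hlim⟩ := exists_amp_approx φ
  have h1 := tendsto_integral_mul_of_eLpNorm (p := p) (q := p') ha (fun n => (hg n).memLp p')
    (φ.memLp p') (hlim p' hp1 hp2)
  have h2 := tendsto_integral_mul_of_eLpNorm (p := q) (q := q') hb (fun n => (hg n).memLp q')
    (φ.memLp q') (hlim q' hq1 hq2)
  have e : ∀ ψ : Rd d → ℂ, MemLp ψ p' volume → MemLp ψ q' volume →
      ∫ x, (a x + b x) * ψ x = (∫ x, a x * ψ x) + ∫ x, b x * ψ x := fun ψ e1 e2 => by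
    rw [← integral_add (integrable_mul_of_holder ha e1) (integrable_mul_of_holder hb e2)]
    simp only [add_mul]
  have h3 : Tendsto (fun _ : ℕ => (0 : ℂ)) atTop (𝓝 ((∫ x, a x * φ x) + ∫ x, b x * φ x)) := by
    refine (h1.add h2).congr fun n => ?_
    rw [← e _ ((hg n).memLp p') ((hg n).memLp q'), h _ (hg n)]
  have h5 := tendsto_nhds_unique h3 tendsto_const_nhds
  simp only [Pi.add_apply]
  rw [e _ (φ.memLp p') (φ.memLp q'), h5]

lemma ae_eq_of_forall_amp {p : ℝ≥0∞} (hp : 1 < p) (hpt : p ≠ ⊤) {a b : Rd d → ℂ}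
    (ha : MemLp a p volume) (hb : MemLp b p volume)
    (h : ∀ g, IsAmp g → ∫ x, a x * 𝓕⁻ g x = ∫ x, b x * 𝓕⁻ g x) : a =ᵐ[volume] b := by
  obtain ⟨p', hp', hp1, hp2⟩ := exists_holderConjugate hp hpt
  have := ae_eq_zero_of_forall_amp hp hpt hp hpt ha hb.neg (fun g hg => by
    have e := integral_sub (integrable_mul_of_holder (q := p') ha (hg.memLp p'))
      (integrable_mul_of_holder (q := p') hb (hg.memLp p'))
    rw [h g hg, sub_self] at e
    rw [← e]
    congr 1; ext x; simp [add_mul, sub_eq_add_neg])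
  filter_upwards [this] with x hx
  simpa [← sub_eq_add_neg, sub_eq_zero] using hx

/-! ### Multipliers of `L^p` as relations tested against amplitudes. -/

lemma integral_fourierInv_mul {h K : Rd d → ℂ} (hh : Integrable h) (hK : Integrable K) :
    ∫ x, 𝓕⁻ h x * K x = ∫ ξ, h ξ * 𝓕⁻ K ξ := by
  have hc : AEStronglyMeasurable (fun z : Rd d × Rd d =>
      Complex.exp ((2 * Real.pi * inner ℝ z.2 z.1 : ℝ) * Complex.I)) (volume.prod volume) :=
    Continuous.aestronglyMeasurable (by fun_prop)
  have hI : Integrable (fun z : Rd d × Rd d =>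
      Complex.exp ((2 * Real.pi * inner ℝ z.2 z.1 : ℝ) * Complex.I) * (K z.1 * h z.2))
      (volume.prod volume) :=
    (hK.mul_prod hh).bdd_mul (c := 1) hc (Eventually.of_forall fun z => by
      rw [Complex.norm_exp_ofReal_mul_I])
  calc ∫ x, 𝓕⁻ h x * K x = ∫ x, ∫ ξ, Complex.exp ((2 * Real.pi * inner ℝ ξ x : ℝ) * Complex.I) *
        (K x * h ξ) := by
        congr 1; ext x
        rw [Real.fourierInv_eq', ← integral_mul_const]
        congr 1; ext ξ
        rw [smul_eq_mul]; ring
    _ = ∫ ξ, ∫ x, Complex.exp ((2 * Real.pi * inner ℝ ξ x : ℝ) * Complex.I) *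
        (K x * h ξ) := integral_integral_swap hI
    _ = _ := by
        congr 1; ext ξ
        rw [Real.fourierInv_eq', ← integral_const_mul]
        congr 1; ext x
        rw [smul_eq_mul, real_inner_comm]; ring

lemma IsAmp.fourierInv_fourierInv {g : Rd d → ℂ} (hg : IsAmp g) (ξ : Rd d) :
    𝓕⁻ (𝓕⁻ g) ξ = g (-ξ) := by
  rw [Real.fourierInv_eq_fourier_neg, hg.fourier_fourierInv]

lemma IsAmp.integral_mul {g h : Rd d → ℂ} (hg : IsAmp g) (hh : IsAmp h) :
    ∫ x, 𝓕⁻ g x * 𝓕⁻ h x = ∫ ξ, g ξ * h (-ξ) := by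
  rw [integral_fourierInv_mul hg.integrable (memLp_one_iff_integrable.1 (hh.memLp 1))]
  simp only [hh.fourierInv_fourierInv]

/-- `m` acts on functions with amplitudes as a multiplier of `L^p`, with norm at most `C`. -/
def AmpMul (p : ℝ≥0∞) (m : Rd d → ℂ) (C : ℝ≥0∞) : Prop :=
  ∀ g, IsAmp g → eLpNorm (𝓕⁻ (fun ξ => m ξ * g ξ)) p volume ≤ C * eLpNorm (𝓕⁻ g) p volume

lemma MulL.ampMul {p : ℝ≥0∞} {m : Rd d → ℂ} {C : ℝ≥0∞} (h : MulL p m C) : AmpMul p m C :=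
  fun g hg => (h g hg.integrable (hg.memLp p)).2.2

namespace AmpMul

variable {p : ℝ≥0∞} {m n : Rd d → ℂ} {A B : ℝ≥0∞}

lemma mul (hm : AmpMul p m A) (hn : AmpMul p n B) (hs : IsSym n) :
    AmpMul p (fun ξ => m ξ * n ξ) (A * B) := fun g hg => by
  have h1 := hm _ (hg.mul_sym hs)
  simp only [← mul_assoc] at h1
  refine h1.trans ?_
  rw [mul_assoc]
  gcongr
  exact hn g hg

lemma one : AmpMul p (fun _ : Rd d => (1 : ℂ)) 1 := fun g _ => by simp

lemma prod {ι : Type*} (s : Finset ι) {m : ι → Rd d → ℂ} {C : ℝ≥0∞}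
    (h : ∀ i ∈ s, AmpMul p (m i) C) (hs : ∀ i ∈ s, IsSym (m i)) :
    AmpMul p (fun ξ => ∏ i ∈ s, m i ξ) (C ^ s.card) := by
  classical
  induction s using Finset.induction_on with
  | empty => simpa using one
  | insert a s ha ih =>
    simp only [Finset.prod_insert ha, Finset.card_insert_of_notMem ha, pow_succ']
    exact (h a (by simp)).mul (ih (fun i hi => h i (by simp [hi])) fun i hi => hs i (by simp [hi]))
      (IsSym.prod fun i hi => hs i (by simp [hi]))

lemma mono (hm : AmpMul p m A) (h : A ≤ B) : AmpMul p m B := fun g hg =>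
  (hm g hg).trans (by gcongr)

end AmpMul

/-- `w = m(D) f`, tested against functions with amplitudes. -/
def Rel (m : Rd d → ℂ) (f w : Rd d → ℂ) : Prop :=
  ∀ g, IsAmp g → ∫ x, w x * 𝓕⁻ g x = ∫ x, f x * 𝓕⁻ (fun ξ => m (-ξ) * g ξ) x

lemma exists_limit_of_cauchy {p : ℝ≥0∞} (hp : 1 ≤ p) {w : ℕ → Rd d → ℂ}
    (hw : ∀ n, MemLp (w n) p volume) {e : ℕ → ℝ≥0∞} (he : Tendsto e atTop (𝓝 0))
    (h : ∀ n k, eLpNorm (w n - w k) p volume ≤ e n + e k) :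
    ∃ z, MemLp z p volume ∧ Tendsto (fun n => eLpNorm (w n - z) p volume) atTop (𝓝 0) := by
  have : Fact (1 ≤ p) := ⟨hp⟩
  have hc : CauchySeq (fun n => (hw n).toLp (w n)) := by
    rw [Lp.cauchySeq_Lp_iff_cauchySeq_eLpNorm]
    have h2 : Tendsto (fun n : ℕ × ℕ => e n.1 + e n.2) atTop (𝓝 0) := by
      have h1 : Tendsto (fun n : ℕ × ℕ => e n.1) atTop (𝓝 0) := by
        rw [← prod_atTop_atTop_eq]; exact he.comp tendsto_fst
      have h2 : Tendsto (fun n : ℕ × ℕ => e n.2) atTop (𝓝 0) := by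
        rw [← prod_atTop_atTop_eq]; exact he.comp tendsto_snd
      simpa using h1.add h2
    refine tendsto_of_tendsto_of_tendsto_of_le_of_le tendsto_const_nhds h2 (fun _ => zero_le)
      fun n => ?_
    refine le_trans (eLpNorm_congr_ae ?_).le (h n.1 n.2)
    exact ((hw n.1).coeFn_toLp).sub ((hw n.2).coeFn_toLp)
  obtain ⟨z, hz⟩ := cauchySeq_tendsto_of_complete hc
  refine ⟨z, Lp.memLp z, ?_⟩
  have hz' : Tendsto (fun n => (hw n).toLp (w n)) atTop (𝓝 ((Lp.memLp z).toLp z)) := by simpa using hz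
  exact (Lp.tendsto_Lp_iff_tendsto_eLpNorm'' w hw z (Lp.memLp z)).1 hz'

lemma le_of_tendsto_eLpNorm {p : ℝ≥0∞} (hp : 1 ≤ p) {w f : ℕ → Rd d → ℂ} {z u : Rd d → ℂ}
    {C : ℝ≥0∞} (hC : C ≠ ⊤) (hw : ∀ n, MemLp (w n) p volume) (hz : MemLp z p volume)
    (hf : ∀ n, MemLp (f n) p volume) (hu : MemLp u p volume)
    (h1 : Tendsto (fun n => eLpNorm (w n - z) p volume) atTop (𝓝 0))
    (h2 : Tendsto (fun n => eLpNorm (f n - u) p volume) atTop (𝓝 0))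
    (h : ∀ n, eLpNorm (w n) p volume ≤ C * eLpNorm (f n) p volume) :
    eLpNorm z p volume ≤ C * eLpNorm u p volume := by
  have hb : ∀ n, eLpNorm z p volume ≤ eLpNorm (w n - z) p volume +
      C * (eLpNorm (f n - u) p volume + eLpNorm u p volume) := by
    intro n
    have e1 : z = w n - (w n - z) := by simp
    have e2 : f n = (f n - u) + u := by simp
    calc eLpNorm z p volume = eLpNorm (w n - (w n - z)) p volume := by rw [← e1]
      _ ≤ eLpNorm (w n) p volume + eLpNorm (w n - z) p volume :=
        eLpNorm_sub_le (hw n).1 ((hw n).sub hz).1 hp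
      _ ≤ C * eLpNorm (f n) p volume + eLpNorm (w n - z) p volume := by gcongr; exact h n
      _ = C * eLpNorm ((f n - u) + u) p volume + eLpNorm (w n - z) p volume := by rw [← e2]
      _ ≤ _ := by
        rw [add_comm]
        gcongr
        exact eLpNorm_add_le ((hf n).sub hu).1 hu.1 hp
  have hlim : Tendsto (fun n => eLpNorm (w n - z) p volume +
      C * (eLpNorm (f n - u) p volume + eLpNorm u p volume)) atTop
      (𝓝 (0 + C * (0 + eLpNorm u p volume))) :=
    h1.add (ENNReal.Tendsto.const_mul (h2.add tendsto_const_nhds) (Or.inr hC))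
  simpa using ge_of_tendsto' hlim hb

namespace Rel

variable {p q : ℝ≥0∞} {m n : Rd d → ℂ} {C : ℝ≥0∞} {f w f' w' z : Rd d → ℂ}

lemma of_amp {g : Rd d → ℂ} (hg : IsAmp g) (hm : IsSym m) :
    Rel m (𝓕⁻ g) (𝓕⁻ (fun ξ => m ξ * g ξ)) := fun h hh => by
  rw [(hg.mul_sym hm).integral_mul hh, hg.integral_mul (hh.mul_sym hm.neg_arg)]
  congr 1; ext ξ
  rw [neg_neg]; ring

/-- Limits of the relation `w = m(D) f` in Lebesgue spaces. -/
lemma of_tendsto (hp : 1 < p) (hpt : p ≠ ⊤) (hq : 1 < q) (hqt : q ≠ ⊤) (hm : IsSym m)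
    {f w : ℕ → Rd d → ℂ} {u z : Rd d → ℂ}
    (hw : ∀ n, MemLp (w n) q volume) (hz : MemLp z q volume)
    (hf : ∀ n, MemLp (f n) p volume) (hu : MemLp u p volume)
    (h1 : Tendsto (fun n => eLpNorm (w n - z) q volume) atTop (𝓝 0))
    (h2 : Tendsto (fun n => eLpNorm (f n - u) p volume) atTop (𝓝 0))
    (h : ∀ n, Rel m (f n) (w n)) : Rel m u z := by
  intro g hg
  obtain ⟨p', hp', -, -⟩ := exists_holderConjugate hp hpt
  obtain ⟨q', hq', -, -⟩ := exists_holderConjugate hq hqt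
  have l1 := tendsto_integral_mul_of_eLpNorm (p := q') (q := q) (hg.memLp q') hw hz h1
  have l2 := tendsto_integral_mul_of_eLpNorm (p := p') (q := p)
    ((hg.mul_sym hm.neg_arg).memLp p') hf hu h2
  have e : ∀ n, ∫ x, 𝓕⁻ g x * w n x = ∫ x, 𝓕⁻ (fun ξ => m (-ξ) * g ξ) x * f n x := fun n => by
    have := h n g hg
    simpa only [mul_comm] using this
  rw [funext e] at l1
  have := tendsto_nhds_unique l1 l2
  simpa only [mul_comm] using this

/-- Extension by density: the images of amplitudes converging to `f` form a Cauchy sequence by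
linearity and `hm`, and both the relation and the bound pass to the limit. -/
lemma exists_of_ampMul (hp : 1 < p) (hpt : p ≠ ⊤) (hs : IsSym m) (hm : AmpMul p m C) (hC : C ≠ ⊤)
    (hf : MemLp f p volume) :
    ∃ w, MemLp w p volume ∧ Rel m f w ∧ eLpNorm w p volume ≤ C * eLpNorm f p volume := by
  obtain ⟨g, hg, hlim⟩ := exists_amp_dense hp hpt hf
  set w : ℕ → Rd d → ℂ := fun n => 𝓕⁻ (fun ξ => m ξ * g n ξ) with hwdef
  have hw : ∀ n, MemLp (w n) p volume := fun n => ((hg n).mul_sym hs).memLp p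
  have hc : ∀ n k, eLpNorm (w n - w k) p volume ≤
      C * eLpNorm (𝓕⁻ (g n) - f) p volume + C * eLpNorm (𝓕⁻ (g k) - f) p volume := by
    intro n k
    have e : w n - w k = 𝓕⁻ (fun ξ => m ξ * (g n - g k) ξ) := by
      rw [hwdef]
      simp only
      rw [← fourierInv_sub ((hg n).mul_sym hs).integrable ((hg k).mul_sym hs).integrable]
      congr 1; ext ξ; simp [mul_sub]
    rw [e]
    refine (hm _ ((hg n).sub (hg k))).trans ?_
    rw [← mul_add]
    gcongr
    rw [fourierInv_sub (hg n).integrable (hg k).integrable]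
    have e2 : 𝓕⁻ (g n) - 𝓕⁻ (g k) = (𝓕⁻ (g n) - f) - (𝓕⁻ (g k) - f) := by simp
    rw [e2]
    exact eLpNorm_sub_le (((hg n).memLp p).sub hf).1 (((hg k).memLp p).sub hf).1 hp.le
  have he : Tendsto (fun n => C * eLpNorm (𝓕⁻ (g n) - f) p volume) atTop (𝓝 0) := by
    have := ENNReal.Tendsto.const_mul hlim (Or.inr hC)
    simpa using this
  obtain ⟨z, hz, hzl⟩ := exists_limit_of_cauchy hp.le hw he hc
  refine ⟨z, hz, ?_, ?_⟩
  · exact of_tendsto hp hpt hp hpt hs hw hz (fun n => (hg n).memLp p) hf hzl hlim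
      fun n => of_amp (hg n) hs
  · exact le_of_tendsto_eLpNorm hp.le hC hw hz (fun n => (hg n).memLp p) hf hzl hlim
      fun n => hm _ (hg n)

lemma unique (hp : 1 < p) (hpt : p ≠ ⊤) (hw : MemLp w p volume) (hw' : MemLp w' p volume)
    (h : Rel m f w) (h' : Rel m f w') : w =ᵐ[volume] w' :=
  ae_eq_of_forall_amp hp hpt hw hw' fun g hg => by rw [h g hg, h' g hg]

lemma bound (hp : 1 < p) (hpt : p ≠ ⊤) (hs : IsSym m) (hm : AmpMul p m C) (hC : C ≠ ⊤)
    (hf : MemLp f p volume) (hw : MemLp w p volume) (h : Rel m f w) :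
    eLpNorm w p volume ≤ C * eLpNorm f p volume := by
  obtain ⟨w', h1, h2, h3⟩ := exists_of_ampMul hp hpt hs hm hC hf
  rwa [eLpNorm_congr_ae (unique hp hpt hw h1 h h2)]

lemma congr (h : Rel m f w) (hf : f =ᵐ[volume] f') (hw : w =ᵐ[volume] w') : Rel m f' w' := by
  intro g hg
  have e1 : ∫ x, w' x * 𝓕⁻ g x = ∫ x, w x * 𝓕⁻ g x :=
    integral_congr_ae (by filter_upwards [hw] with x hx; rw [hx])
  rw [e1, h g hg]
  exact integral_congr_ae (by filter_upwards [hf] with x hx; rw [hx])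

lemma sub (hp : 1 < p) (hpt : p ≠ ⊤) (hs : IsSym m) (hf : MemLp f p volume)
    (hf' : MemLp f' p volume) (hw : MemLp w p volume) (hw' : MemLp w' p volume)
    (h : Rel m f w) (h' : Rel m f' w') : Rel m (f - f') (w - w') := by
  obtain ⟨q, hq, -, -⟩ := exists_holderConjugate hp hpt
  intro g hg
  simp only [Pi.sub_apply, sub_mul]
  rw [integral_sub (integrable_mul_of_holder (q := q) hw (hg.memLp q))
    (integrable_mul_of_holder (q := q) hw' (hg.memLp q)),
    integral_sub (integrable_mul_of_holder (q := q) hf ((hg.mul_sym hs.neg_arg).memLp q))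
    (integrable_mul_of_holder (q := q) hf' ((hg.mul_sym hs.neg_arg).memLp q)), h g hg, h' g hg]

lemma comp (h : Rel m f w) (h' : Rel n w z) (hn : IsSym n) :
    Rel (fun ξ => m ξ * n ξ) f z := by
  intro g hg
  rw [h' g hg, h _ (hg.mul_sym hn.neg_arg)]
  simp only [mul_assoc]

lemma of_avg {Y : Type*} [MeasurableSpace Y] {ν : Measure Y} [SFinite ν] {τ : Y → Rd d}
    {κ : Y → ℂ} (hτ : Measurable τ) (hκ : Integrable κ ν) (hp : 1 ≤ p) (hf : MemLp f p volume) :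
    Rel (avgSymbol ν τ κ) f (avg ν τ κ f) := by
  intro g hg
  have hq : ENNReal.HolderConjugate p p.conjExponent := ENNReal.HolderConjugate.conjExponent hp
  rw [integral_avg_mul (q := p.conjExponent) hτ hκ hf (hg.memLp _),
    avg_fourierInv (τ := fun t => -τ t) hτ.neg hκ hg.integrable]
  simp only [avgSymbol_neg]

/-- Multipliers commute with averages of translates. -/
lemma avg_comm {Y : Type*} [MeasurableSpace Y] {ν : Measure Y} [SFinite ν] {τ : Y → Rd d}
    {κ : Y → ℂ} (hτ : Measurable τ) (hκ : Integrable κ ν) (hp : 1 ≤ p) (hf : MemLp f p volume)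
    (hw : MemLp w p volume) (hsym : IsSym (avgSymbol ν τ κ)) (hs : IsSym m) (h : Rel m f w) :
    Rel m (avg ν τ κ f) (avg ν τ κ w) := by
  intro g hg
  rw [of_avg hτ hκ hp hw g hg, h _ (hg.mul_sym hsym.neg_arg),
    of_avg hτ hκ hp hf _ (hg.mul_sym hs.neg_arg)]
  have e : (fun ξ => m (-ξ) * (avgSymbol ν τ κ (-ξ) * g ξ)) =
      fun ξ => avgSymbol ν τ κ (-ξ) * (m (-ξ) * g ξ) := by ext ξ; ring
  rw [e]

end Rel

/-- The `L^p` norm is determined by pairings with amplitudes. -/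
lemma eLpNorm_le_of_forall_amp {p q : ℝ≥0∞} [hpq : ENNReal.HolderConjugate p q] (hp : 1 < p)
    (hpt : p ≠ ⊤) {w : Rd d → ℂ} (hw : MemLp w p volume) {M : ℝ≥0∞} (hM : M ≠ ⊤)
    (h : ∀ g, IsAmp g → ‖∫ x, w x * 𝓕⁻ g x‖ₑ ≤ M * eLpNorm (𝓕⁻ g) q volume) :
    eLpNorm w p volume ≤ M := by
  have hqt : q ≠ ⊤ := ((ENNReal.HolderConjugate.lt_top_iff_one_lt q p).2 hp).ne
  have hq : 1 < q := (ENNReal.HolderConjugate.lt_top_iff_one_lt p q).1 hpt.lt_top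
  have hext : ∀ ψ, MemLp ψ q volume → ‖∫ x, w x * ψ x‖ₑ ≤ M * eLpNorm ψ q volume := by
    intro ψ hψ
    obtain ⟨g, hg, hlim⟩ := exists_amp_dense hq hqt hψ
    have l1 := (tendsto_integral_mul_of_eLpNorm (p := p) (q := q) hw (fun n => (hg n).memLp q)
      hψ hlim).enorm
    have hb : ∀ n, ‖∫ x, w x * 𝓕⁻ (g n) x‖ₑ ≤
        M * (eLpNorm (𝓕⁻ (g n) - ψ) q volume + eLpNorm ψ q volume) := fun n => by
      refine (h _ (hg n)).trans ?_
      gcongr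
      have e : 𝓕⁻ (g n) = (𝓕⁻ (g n) - ψ) + ψ := by simp
      nth_rw 1 [e]
      exact eLpNorm_add_le (((hg n).memLp q).sub hψ).1 hψ.1 hq.le
    have l2 : Tendsto (fun n => M * (eLpNorm (𝓕⁻ (g n) - ψ) q volume + eLpNorm ψ q volume)) atTop
        (𝓝 (M * (0 + eLpNorm ψ q volume))) :=
      ENNReal.Tendsto.const_mul (hlim.add tendsto_const_nhds) (Or.inr hM)
    have := le_of_tendsto_of_tendsto' l1 l2 hb
    simpa using this
  have hPQ : p.toReal.HolderConjugate q.toReal := ENNReal.HolderConjugate.toReal_of_ne_top hpt hqt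
  set P := p.toReal with hP
  set Q := q.toReal with hQ
  have hP1 : 1 < P := hPQ.lt
  have hQ1 : 1 < Q := hPQ.symm.lt
  -- The extremal function for Hölder's inequality: `w ψ = |w|^P` and `|ψ|^Q = |w|^P`. Where `w = 0`
  -- the conjugate factor makes `ψ` vanish, whatever the value of `‖w‖ ^ (P - 2)`.
  set ψ : Rd d → ℂ := fun x => (starRingEnd ℂ) (w x) * ((‖w x‖ ^ (P - 2) : ℝ) : ℂ) with hψdef
  have hψm : AEStronglyMeasurable ψ volume := by
    refine (Complex.continuous_conj.comp_aestronglyMeasurable hw.1).mul ?_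
    exact (Complex.measurable_ofReal.comp_aemeasurable
      (hw.1.norm.aemeasurable.pow_const _)).aestronglyMeasurable
  have hψn : ∀ x, ‖ψ x‖ = ‖w x‖ ^ (P - 1) := by
    intro x
    simp only [hψdef, norm_mul, RCLike.norm_conj, Complex.norm_real, Real.norm_eq_abs]
    rw [abs_of_nonneg (by positivity)]
    rcases eq_or_ne (‖w x‖) 0 with h0 | h0
    · rw [h0, zero_mul, Real.zero_rpow (by linarith)]
    · nth_rw 1 [← Real.rpow_one ‖w x‖]
      rw [← Real.rpow_add (lt_of_le_of_ne (norm_nonneg _) h0.symm)]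
      congr 1; ring
  have hwψ : ∀ x, w x * ψ x = ((‖w x‖ ^ P : ℝ) : ℂ) := by
    intro x
    simp only [hψdef]
    rw [← mul_assoc, Complex.mul_conj, ← Complex.ofReal_mul, Complex.normSq_eq_norm_sq]
    congr 1
    rcases eq_or_ne (‖w x‖) 0 with h0 | h0
    · rw [h0, Real.zero_rpow (by linarith : P ≠ 0)]; simp
    · rw [← Real.rpow_natCast, ← Real.rpow_add (lt_of_le_of_ne (norm_nonneg _) h0.symm)]
      congr 1; push_cast; ring
  set N := ∫⁻ x, ‖w x‖ₑ ^ P with hN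
  have hp0 : p ≠ 0 := (zero_lt_one.trans hp).ne'
  have hq0 : q ≠ 0 := (zero_lt_one.trans hq).ne'
  have hNlt : N < ⊤ := lintegral_rpow_enorm_lt_top_of_eLpNorm_lt_top hp0 hpt hw.2
  have hψN : ∫⁻ x, ‖ψ x‖ₑ ^ Q = N := by
    refine lintegral_congr fun x => ?_
    rw [← ofReal_norm, hψn, ← ENNReal.ofReal_rpow_of_nonneg (norm_nonneg _) (by linarith),
      ofReal_norm, ← ENNReal.rpow_mul, hPQ.sub_one_mul_conj]
  have hψnorm : eLpNorm ψ q volume = N ^ (1 / Q) := by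
    rw [eLpNorm_eq_lintegral_rpow_enorm_toReal hq0 hqt, ← hQ, hψN]
  have hψ : MemLp ψ q volume :=
    ⟨hψm, by rw [hψnorm]; exact ENNReal.rpow_lt_top_of_nonneg (by positivity) hNlt.ne⟩
  have hmain := hext ψ hψ
  have hint : ‖∫ x, w x * ψ x‖ₑ = N := by
    simp only [hwψ]
    rw [integral_complex_ofReal, ← ofReal_norm, Complex.norm_real, Real.norm_eq_abs,
      abs_of_nonneg (integral_nonneg fun x => by positivity),
      ofReal_integral_eq_lintegral_ofReal]
    · refine lintegral_congr fun x => ?_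
      rw [← ENNReal.ofReal_rpow_of_nonneg (norm_nonneg _) (by linarith), ofReal_norm]
    · exact hw.integrable_norm_rpow hp0 hpt
    · exact Eventually.of_forall fun x => by positivity
  rw [hint, hψnorm] at hmain
  rw [eLpNorm_eq_lintegral_rpow_enorm_toReal hp0 hpt, ← hP, ← hN]
  rcases eq_or_ne N 0 with h0 | h0
  · rw [h0, ENNReal.zero_rpow_of_pos (by positivity)]; exact zero_le
  · have e : N = N ^ (1 / P) * N ^ (1 / Q) := by
      rw [← ENNReal.rpow_add _ _ h0 hNlt.ne]
      have := hPQ.inv_add_inv_eq_one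
      rw [one_div, one_div, this, ENNReal.rpow_one]
    -- The inequality reads `N ≤ M N^(1/Q)`; writing `N = N^(1/P) N^(1/Q)` and cancelling the finite
    -- nonzero factor `N^(1/Q)` leaves the norm of `w` on the left.
    nth_rw 1 [e] at hmain
    have hz : N ^ (1 / Q) ≠ 0 := by simp [h0, hNlt.ne]
    have ht : N ^ (1 / Q) ≠ ⊤ := ENNReal.rpow_ne_top_of_nonneg (by positivity) hNlt.ne
    exact (ENNReal.mul_le_mul_iff_left hz ht).1 hmain

/-- The transpose of `m(D)` is `m(-D)`, so a bound for the latter on `L^q` is a bound for the former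
on the dual exponent. -/
lemma AmpMul.of_dual {p q : ℝ≥0∞} [hpq : ENNReal.HolderConjugate p q] (hp : 1 < p)
    (hpt : p ≠ ⊤) {m : Rd d → ℂ} (hs : IsSym m) {C : ℝ≥0∞} (hC : C ≠ ⊤)
    (h : AmpMul q (fun ξ => m (-ξ)) C) : AmpMul p m C := by
  intro g hg
  refine eLpNorm_le_of_forall_amp (q := q) hp hpt ((hg.mul_sym hs).memLp p)
    (ENNReal.mul_ne_top hC (hg.memLp p).2.ne) fun k hk => ?_
  rw [Rel.of_amp hg hs k hk]
  refine (enorm_integral_mul_le (p := p) (q := q) (hg.memLp p).1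
    ((hk.mul_sym hs.neg_arg).memLp q).1).trans ?_
  calc _ ≤ eLpNorm (𝓕⁻ g) p volume * (C * eLpNorm (𝓕⁻ k) q volume) := by gcongr; exact h k hk
    _ = _ := by ring

/-! ### M. Riesz's theorem on `L^{2k}`. -/

/-- The indicator of the half space `s ξ_i > 0`. -/
def half (i : Fin d) (s : ℝ) (ξ : Rd d) : ℂ := if 0 < s * ξ i then 1 else 0

lemma isSym_half (i : Fin d) {s : ℝ} (hs : s ≠ 0) : IsSym (half i s) := by
  intro ξ hξ
  refine ContDiffAt.contDiffWithinAt ?_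
  have hi : Continuous fun ξ : Rd d => s * ξ i := by fun_prop
  rcases lt_or_gt_of_ne (mul_ne_zero hs (hξ i)) with h | h
  · refine (contDiffAt_const (c := (0 : ℂ))).congr_of_eventuallyEq ?_
    filter_upwards [hi.continuousAt.eventually_lt continuousAt_const h] with η hη
    simp [half, not_lt.2 hη.le]
  · refine (contDiffAt_const (c := (1 : ℂ))).congr_of_eventuallyEq ?_
    filter_upwards [continuousAt_const.eventually_lt hi.continuousAt h] with η hη
    simp [half, hη]

lemma half_neg_arg (i : Fin d) (s : ℝ) (ξ : Rd d) : half i s (-ξ) = half i (-s) ξ := by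
  simp [half]

lemma fourier_fourierInv_mul {h G : Rd d → ℂ} (hh : Integrable h) (hG : Integrable G) (ζ : Rd d) :
    𝓕 (fun x => 𝓕⁻ h x * G x) ζ = ∫ ξ, h ξ * 𝓕 G (ζ - ξ) := by
  have hK : Integrable (fun x => Complex.exp ((-2 * Real.pi * inner ℝ x ζ : ℝ) * Complex.I) * G x) :=
    hG.bdd_mul (c := 1) (Continuous.aestronglyMeasurable (by fun_prop))
      (Eventually.of_forall fun x => by rw [Complex.norm_exp_ofReal_mul_I])
  have := integral_fourierInv_mul hh hK
  calc 𝓕 (fun x => 𝓕⁻ h x * G x) ζ = ∫ x, 𝓕⁻ h x *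
        (Complex.exp ((-2 * Real.pi * inner ℝ x ζ : ℝ) * Complex.I) * G x) := by
        rw [Real.fourier_eq']
        congr 1; ext x
        rw [smul_eq_mul]; ring
    _ = _ := this
    _ = _ := by
        congr 1; ext ξ
        rw [Real.fourierInv_eq', Real.fourier_eq']
        congr 2; ext x
        rw [smul_eq_mul, smul_eq_mul, ← mul_assoc, ← Complex.exp_add]
        congr 2
        rw [inner_sub_right]
        push_cast; ring

/-- Powers of a function with spectrum in a half space have spectrum in that half space. -/
lemma fourier_pow_eq_zero {h : Rd d → ℂ} (hh : IsAmp h) {i : Fin d} {s : ℝ}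
    (hsupp : ∀ ξ, s * ξ i ≤ 0 → h ξ = 0) (n : ℕ) :
    Integrable (fun x => 𝓕⁻ h x ^ (n + 1)) ∧
      ∀ ζ : Rd d, s * ζ i ≤ 0 → 𝓕 (fun x => 𝓕⁻ h x ^ (n + 1)) ζ = 0 := by
  have hF1 : Integrable (𝓕⁻ h) := memLp_one_iff_integrable.1 (hh.memLp 1)
  induction n with
  | zero =>
    simp only [zero_add, pow_one]
    refine ⟨hF1, fun ζ hζ => ?_⟩
    change 𝓕 (𝓕⁻ h) ζ = 0
    rw [hh.fourier_fourierInv, hsupp ζ hζ]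
  | succ n ih =>
    have e : (fun x => 𝓕⁻ h x ^ (n + 1 + 1)) = fun x => 𝓕⁻ h x * 𝓕⁻ h x ^ (n + 1) := by
      ext x; ring
    rw [e]
    constructor
    · have hb : ∀ x, ‖𝓕⁻ h x‖ ≤ SchwartzMap.seminorm ℂ 0 0 hh.toS := fun x => by
        rw [← hh.coe_toS]; exact SchwartzMap.norm_le_seminorm ℂ _ x
      exact ih.1.bdd_mul (c := SchwartzMap.seminorm ℂ 0 0 hh.toS)
        hh.continuous_fourierInv.aestronglyMeasurable (Eventually.of_forall hb)
    · intro ζ hζ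
      rw [fourier_fourierInv_mul hh.integrable ih.1]
      -- The spectrum of a product is a convolution, and the open half space is stable under
      -- addition: if `ζ` lies outside it, one of `ξ` and `ζ - ξ` does too.
      have : ∀ ξ, h ξ * 𝓕 (fun x => 𝓕⁻ h x ^ (n + 1)) (ζ - ξ) = 0 := fun ξ => by
        by_cases hξ : s * ξ i ≤ 0
        · rw [hsupp ξ hξ, zero_mul]
        · rw [ih.2 (ζ - ξ) (by simp only [PiLp.sub_apply, mul_sub]; push Not at hξ; linarith),
            mul_zero]
      simp [this]

/-- The integral is the value at frequency zero, which lies on the boundary of the half space and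
thus outside the spectrum. -/
lemma integral_pow_eq_zero {h : Rd d → ℂ} (hh : IsAmp h) {i : Fin d} {s : ℝ}
    (hsupp : ∀ ξ, s * ξ i ≤ 0 → h ξ = 0) (n : ℕ) : ∫ x, 𝓕⁻ h x ^ (n + 1) = 0 := by
  have := (fourier_pow_eq_zero hh hsupp n).2 0 (by simp)
  rw [Real.fourier_eq'] at this
  simpa using this

lemma norm_pow_sub_pow_le_mul {A B : ℂ} {r : ℝ} (hA : ‖A‖ ≤ r) (hB : ‖B‖ ≤ r) (k : ℕ) :
    ‖A ^ (k + 1) - B ^ (k + 1)‖ ≤ (k + 1) * ‖A - B‖ * r ^ k := by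
  rw [← geom_sum₂_mul, norm_mul]
  have : ‖∑ i ∈ Finset.range (k + 1), A ^ i * B ^ (k + 1 - 1 - i)‖ ≤ (k + 1) * r ^ k := by
    refine (norm_sum_le _ _).trans ?_
    have : ∀ i ∈ Finset.range (k + 1), ‖A ^ i * B ^ (k + 1 - 1 - i)‖ ≤ r ^ k := by
      intro i hi
      have hi' : i ≤ k := Nat.lt_succ_iff.1 (Finset.mem_range.1 hi)
      rw [norm_mul, norm_pow, norm_pow]
      calc ‖A‖ ^ i * ‖B‖ ^ (k + 1 - 1 - i) ≤ r ^ i * r ^ (k + 1 - 1 - i) := by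
            gcongr
            exact pow_nonneg ((norm_nonneg _).trans hA) _
        _ = r ^ k := by rw [← pow_add]; congr 1; omega
    refine (Finset.sum_le_sum this).trans ?_
    simp
  calc _ ≤ ((k + 1) * r ^ k) * ‖A - B‖ := by gcongr
    _ = _ := by ring

/-- The pointwise inequality behind the `L^{2k}` boundedness of the Hilbert transform. -/
lemma norm_pow_le_re_pow_add (F : ℂ) (k : ℕ) :
    ‖F‖ ^ (2 * (k + 1)) ≤ (-1) ^ (k + 1) * (F ^ (2 * (k + 1))).re +
      2 * (k + 1) * (|F.re| * ‖F‖ ^ (2 * k + 1)) := by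
  -- Since `F² + |F|² = 2 (Re F) F`, the numbers `F²` and `-|F|²` differ by a multiple of `Re F`.
  -- Comparing their `(k+1)`-st powers gives the inequality.
  have h1 : F ^ 2 - (-((‖F‖ ^ 2 : ℝ) : ℂ)) = 2 * F.re * F := by
    have h2 : ((‖F‖ ^ 2 : ℝ) : ℂ) = F * (starRingEnd ℂ) F := by
      rw [Complex.mul_conj, Complex.normSq_eq_norm_sq]
    have h3 : F + (starRingEnd ℂ) F = 2 * F.re := by
      rw [Complex.add_conj]; push_cast; ring
    rw [h2, ← h3]; ring
  have hr1 : ‖F ^ 2‖ ≤ ‖F‖ ^ 2 := by rw [norm_pow]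
  have hr2 : ‖-((‖F‖ ^ 2 : ℝ) : ℂ)‖ ≤ ‖F‖ ^ 2 := by
    rw [norm_neg, Complex.norm_real, Real.norm_eq_abs, abs_of_nonneg (by positivity)]
  have hk := norm_pow_sub_pow_le_mul hr1 hr2 k
  rw [h1, ← pow_mul] at hk
  have hk2 : ‖2 * (F.re : ℂ) * F‖ = 2 * |F.re| * ‖F‖ := by
    rw [norm_mul, norm_mul, Complex.norm_real, Complex.norm_ofNat, Real.norm_eq_abs]
  rw [hk2] at hk
  have h4 : (-((‖F‖ ^ 2 : ℝ) : ℂ)) ^ (k + 1) = (((-1) ^ (k + 1) * ‖F‖ ^ (2 * (k + 1)) : ℝ) : ℂ) := by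
    rw [neg_pow, pow_mul]; push_cast; ring
  rw [h4] at hk
  have h5 := (Complex.abs_re_le_norm _).trans hk
  rw [Complex.sub_re, Complex.ofReal_re] at h5
  have h6 : |(-1 : ℝ) ^ (k + 1)| = 1 := by simp
  have h7 : ‖F‖ ^ (2 * (k + 1)) - (-1) ^ (k + 1) * (F ^ (2 * (k + 1))).re =
      -((-1) ^ (k + 1) * ((F ^ (2 * (k + 1))).re - (-1) ^ (k + 1) * ‖F‖ ^ (2 * (k + 1)))) := by
    have : ((-1 : ℝ) ^ (k + 1)) * (-1) ^ (k + 1) = 1 := by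
      rw [← mul_pow]; simp
    linear_combination (-‖F‖ ^ (2 * (k + 1))) * this
  have h8 : ‖F‖ ^ (2 * (k + 1)) - (-1) ^ (k + 1) * (F ^ (2 * (k + 1))).re ≤
      (k + 1) * (2 * |F.re| * ‖F‖) * (‖F‖ ^ 2) ^ k := by
    rw [h7]
    refine (neg_le_abs _).trans ?_
    rw [abs_mul, h6, one_mul]
    exact h5
  have h9 : (k + 1) * (2 * |F.re| * ‖F‖) * (‖F‖ ^ 2) ^ k =
      2 * (k + 1) * (|F.re| * ‖F‖ ^ (2 * k + 1)) := by
    rw [← pow_mul]; ring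
  linarith

/-- Integrate `norm_pow_le_re_pow_add` with `n = 2(k+1)`. The term `Re F^n` integrates to zero,
leaving `∫ |F|^n ≤ n ∫ |Re F| |F|^(n-1)`; Hölder's inequality and division by the power of `∫ |F|^n`
conclude. -/
lemma eLpNorm_le_of_spectrum_half {h : Rd d → ℂ} (hh : IsAmp h) {i : Fin d} {s : ℝ}
    (hsupp : ∀ ξ, s * ξ i ≤ 0 → h ξ = 0) (k : ℕ) :
    eLpNorm (𝓕⁻ h) ((2 * (k + 1) : ℕ) : ℝ≥0∞) volume ≤
      ((2 * (k + 1) : ℕ) : ℝ≥0∞) *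
        eLpNorm (fun x => ((𝓕⁻ h x).re : ℂ)) ((2 * (k + 1) : ℕ) : ℝ≥0∞) volume := by
  set F : Rd d → ℂ := 𝓕⁻ h with hFdef
  set n : ℕ := 2 * (k + 1) with hn
  have hn2 : 2 ≤ n := by omega
  have hn1 : 2 * k + 1 = n - 1 := by omega
  have hFc : Continuous F := hh.continuous_fourierInv
  have hFp : MemLp F n volume := hh.memLp n
  have hn0 : (n : ℝ≥0∞) ≠ 0 := by simp [hn]
  have hInt : Integrable (fun x => ‖F x‖ ^ n) volume := hFp.integrable_norm_pow (by omega)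
  have hInt2 : Integrable (fun x => |(F x).re| * ‖F x‖ ^ (n - 1)) volume := by
    refine hInt.mono' (Continuous.aestronglyMeasurable (by fun_prop)) (Eventually.of_forall fun x => ?_)
    rw [Real.norm_eq_abs, abs_of_nonneg (by positivity)]
    calc |(F x).re| * ‖F x‖ ^ (n - 1) ≤ ‖F x‖ * ‖F x‖ ^ (n - 1) := by
          gcongr; exact Complex.abs_re_le_norm _
      _ = ‖F x‖ ^ n := by rw [← pow_succ', Nat.sub_add_cancel (by omega)]
  have hzero : ∫ x, (F x ^ n).re = 0 := by
    have h0 := integral_pow_eq_zero hh hsupp (2 * k + 1)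
    have h1 := (fourier_pow_eq_zero hh hsupp (2 * k + 1)).1
    have e : 2 * k + 1 + 1 = n := by omega
    rw [e] at h0 h1
    have := integral_re h1
    simp only [RCLike.re_to_complex] at this
    rw [this, h0]; simp
  have hIre : Integrable (fun x => (F x ^ n).re) volume := by
    have h1 := (fourier_pow_eq_zero hh hsupp (2 * k + 1)).1
    have e : 2 * k + 1 + 1 = n := by omega
    rw [e] at h1
    exact h1.re
  have hreal : ∫ x, ‖F x‖ ^ n ≤ ∫ x, (n : ℝ) * (|(F x).re| * ‖F x‖ ^ (n - 1)) := by
    have h2 : ∫ x, ‖F x‖ ^ n ≤ ∫ x, ((-1) ^ (k + 1) * (F x ^ n).re +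
        (n : ℝ) * (|(F x).re| * ‖F x‖ ^ (n - 1))) := by
      refine integral_mono hInt ((hIre.const_mul _).add (hInt2.const_mul _)) fun x => ?_
      have := norm_pow_le_re_pow_add (F x) k
      rw [hn1, ← hn] at this
      have e : ((n : ℕ) : ℝ) = 2 * (k + 1) := by rw [hn]; push_cast; ring
      simp only [e]
      exact this
    rw [integral_add (hIre.const_mul _) (hInt2.const_mul _), integral_const_mul, hzero] at h2
    simpa using h2
  have hR : ((n : ℕ) : ℝ) ≠ 0 := by positivity
  have hlin : ∫⁻ x, ‖F x‖ₑ ^ (n : ℝ) ≤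
      (n : ℝ≥0∞) * ∫⁻ x, ‖(F x).re‖ₑ * ‖F x‖ₑ ^ ((n : ℝ) - 1) := by
    have e1 : ∫⁻ x, ‖F x‖ₑ ^ (n : ℝ) = ENNReal.ofReal (∫ x, ‖F x‖ ^ n) := by
      rw [ofReal_integral_eq_lintegral_ofReal hInt (Eventually.of_forall fun x => by positivity)]
      refine lintegral_congr fun x => ?_
      rw [ENNReal.rpow_natCast, ENNReal.ofReal_pow (norm_nonneg _), ofReal_norm]
    have e2 : (n : ℝ≥0∞) * ∫⁻ x, ‖(F x).re‖ₑ * ‖F x‖ₑ ^ ((n : ℝ) - 1) =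
        ENNReal.ofReal (∫ x, (n : ℝ) * (|(F x).re| * ‖F x‖ ^ (n - 1))) := by
      rw [integral_const_mul, ENNReal.ofReal_mul (by positivity), ENNReal.ofReal_natCast,
        ofReal_integral_eq_lintegral_ofReal hInt2 (Eventually.of_forall fun x => by positivity)]
      congr 1
      refine lintegral_congr fun x => ?_
      have : ((n : ℝ) - 1) = ((n - 1 : ℕ) : ℝ) := by rw [Nat.cast_sub (by omega)]; simp
      rw [this, ENNReal.rpow_natCast, ENNReal.ofReal_mul (abs_nonneg _),
        ENNReal.ofReal_pow (norm_nonneg _), ofReal_norm, ← Real.norm_eq_abs, ofReal_norm]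
    rw [e1, e2]
    exact ENNReal.ofReal_le_ofReal hreal
  have hconj : (n : ℝ).HolderConjugate ((n : ℝ).conjExponent) :=
    Real.HolderConjugate.conjExponent (by exact_mod_cast (by omega : 1 < n))
  have hre : Continuous fun x => (F x).re := by fun_prop
  have hhol := ENNReal.lintegral_mul_le_Lp_mul_Lq (volume : Measure (Rd d)) hconj
    (f := fun x => ‖(F x).re‖ₑ) (g := fun x => ‖F x‖ₑ ^ ((n : ℝ) - 1))
    hre.aestronglyMeasurable.enorm (hFc.aestronglyMeasurable.enorm.pow_const _)
  simp only [Pi.mul_apply, ← ENNReal.rpow_mul] at hhol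
  rw [hconj.sub_one_mul_conj] at hhol
  set N := ∫⁻ x, ‖F x‖ₑ ^ (n : ℝ) with hN
  have hNlt : N < ⊤ := by
    have := lintegral_rpow_enorm_lt_top_of_eLpNorm_lt_top hn0 (by simp) hFp.2
    simpa [hN] using this
  rw [eLpNorm_eq_lintegral_rpow_enorm_toReal hn0 (by simp),
    eLpNorm_eq_lintegral_rpow_enorm_toReal hn0 (by simp)]
  simp only [ENNReal.toReal_natCast]
  rw [← hN]
  have hmain : N ≤ (n : ℝ≥0∞) * (∫⁻ x, ‖((F x).re : ℂ)‖ₑ ^ (n : ℝ)) ^ (1 / (n : ℝ)) *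
      N ^ (1 / (n : ℝ).conjExponent) := by
    refine hlin.trans ?_
    rw [mul_assoc]
    gcongr
    refine hhol.trans_eq ?_
    congr 3
    ext x
    rw [← ofReal_norm, ← ofReal_norm, Complex.norm_real]
  rcases eq_or_ne N 0 with h0 | h0
  · rw [h0, ENNReal.zero_rpow_of_pos (by positivity)]; exact zero_le
  · have e : N = N ^ (1 / (n : ℝ)) * N ^ (1 / (n : ℝ).conjExponent) := by
      rw [← ENNReal.rpow_add _ _ h0 hNlt.ne]
      have := hconj.inv_add_inv_eq_one
      rw [one_div, one_div, this, ENNReal.rpow_one]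
    nth_rw 1 [e] at hmain
    have hpos : 0 < 1 / (n : ℝ).conjExponent := one_div_pos.2 hconj.symm.pos
    have hz : N ^ (1 / (n : ℝ).conjExponent) ≠ 0 := by simp [h0, hNlt.ne]
    have ht : N ^ (1 / (n : ℝ).conjExponent) ≠ ⊤ :=
      ENNReal.rpow_ne_top_of_nonneg hpos.le hNlt.ne
    exact (ENNReal.mul_le_mul_iff_left hz ht).1 hmain

lemma fourierInv_conj_neg (g : Rd d → ℂ) (x : Rd d) :
    𝓕⁻ (fun ξ => (starRingEnd ℂ) (g (-ξ))) x = (starRingEnd ℂ) (𝓕⁻ g x) := by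
  rw [Real.fourierInv_eq', Real.fourierInv_eq', ← integral_conj, ← integral_neg_eq_self]
  congr 1; ext ξ
  simp only [smul_eq_mul, map_mul, neg_neg, inner_neg_left]
  rw [← Complex.exp_conj]
  congr 2
  rw [map_mul, Complex.conj_ofReal, Complex.conj_I]
  push_cast; ring

lemma half_add_half_mul {g : Rd d → ℂ} (hg : IsAmp g) (i : Fin d) {s : ℝ} (hs : s ≠ 0) (ξ : Rd d) :
    half i s ξ * g ξ + half i (-s) ξ * g ξ = g ξ := by
  by_cases h0 : g ξ = 0
  · simp [h0]
  have hξ := hg.off (subset_tsupport g h0) i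
  rcases lt_or_gt_of_ne (mul_ne_zero hs hξ) with h | h
  · simp [half, not_lt.2 h.le, h]
  · simp [half, not_lt.2 h.le, h]

/-- The symmetry of `g` says that `𝓕⁻ g` is real. Its two opposite half-space projections are then
complex conjugates with sum `𝓕⁻ g`, so the real part of either one is half of `𝓕⁻ g`. -/
lemma eLpNorm_half_le_of_symm {g : Rd d → ℂ} (hg : IsAmp g)
    (hsym : ∀ ξ, (starRingEnd ℂ) (g (-ξ)) = g ξ) (i : Fin d) {s : ℝ} (hs : s ≠ 0) (k : ℕ) :
    eLpNorm (𝓕⁻ (fun ξ => half i s ξ * g ξ)) ((2 * (k + 1) : ℕ) : ℝ≥0∞) volume ≤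
      ((2 * (k + 1) : ℕ) : ℝ≥0∞) * (2⁻¹ *
        eLpNorm (𝓕⁻ g) ((2 * (k + 1) : ℕ) : ℝ≥0∞) volume) := by
  have hh := hg.mul_sym (isSym_half i hs)
  have h1 := eLpNorm_le_of_spectrum_half hh (i := i) (s := s)
    (fun ξ hξ => by simp [half, not_lt.2 hξ]) k
  refine h1.trans ?_
  gcongr
  have hc := hg.mul_sym (isSym_half i (neg_ne_zero.2 hs))
  have e : (fun x => ((𝓕⁻ (fun ξ => half i s ξ * g ξ) x).re : ℂ)) = (2⁻¹ : ℂ) • 𝓕⁻ g := by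
    ext x
    have h2 : (starRingEnd ℂ) (𝓕⁻ (fun ξ => half i s ξ * g ξ) x) =
        𝓕⁻ (fun ξ => half i (-s) ξ * g ξ) x := by
      rw [← fourierInv_conj_neg]
      have e5 : (fun ξ => (starRingEnd ℂ) (half i s (-ξ) * g (-ξ))) =
          fun ξ => half i (-s) ξ * g ξ := by
        ext ξ
        rw [map_mul, hsym, half_neg_arg]
        congr 1
        simp only [half]; split_ifs <;> simp
      rw [e5]
    have h3 : 𝓕⁻ (fun ξ => half i s ξ * g ξ) x + 𝓕⁻ (fun ξ => half i (-s) ξ * g ξ) x = 𝓕⁻ g x := by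
      have h4 : (fun ξ => half i s ξ * g ξ) + (fun ξ => half i (-s) ξ * g ξ) = g := by
        ext ξ; exact half_add_half_mul hg i hs ξ
      have := congrFun (fourierInv_add hh.integrable hc.integrable) x
      rw [h4] at this
      exact this.symm
    rw [← h2, Complex.add_conj] at h3
    rw [Pi.smul_apply, ← h3, smul_eq_mul]
    push_cast; ring
  rw [e, eLpNorm_const_smul]
  refine le_of_eq ?_
  congr 1
  rw [enorm_inv (by norm_num), ← ofReal_norm, Complex.norm_ofNat]
  simp

lemma ampMul_half_even (i : Fin d) {s : ℝ} (hs : s ≠ 0) (k : ℕ) :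
    AmpMul ((2 * (k + 1) : ℕ) : ℝ≥0∞) (half i s) ((2 * (k + 1) : ℕ) : ℝ≥0∞) := by
  intro g hg
  set n : ℕ := 2 * (k + 1) with hn
  have hn1 : (1 : ℝ≥0∞) ≤ n := by
    have : 1 ≤ n := by omega
    exact_mod_cast this
  set g' : Rd d → ℂ := fun ξ => (starRingEnd ℂ) (g (-ξ)) with hg'
  have hg'a : IsAmp g' := hg.conj_neg
  have hconj : ∀ x, 𝓕⁻ g' x = (starRingEnd ℂ) (𝓕⁻ g x) := fourierInv_conj_neg g
  have hnorm : eLpNorm (𝓕⁻ g') n volume = eLpNorm (𝓕⁻ g) n volume := by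
    refine eLpNorm_congr_norm_ae (Eventually.of_forall fun x => ?_)
    rw [hconj, RCLike.norm_conj]
  -- The amplitudes `a` and `b` correspond to `2 Re` and `-2 Im` of `𝓕⁻ g`, and `g = (a - i b) / 2`.
  -- The real-valued case applies to each of them.
  set a : Rd d → ℂ := g + g' with ha
  set b : Rd d → ℂ := fun ξ => Complex.I * (g - g') ξ with hb
  have haA : IsAmp a := hg.add hg'a
  have hbA : IsAmp b := (hg.sub hg'a).const_mul _
  have h1 := eLpNorm_half_le_of_symm haA (fun ξ => by simp [ha, hg', add_comm]) i hs k
  have h2 := eLpNorm_half_le_of_symm hbA (fun ξ => by simp [hb, hg']; ring) i hs k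
  rw [← hn] at h1 h2
  have hA := (haA.mul_sym (isSym_half i hs))
  have hB := (hbA.mul_sym (isSym_half i hs))
  have ea : eLpNorm (𝓕⁻ a) n volume ≤ 2 * eLpNorm (𝓕⁻ g) n volume := by
    rw [ha, fourierInv_add hg.integrable hg'a.integrable]
    refine (eLpNorm_add_le (hg.memLp n).1 (hg'a.memLp n).1 hn1).trans_eq ?_
    rw [hnorm, two_mul]
  have enI : ‖Complex.I‖ₑ = 1 := by rw [← ofReal_norm]; simp
  have eb : eLpNorm (𝓕⁻ b) n volume ≤ 2 * eLpNorm (𝓕⁻ g) n volume := by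
    have : 𝓕⁻ b = Complex.I • (𝓕⁻ g - 𝓕⁻ g') := by
      rw [hb, fourierInv_const_mul, fourierInv_sub hg.integrable hg'a.integrable]; rfl
    rw [this, eLpNorm_const_smul, enI, one_mul]
    refine (eLpNorm_sub_le (hg.memLp n).1 (hg'a.memLp n).1 hn1).trans_eq ?_
    rw [hnorm, two_mul]
  have edec : 𝓕⁻ (fun ξ => half i s ξ * g ξ) =
      (2⁻¹ : ℂ) • (𝓕⁻ (fun ξ => half i s ξ * a ξ) - Complex.I • 𝓕⁻ (fun ξ => half i s ξ * b ξ)) := by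
    have h3 : Complex.I • 𝓕⁻ (fun ξ => half i s ξ * b ξ) =
        𝓕⁻ (fun ξ => Complex.I * (half i s ξ * b ξ)) := by
      rw [fourierInv_const_mul]; rfl
    rw [h3, ← fourierInv_sub hA.integrable (hB.const_mul _).integrable]
    have h4 : ∀ f : Rd d → ℂ, (2⁻¹ : ℂ) • 𝓕⁻ f = 𝓕⁻ (fun ξ => 2⁻¹ * f ξ) := fun f => by
      rw [fourierInv_const_mul]; rfl
    rw [h4]
    congr 1; ext ξ
    simp only [ha, hb, Pi.add_apply, Pi.sub_apply]
    have : Complex.I * (half i s ξ * (Complex.I * (g ξ - g' ξ))) = -(half i s ξ * (g ξ - g' ξ)) := by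
      linear_combination (half i s ξ * (g ξ - g' ξ)) * Complex.I_mul_I
    rw [this]; ring
  rw [edec, eLpNorm_const_smul]
  have e2 : ‖(2⁻¹ : ℂ)‖ₑ = 2⁻¹ := by
    rw [enorm_inv (by norm_num), ← ofReal_norm, Complex.norm_ofNat]; simp
  rw [e2]
  have htwo : (2 : ℝ≥0∞)⁻¹ * 2 = 1 := ENNReal.inv_mul_cancel (by simp) (by simp)
  calc (2 : ℝ≥0∞)⁻¹ * _ ≤ 2⁻¹ * (n * (2⁻¹ * (2 * eLpNorm (𝓕⁻ g) n volume)) +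
        n * (2⁻¹ * (2 * eLpNorm (𝓕⁻ g) n volume))) := by
        gcongr
        refine (eLpNorm_sub_le (hA.memLp n).1 ((hB.memLp n).1.const_smul _) hn1).trans ?_
        rw [eLpNorm_const_smul, enI, one_mul]
        gcongr
        · exact h1.trans (by gcongr)
        · exact h2.trans (by gcongr)
    _ = (2⁻¹ * 2) * (2⁻¹ * 2) * (n * eLpNorm (𝓕⁻ g) n volume) := by ring
    _ = _ := by rw [htwo, one_mul, one_mul]

/-! ### Marcinkiewicz interpolation. -/

lemma lintegral_Ioi_indicator_Iio_rpow {y c : ℝ} (hy : 0 ≤ y) (hc : 0 < c) :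
    ∫⁻ t in Set.Ioi (0 : ℝ), (Set.Iio y).indicator (fun t => ENNReal.ofReal (t ^ (c - 1))) t =
      ENNReal.ofReal (y ^ c / c) := by
  rw [lintegral_indicator measurableSet_Iio, Measure.restrict_restrict measurableSet_Iio,
    Set.inter_comm, Set.Ioi_inter_Iio]
  have hI : IntegrableOn (fun t : ℝ => t ^ (c - 1)) (Set.Ioc 0 y) := by
    have := intervalIntegral.intervalIntegrable_rpow' (a := 0) (b := y) (r := c - 1) (by linarith)
    rwa [intervalIntegrable_iff_integrableOn_Ioc_of_le hy] at this
  rw [setLIntegral_congr Ioo_ae_eq_Ioc, ← ofReal_integral_eq_lintegral_ofReal hI]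
  · rw [← intervalIntegral.integral_of_le hy, integral_rpow (Or.inl (by linarith))]
    congr 1
    rw [sub_add_cancel, Real.zero_rpow hc.ne', sub_zero]
  · refine (ae_restrict_iff' measurableSet_Ioc).2 (Eventually.of_forall fun t ht => ?_)
    exact Real.rpow_nonneg ht.1.le _

lemma lintegral_Ioi_indicator_Ici_rpow {y c : ℝ} (hy : 0 < y) (hc : 0 < c) :
    ∫⁻ t in Set.Ioi (0 : ℝ), (Set.Ici y).indicator (fun t => ENNReal.ofReal (t ^ (-c - 1))) t =
      ENNReal.ofReal (y ^ (-c) / c) := by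
  rw [lintegral_indicator measurableSet_Ici, Measure.restrict_restrict measurableSet_Ici]
  have : Set.Ici y ∩ Set.Ioi 0 = Set.Ici y :=
    Set.inter_eq_left.2 fun t ht => lt_of_lt_of_le hy ht
  rw [this, setLIntegral_congr Ioi_ae_eq_Ici.symm, ← ofReal_integral_eq_lintegral_ofReal
    (integrableOn_Ioi_rpow_of_lt (by linarith) hy)]
  · rw [integral_Ioi_rpow_of_lt (by linarith) hy]
    congr 1
    rw [sub_add_cancel, neg_div_neg_eq]
  · refine (ae_restrict_iff' measurableSet_Ioi).2 (Eventually.of_forall fun t ht => ?_)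
    exact Real.rpow_nonneg (hy.trans ht).le _

lemma ofReal_rpow_norm {z : ℂ} {a : ℝ} (ha : 0 ≤ a) :
    ENNReal.ofReal (‖z‖ ^ a) = ‖z‖ₑ ^ a := by
  rw [← ENNReal.ofReal_rpow_of_nonneg (norm_nonneg _) ha, ofReal_norm]

/-- Tonelli's theorem: for fixed `x` the integral in `t` is `∫₀^{|f x|} t^(P-a-1) dt = |f x|^(P-a) /
(P-a)`, convergent at zero because `a < P`. -/
lemma lintegral_truncate_high {f : Rd d → ℂ} (hf : Continuous f) {a P : ℝ} (ha : 0 < a) (haP : a < P) :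
    ∫⁻ t in Set.Ioi (0 : ℝ), (∫⁻ x in {x | t < ‖f x‖}, ‖f x‖ₑ ^ a) * ENNReal.ofReal (t ^ (P - a - 1)) =
      ENNReal.ofReal (P - a)⁻¹ * ∫⁻ x, ‖f x‖ₑ ^ P := by
  have hset : MeasurableSet {z : ℝ × Rd d | z.1 < ‖f z.2‖} :=
    (isOpen_lt continuous_fst (hf.comp continuous_snd).norm).measurableSet
  have hm : Measurable (fun z : ℝ × Rd d => {z : ℝ × Rd d | z.1 < ‖f z.2‖}.indicator
      (fun z => ‖f z.2‖ₑ ^ a * ENNReal.ofReal (z.1 ^ (P - a - 1))) z) := by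
    refine Measurable.indicator ?_ hset
    have hf2 : Measurable fun z : ℝ × Rd d => ‖f z.2‖ₑ :=
      (hf.comp continuous_snd).measurable.enorm
    fun_prop
  calc _ = ∫⁻ t in Set.Ioi (0 : ℝ), ∫⁻ x, {z : ℝ × Rd d | z.1 < ‖f z.2‖}.indicator
        (fun z => ‖f z.2‖ₑ ^ a * ENNReal.ofReal (z.1 ^ (P - a - 1))) (t, x) := by
        refine lintegral_congr fun t => ?_
        have hst : MeasurableSet {x | t < ‖f x‖} := (isOpen_lt continuous_const hf.norm).measurableSet
        rw [← lintegral_indicator hst, ← lintegral_mul_const' _ _ ENNReal.ofReal_ne_top]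
        refine lintegral_congr fun x => ?_
        by_cases h : t < ‖f x‖ <;> simp [Set.indicator, h]
    _ = ∫⁻ x, ∫⁻ t in Set.Ioi (0 : ℝ), {z : ℝ × Rd d | z.1 < ‖f z.2‖}.indicator
        (fun z => ‖f z.2‖ₑ ^ a * ENNReal.ofReal (z.1 ^ (P - a - 1))) (t, x) :=
        lintegral_lintegral_swap hm.aemeasurable
    _ = ∫⁻ x, ENNReal.ofReal (P - a)⁻¹ * ‖f x‖ₑ ^ P := by
        refine lintegral_congr fun x => ?_
        have := lintegral_Ioi_indicator_Iio_rpow (norm_nonneg (f x)) (sub_pos.2 haP)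
        calc _ = ∫⁻ t in Set.Ioi (0 : ℝ), ‖f x‖ₑ ^ a *
              (Set.Iio ‖f x‖).indicator (fun t => ENNReal.ofReal (t ^ (P - a - 1))) t := by
              refine lintegral_congr fun t => ?_
              by_cases h : t < ‖f x‖ <;> simp [Set.indicator, h]
          _ = ‖f x‖ₑ ^ a * ENNReal.ofReal (‖f x‖ ^ (P - a) / (P - a)) := by
              rw [lintegral_const_mul' _ _ (by simp [ha.le]), this]
          _ = _ := by
              rw [div_eq_inv_mul, ENNReal.ofReal_mul (by simp [haP.le]),
                ofReal_rpow_norm (by linarith), mul_left_comm,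
                ← ENNReal.rpow_add_of_nonneg _ _ ha.le (by linarith)]
              congr 2; ring
    _ = _ := lintegral_const_mul' _ _ ENNReal.ofReal_ne_top

lemma lintegral_truncate_low {f : Rd d → ℂ} (hf : Continuous f) {b P : ℝ} (hP : 0 < P) (hbP : P < b) :
    ∫⁻ t in Set.Ioi (0 : ℝ), (∫⁻ x in {x | ‖f x‖ ≤ t}, ‖f x‖ₑ ^ b) * ENNReal.ofReal (t ^ (P - b - 1)) ≤
      ENNReal.ofReal (b - P)⁻¹ * ∫⁻ x, ‖f x‖ₑ ^ P := by
  have hset : MeasurableSet {z : ℝ × Rd d | ‖f z.2‖ ≤ z.1} :=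
    (isClosed_le (hf.comp continuous_snd).norm continuous_fst).measurableSet
  have hm : Measurable (fun z : ℝ × Rd d => {z : ℝ × Rd d | ‖f z.2‖ ≤ z.1}.indicator
      (fun z => ‖f z.2‖ₑ ^ b * ENNReal.ofReal (z.1 ^ (P - b - 1))) z) := by
    refine Measurable.indicator ?_ hset
    have hf2 : Measurable fun z : ℝ × Rd d => ‖f z.2‖ₑ :=
      (hf.comp continuous_snd).measurable.enorm
    fun_prop
  have hb : 0 < b := hP.trans hbP
  calc _ = ∫⁻ t in Set.Ioi (0 : ℝ), ∫⁻ x, {z : ℝ × Rd d | ‖f z.2‖ ≤ z.1}.indicator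
        (fun z => ‖f z.2‖ₑ ^ b * ENNReal.ofReal (z.1 ^ (P - b - 1))) (t, x) := by
        refine lintegral_congr fun t => ?_
        have hst : MeasurableSet {x | ‖f x‖ ≤ t} :=
          (isClosed_le hf.norm continuous_const).measurableSet
        rw [← lintegral_indicator hst, ← lintegral_mul_const' _ _ ENNReal.ofReal_ne_top]
        refine lintegral_congr fun x => ?_
        by_cases h : ‖f x‖ ≤ t <;> simp [Set.indicator, h]
    _ = ∫⁻ x, ∫⁻ t in Set.Ioi (0 : ℝ), {z : ℝ × Rd d | ‖f z.2‖ ≤ z.1}.indicator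
        (fun z => ‖f z.2‖ₑ ^ b * ENNReal.ofReal (z.1 ^ (P - b - 1))) (t, x) :=
        lintegral_lintegral_swap hm.aemeasurable
    _ ≤ ∫⁻ x, ENNReal.ofReal (b - P)⁻¹ * ‖f x‖ₑ ^ P := by
        refine lintegral_mono fun x => ?_
        -- Where `f x = 0` the weight alone is not integrable at zero, but the integrand vanishes
        -- since `b > 0`.
        rcases eq_or_ne (f x) 0 with h0 | h0
        · simp [Set.indicator, h0, ENNReal.zero_rpow_of_pos hb]
        have hpos := norm_pos_iff.2 h0
        have := lintegral_Ioi_indicator_Ici_rpow hpos (sub_pos.2 hbP)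
        have e : -(b - P) - 1 = P - b - 1 := by ring
        rw [e] at this
        refine le_of_eq ?_
        calc _ = ∫⁻ t in Set.Ioi (0 : ℝ), ‖f x‖ₑ ^ b *
              (Set.Ici ‖f x‖).indicator (fun t => ENNReal.ofReal (t ^ (P - b - 1))) t := by
              refine lintegral_congr fun t => ?_
              by_cases h : ‖f x‖ ≤ t <;> simp [Set.indicator, h]
          _ = ‖f x‖ₑ ^ b * ENNReal.ofReal (‖f x‖ ^ (-(b - P)) / (b - P)) := by
              rw [lintegral_const_mul' _ _ (by simp [hb.le]), this]
          _ = _ := by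
              rw [div_eq_inv_mul, ENNReal.ofReal_mul (by simp [hbP.le]), mul_left_comm,
                ← ofReal_rpow_norm hb.le, ← ENNReal.ofReal_mul (by positivity),
                ← Real.rpow_add hpos, ← ofReal_rpow_norm hP.le]
              congr 3; ring
    _ = _ := lintegral_const_mul' _ _ ENNReal.ofReal_ne_top

/-- The distribution function estimate in the Marcinkiewicz interpolation theorem. -/
lemma meas_lt_le_of_ampMul {p₀ p₁ : ℝ≥0∞} (h0 : 1 < p₀) (h0t : p₀ ≠ ⊤) (h1 : 1 < p₁) (h1t : p₁ ≠ ⊤)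
    {m : Rd d → ℂ} (hs : IsSym m) {A B : ℝ≥0∞} (hA : A ≠ ⊤) (hB : B ≠ ⊤) (hm0 : AmpMul p₀ m A)
    (hm1 : AmpMul p₁ m B) {g : Rd d → ℂ} (hg : IsAmp g) {t : ℝ} (ht : 0 < t) :
    volume {x | t < ‖𝓕⁻ (fun ξ => m ξ * g ξ) x‖ / 2} ≤
      A ^ p₀.toReal * ((∫⁻ x in {x | t < ‖𝓕⁻ g x‖}, ‖𝓕⁻ g x‖ₑ ^ p₀.toReal) *
        ENNReal.ofReal (t ^ (-p₀.toReal))) +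
      B ^ p₁.toReal * ((∫⁻ x in {x | ‖𝓕⁻ g x‖ ≤ t}, ‖𝓕⁻ g x‖ₑ ^ p₁.toReal) *
        ENNReal.ofReal (t ^ (-p₁.toReal))) := by
  set f : Rd d → ℂ := 𝓕⁻ g with hf
  have hfc : Continuous f := hg.continuous_fourierInv
  have hsets : MeasurableSet {x | t < ‖f x‖} := (isOpen_lt continuous_const hfc.norm).measurableSet
  have hsets' : MeasurableSet {x | ‖f x‖ ≤ t} := (isClosed_le hfc.norm continuous_const).measurableSet
  set f₁ := {x | t < ‖f x‖}.indicator f with hf1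
  set f₂ := {x | ‖f x‖ ≤ t}.indicator f with hf2
  have hf₁ : MemLp f₁ p₀ volume := (hg.memLp p₀).indicator hsets
  have hf₂ : MemLp f₂ p₁ volume := (hg.memLp p₁).indicator hsets'
  have hsum : ∀ x, f₁ x + f₂ x = f x := fun x => by
    by_cases h : t < ‖f x‖
    · simp [hf1, hf2, h, not_le.2 h]
    · simp [hf1, hf2, h, not_lt.1 h]
  obtain ⟨w₁, hw1, hr1, hb1⟩ := Rel.exists_of_ampMul h0 h0t hs hm0 hA hf₁
  obtain ⟨w₂, hw2, hr2, hb2⟩ := Rel.exists_of_ampMul h1 h1t hs hm1 hB hf₂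
  set T : Rd d → ℂ := 𝓕⁻ (fun ξ => m ξ * g ξ) with hT
  have hTr : Rel m f T := Rel.of_amp hg hs
  have hT0 : MemLp T p₀ volume := (hg.mul_sym hs).memLp p₀
  obtain ⟨q₀, hq0, -, -⟩ := exists_holderConjugate h0 h0t
  obtain ⟨q₁, hq1, -, -⟩ := exists_holderConjugate h1 h1t
  -- The images of the high part, in `L^{p₀}`, and of the low part, in `L^{p₁}`, add up to `T`. The
  -- operators are only known through pairings, so this is checked against amplitudes, which lie in
  -- all the dual spaces.
  have hae : (w₁ - T) + w₂ =ᵐ[volume] 0 := by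
    refine ae_eq_zero_of_forall_amp h0 h0t h1 h1t (hw1.sub hT0) hw2 fun k hk => ?_
    have i1 := integrable_mul_of_holder (q := q₀) hw1 (hk.memLp q₀)
    have i2 := integrable_mul_of_holder (q := q₀) hT0 (hk.memLp q₀)
    have i3 := integrable_mul_of_holder (q := q₁) hw2 (hk.memLp q₁)
    have hk' := hk.mul_sym hs.neg_arg
    have j1 := integrable_mul_of_holder (q := q₀) hf₁ (hk'.memLp q₀)
    have j3 := integrable_mul_of_holder (q := q₁) hf₂ (hk'.memLp q₁)
    calc _ = ∫ x, (w₁ x * 𝓕⁻ k x - T x * 𝓕⁻ k x) + w₂ x * 𝓕⁻ k x := by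
          congr 1; ext x
          simp only [Pi.sub_apply]; ring
      _ = (∫ x, w₁ x * 𝓕⁻ k x) - (∫ x, T x * 𝓕⁻ k x) + ∫ x, w₂ x * 𝓕⁻ k x := by
          have i12 : Integrable (fun x => w₁ x * 𝓕⁻ k x - T x * 𝓕⁻ k x) := i1.sub i2
          rw [integral_add i12 i3, integral_sub i1 i2]
      _ = (∫ x, f₁ x * 𝓕⁻ (fun ξ => m (-ξ) * k ξ) x + f₂ x * 𝓕⁻ (fun ξ => m (-ξ) * k ξ) x) -
            ∫ x, f x * 𝓕⁻ (fun ξ => m (-ξ) * k ξ) x := by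
          rw [hr1 k hk, hr2 k hk, hTr k hk, integral_add j1 j3]; ring
      _ = 0 := by simp only [← add_mul, hsum, sub_self]
  have ht0 : ENNReal.ofReal t ≠ 0 := by simpa using ht
  have hp0 : p₀ ≠ 0 := (zero_lt_one.trans h0).ne'
  have hp1 : p₁ ≠ 0 := (zero_lt_one.trans h1).ne'
  have e1 : volume {x | t < ‖T x‖ / 2} ≤ volume {x | ENNReal.ofReal t ≤ ‖w₁ x‖ₑ} +
      volume {x | ENNReal.ofReal t ≤ ‖w₂ x‖ₑ} := by
    refine le_trans (measure_mono_ae ?_) (measure_union_le _ _)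
    filter_upwards [hae] with x hx hx2
    have hx3 : T x = w₁ x + w₂ x := by
      have : w₁ x - T x + w₂ x = 0 := hx
      linear_combination -this
    have hx4 : t < ‖T x‖ / 2 := hx2
    have := norm_add_le (w₁ x) (w₂ x)
    rw [← hx3] at this
    have hcase : t ≤ ‖w₁ x‖ ∨ t ≤ ‖w₂ x‖ := by
      by_contra! h
      linarith [h.1, h.2]
    rcases hcase with h | h
    · left
      change ENNReal.ofReal t ≤ ‖w₁ x‖ₑ
      rw [← ofReal_norm]; exact ENNReal.ofReal_le_ofReal h
    · right
      change ENNReal.ofReal t ≤ ‖w₂ x‖ₑ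
      rw [← ofReal_norm]; exact ENNReal.ofReal_le_ofReal h
  have key : ∀ {p : ℝ≥0∞} (_ : p ≠ 0) (_ : p ≠ ⊤) {w φ : Rd d → ℂ} {S : Set (Rd d)} {C : ℝ≥0∞}
      (_ : MemLp w p volume) (_ : MeasurableSet S) (_ : φ = S.indicator f)
      (_ : eLpNorm w p volume ≤ C * eLpNorm φ p volume),
      volume {x | ENNReal.ofReal t ≤ ‖w x‖ₑ} ≤
        C ^ p.toReal * ((∫⁻ x in S, ‖f x‖ₑ ^ p.toReal) * ENNReal.ofReal (t ^ (-p.toReal))) := by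
    intro p hp hpt w φ S C hw hS hφ hb
    have hP := ENNReal.toReal_pos hp hpt
    have hin : eLpNorm φ p volume ^ p.toReal = ∫⁻ x in S, ‖f x‖ₑ ^ p.toReal := by
      rw [hφ, eLpNorm_indicator_eq_eLpNorm_restrict hS,
        eLpNorm_eq_lintegral_rpow_enorm_toReal hp hpt, ← ENNReal.rpow_mul,
        one_div_mul_cancel hP.ne', ENNReal.rpow_one]
    calc _ ≤ (ENNReal.ofReal t)⁻¹ ^ p.toReal * eLpNorm w p volume ^ p.toReal :=
          meas_ge_le_mul_pow_eLpNorm_enorm volume hp hpt hw.1 ht0 (fun h => by simp at h)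
      _ ≤ (ENNReal.ofReal t)⁻¹ ^ p.toReal * (C * eLpNorm φ p volume) ^ p.toReal := by
          gcongr
      _ = _ := by
          rw [ENNReal.mul_rpow_of_nonneg _ _ hP.le, hin, ENNReal.inv_rpow, ← ENNReal.rpow_neg,
            ENNReal.ofReal_rpow_of_pos ht]
          ring
  exact e1.trans (add_le_add (key hp0 h0t hw1 hsets hf1 hb1) (key hp1 h1t hw2 hsets' hf2 hb2))

/-- Marcinkiewicz interpolation for Fourier multipliers. -/
lemma AmpMul.interpolate {p₀ p p₁ : ℝ≥0∞} (h0 : 1 < p₀) (h0p : p₀ < p) (hp1 : p < p₁) (h1t : p₁ ≠ ⊤)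
    {m : Rd d → ℂ} (hs : IsSym m) {A B : ℝ≥0∞} (hA : A ≠ ⊤) (hB : B ≠ ⊤) (hm0 : AmpMul p₀ m A)
    (hm1 : AmpMul p₁ m B) : ∃ C : ℝ≥0∞, C ≠ ⊤ ∧ AmpMul p m C := by
  have hpt : p ≠ ⊤ := (hp1.trans h1t.lt_top).ne
  have h0t : p₀ ≠ ⊤ := (h0p.trans hpt.lt_top).ne
  have hp1' : 1 < p := h0.trans h0p
  have h1 : 1 < p₁ := hp1'.trans hp1
  set a := p₀.toReal with ha
  set P := p.toReal with hP
  set b := p₁.toReal with hb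
  have ha0 : 0 < a := ENNReal.toReal_pos (zero_lt_one.trans h0).ne' h0t
  have haP : a < P := ENNReal.toReal_strict_mono hpt h0p
  have hPb : P < b := ENNReal.toReal_strict_mono h1t hp1
  have hP0 : 0 < P := ha0.trans haP
  -- The factor `2 ^ P` undoes the halving in the distribution estimate, `P` comes from the
  -- layer-cake formula, and the two summands are the contributions of the high and low truncations.
  set D : ℝ≥0∞ := 2 ^ P * (ENNReal.ofReal P *
    (A ^ a * ENNReal.ofReal (P - a)⁻¹ + B ^ b * ENNReal.ofReal (b - P)⁻¹)) with hD
  have hDt : D ≠ ⊤ := by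
    refine ENNReal.mul_ne_top (ENNReal.rpow_ne_top_of_nonneg hP0.le (by simp))
      (ENNReal.mul_ne_top ENNReal.ofReal_ne_top (ENNReal.add_ne_top.2 ⟨?_, ?_⟩))
    · exact ENNReal.mul_ne_top (ENNReal.rpow_ne_top_of_nonneg ha0.le hA) ENNReal.ofReal_ne_top
    · exact ENNReal.mul_ne_top (ENNReal.rpow_ne_top_of_nonneg (hP0.trans hPb).le hB)
        ENNReal.ofReal_ne_top
  refine ⟨D ^ (1 / P), ENNReal.rpow_ne_top_of_nonneg (by positivity) hDt, fun g hg => ?_⟩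
  have hp0 : p ≠ 0 := (zero_lt_one.trans hp1').ne'
  set f : Rd d → ℂ := 𝓕⁻ g with hf
  have hfc : Continuous f := hg.continuous_fourierInv
  set T : Rd d → ℂ := 𝓕⁻ (fun ξ => m ξ * g ξ) with hT
  have hTc : Continuous T := (hg.mul_sym hs).continuous_fourierInv
  have hlayer := lintegral_rpow_eq_lintegral_meas_lt_mul (volume : Measure (Rd d))
    (f := fun x => ‖T x‖ / 2) (Eventually.of_forall fun x => by positivity)
    (by fun_prop : AEMeasurable (fun x => ‖T x‖ / 2) volume) hP0
  have hleft : ∫⁻ x, ‖T x‖ₑ ^ P = 2 ^ P * ∫⁻ x, ENNReal.ofReal ((‖T x‖ / 2) ^ P) := by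
    rw [← lintegral_const_mul' _ _ (ENNReal.rpow_ne_top_of_nonneg hP0.le (by simp))]
    refine lintegral_congr fun x => ?_
    rw [← ENNReal.ofReal_rpow_of_nonneg (by positivity) hP0.le,
      ← ENNReal.mul_rpow_of_nonneg _ _ hP0.le, ← ofReal_norm]
    congr 1
    have : (2 : ℝ≥0∞) = ENNReal.ofReal 2 := by simp
    rw [this, ← ENNReal.ofReal_mul (by norm_num)]
    congr 1; ring
  have hmono1 : Measurable fun t : ℝ => (∫⁻ x in {x | t < ‖f x‖}, ‖f x‖ₑ ^ a) := by
    refine Antitone.measurable fun s t hst => ?_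
    exact lintegral_mono_set fun x hx => lt_of_le_of_lt hst hx
  have hbound : ∫⁻ x, ‖T x‖ₑ ^ P ≤ D * ∫⁻ x, ‖f x‖ₑ ^ P := by
    rw [hleft, hlayer, hD, mul_assoc, mul_assoc]
    gcongr
    calc _ ≤ ∫⁻ t in Set.Ioi (0 : ℝ), (A ^ a * ((∫⁻ x in {x | t < ‖f x‖}, ‖f x‖ₑ ^ a) *
          ENNReal.ofReal (t ^ (P - a - 1))) + B ^ b * ((∫⁻ x in {x | ‖f x‖ ≤ t}, ‖f x‖ₑ ^ b) *
          ENNReal.ofReal (t ^ (P - b - 1)))) := by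
          refine setLIntegral_mono' measurableSet_Ioi fun t ht => ?_
          have ht' : 0 < t := ht
          refine (mul_le_mul_left (meas_lt_le_of_ampMul h0 h0t h1 h1t hs hA hB hm0 hm1 hg ht') _).trans_eq ?_
          rw [add_mul, mul_assoc, mul_assoc, mul_assoc, mul_assoc,
            ← ENNReal.ofReal_mul (by positivity), ← ENNReal.ofReal_mul (by positivity),
            ← Real.rpow_add ht', ← Real.rpow_add ht']
          have e1 : -a + (P - 1) = P - a - 1 := by ring
          have e2 : -b + (P - 1) = P - b - 1 := by ring
          rw [e1, e2]
      _ = A ^ a * (∫⁻ t in Set.Ioi (0 : ℝ), (∫⁻ x in {x | t < ‖f x‖}, ‖f x‖ₑ ^ a) *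
          ENNReal.ofReal (t ^ (P - a - 1))) + B ^ b * ∫⁻ t in Set.Ioi (0 : ℝ),
          (∫⁻ x in {x | ‖f x‖ ≤ t}, ‖f x‖ₑ ^ b) * ENNReal.ofReal (t ^ (P - b - 1)) := by
          rw [lintegral_add_left, lintegral_const_mul' _ _ (ENNReal.rpow_ne_top_of_nonneg ha0.le hA),
            lintegral_const_mul' _ _ (ENNReal.rpow_ne_top_of_nonneg (hP0.trans hPb).le hB)]
          exact (hmono1.mul (by fun_prop)).const_mul _
      _ ≤ A ^ a * (ENNReal.ofReal (P - a)⁻¹ * ∫⁻ x, ‖f x‖ₑ ^ P) +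
          B ^ b * (ENNReal.ofReal (b - P)⁻¹ * ∫⁻ x, ‖f x‖ₑ ^ P) := by
          gcongr
          · exact (lintegral_truncate_high hfc ha0 haP).le
          · exact lintegral_truncate_low hfc hP0 hPb
      _ = _ := by ring
  rw [eLpNorm_eq_lintegral_rpow_enorm_toReal hp0 hpt, eLpNorm_eq_lintegral_rpow_enorm_toReal hp0 hpt,
    ← ENNReal.mul_rpow_of_nonneg _ _ (by positivity)]
  exact ENNReal.rpow_le_rpow hbound (by positivity)

/-! ### M. Riesz's theorem for all `1 < p < ∞`. -/

lemma exists_ampMul_half_of_two_le {p : ℝ≥0∞} (hp : 2 ≤ p) (hpt : p ≠ ⊤) (i : Fin d) {s : ℝ}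
    (hs : s ≠ 0) : ∃ C : ℝ≥0∞, C ≠ ⊤ ∧ AmpMul p (half i s) C := by
  have h2 := ampMul_half_even i hs 0
  simp only [zero_add, mul_one] at h2
  rcases hp.eq_or_lt with rfl | hp
  · exact ⟨_, ENNReal.natCast_ne_top 2, by exact_mod_cast h2⟩
  · obtain ⟨n, hn⟩ := ENNReal.exists_nat_gt hpt
    have hk := ampMul_half_even i hs n
    refine AmpMul.interpolate (p₀ := ((2 : ℕ) : ℝ≥0∞)) (p₁ := ((2 * (n + 1) : ℕ) : ℝ≥0∞))
      (by norm_num) (by exact_mod_cast hp) (hn.trans_le ?_) (ENNReal.natCast_ne_top _)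
      (isSym_half i hs) (ENNReal.natCast_ne_top _) (ENNReal.natCast_ne_top _) h2 hk
    exact_mod_cast (by omega : n ≤ 2 * (n + 1))

/-- M. Riesz's theorem: projections onto half spaces are bounded on `L^p`, `1 < p < ∞`. -/
lemma exists_ampMul_half {p : ℝ≥0∞} (hp : 1 < p) (hpt : p ≠ ⊤) (i : Fin d) {s : ℝ} (hs : s ≠ 0) :
    ∃ C : ℝ≥0∞, C ≠ ⊤ ∧ AmpMul p (half i s) C := by
  rcases le_total 2 p with h | h
  · exact exists_ampMul_half_of_two_le h hpt i hs
  · obtain ⟨q, hq, hq1, hqt⟩ := exists_holderConjugate hp hpt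
    have hq2 : 2 ≤ q := by
      have e := ENNReal.HolderConjugate.inv_add_inv_eq_one p q
      by_contra! hlt
      have h1 : (2 : ℝ≥0∞)⁻¹ ≤ p⁻¹ := ENNReal.inv_le_inv.2 h
      have h2 : (2 : ℝ≥0∞)⁻¹ < q⁻¹ := ENNReal.inv_lt_inv.2 hlt
      have h3 := ENNReal.add_lt_add_of_le_of_lt (by simp) h1 h2
      rw [e, ENNReal.inv_two_add_inv_two] at h3
      exact lt_irrefl _ h3
    -- The transpose of a half-space projection is the projection onto the opposite half space,
    -- whence the sign `-s`.
    obtain ⟨C, hC, h3⟩ := exists_ampMul_half_of_two_le hq2 hqt i (neg_ne_zero.2 hs)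
    refine ⟨C, hC, AmpMul.of_dual (q := q) hp hpt (isSym_half i hs) hC ?_⟩
    simpa only [half_neg_arg] using h3

/-! ### Poisson kernels and the operators `e^{-aΛ₁}`. -/

/-- The density on the line whose Fourier transform is `exp (-|s|)`. -/
def lineDensity (t : ℝ) : ℂ := 2 / (1 + (2 * Real.pi * t) ^ 2 : ℝ)

lemma norm_lineDensity (t : ℝ) : ‖lineDensity t‖ = 2 * (1 + (2 * Real.pi * t) ^ 2)⁻¹ := by
  have h : 0 < 1 + (2 * Real.pi * t) ^ 2 := by positivity
  rw [lineDensity, norm_div, Complex.norm_real, Real.norm_of_nonneg h.le, div_eq_mul_inv]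
  simp

lemma continuous_lineDensity : Continuous lineDensity := by
  unfold lineDensity
  refine continuous_const.div (by fun_prop) fun t => ?_
  have h : 0 < 1 + (2 * Real.pi * t) ^ 2 := by positivity
  exact_mod_cast h.ne'

lemma integrable_lineDensity : Integrable lineDensity := by
  refine (integrable_norm_iff continuous_lineDensity.aestronglyMeasurable).1 ?_
  simp only [norm_lineDensity]
  exact (integrable_inv_one_add_sq.comp_mul_left' (R := 2 * Real.pi) (by positivity)).const_mul 2

lemma integrable_exp_neg_abs : Integrable (fun s : ℝ => ((Real.exp (-|s|) : ℝ) : ℂ)) := by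
  refine Integrable.ofReal (f := fun s : ℝ => Real.exp (-|s|)) ?_
  rw [← integrableOn_univ, ← Set.Iic_union_Ioi (a := (0 : ℝ)), integrableOn_union]
  constructor
  · refine (integrableOn_exp_Iic 0).congr_fun (fun s hs => ?_) measurableSet_Iic
    simp only [abs_of_nonpos (show s ≤ 0 from hs), neg_neg]
  · refine (integrableOn_exp_neg_Ioi 0).congr_fun (fun s hs => ?_) measurableSet_Ioi
    simp only [abs_of_pos (show 0 < s from hs)]

lemma fourier_exp_neg_abs :
    𝓕 (fun s : ℝ => ((Real.exp (-|s|) : ℝ) : ℂ)) = lineDensity := by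
  ext t
  rw [Real.fourier_eq']
  have hint : Integrable (fun v : ℝ => Complex.exp ((↑(-2 * Real.pi * inner ℝ v t) : ℂ) * Complex.I) •
      ((Real.exp (-|v|) : ℝ) : ℂ)) := by
    refine integrable_exp_neg_abs.mono (by
      refine Continuous.aestronglyMeasurable ?_
      fun_prop) (Eventually.of_forall fun v => ?_)
    rw [norm_smul, Complex.norm_exp_ofReal_mul_I, one_mul]
  rw [← integral_add_compl (measurableSet_Iic (a := (0 : ℝ))) hint, Set.compl_Iic]
  have e1 : ∫ v in Set.Iic (0 : ℝ), Complex.exp ((↑(-2 * Real.pi * inner ℝ v t) : ℂ) * Complex.I) •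
      ((Real.exp (-|v|) : ℝ) : ℂ) = ∫ v in Set.Iic (0 : ℝ),
        Complex.exp ((1 - 2 * Real.pi * t * Complex.I) * v) := by
    refine setIntegral_congr_fun measurableSet_Iic fun v hv => ?_
    have hv' : v ≤ 0 := hv
    simp only [abs_of_nonpos hv', smul_eq_mul, neg_neg, Complex.ofReal_exp, ← Complex.exp_add]
    congr 1
    simp only [RCLike.inner_apply, conj_trivial]
    push_cast; ring
  have e2 : ∫ v in Set.Ioi (0 : ℝ), Complex.exp ((↑(-2 * Real.pi * inner ℝ v t) : ℂ) * Complex.I) •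
      ((Real.exp (-|v|) : ℝ) : ℂ) = ∫ v in Set.Ioi (0 : ℝ),
        Complex.exp ((-1 - 2 * Real.pi * t * Complex.I) * v) := by
    refine setIntegral_congr_fun measurableSet_Ioi fun v hv => ?_
    have hv' : 0 < v := hv
    simp only [abs_of_pos hv', smul_eq_mul, Complex.ofReal_exp, ← Complex.exp_add]
    congr 1
    simp only [RCLike.inner_apply, conj_trivial]
    push_cast; ring
  have n1 : (1 - 2 * Real.pi * t * Complex.I) ≠ 0 := fun h => by
    have := congrArg Complex.re h; simp at this
  have n2 : (-1 - 2 * Real.pi * t * Complex.I) ≠ 0 := fun h => by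
    have := congrArg Complex.re h; simp at this
  rw [e1, e2, integral_exp_mul_complex_Iic (by simp), integral_exp_mul_complex_Ioi (by simp)]
  have n3 : ((1 + (2 * Real.pi * t) ^ 2 : ℝ) : ℂ) =
      -((1 - 2 * Real.pi * t * Complex.I) * (-1 - 2 * Real.pi * t * Complex.I)) := by
    push_cast; linear_combination (4 * (Real.pi : ℂ) ^ 2 * t ^ 2) * Complex.I_sq
  rw [lineDensity, n3]
  simp only [Complex.ofReal_zero, mul_zero, Complex.exp_zero]
  field_simp
  ring

lemma integral_lineDensity_mul_exp (s : ℝ) :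
    ∫ t : ℝ, lineDensity t * Complex.exp ((↑(-(2 * Real.pi * (t * s))) : ℂ) * Complex.I) =
      ((Real.exp (-|s|) : ℝ) : ℂ) := by
  have hc : Continuous (fun s : ℝ => ((Real.exp (-|s|) : ℝ) : ℂ)) := by fun_prop
  have h := hc.fourierInv_fourier_eq integrable_exp_neg_abs
    (by rw [fourier_exp_neg_abs]; exact integrable_lineDensity)
  rw [fourier_exp_neg_abs] at h
  have h2 := congrFun h (-s)
  rw [Real.fourierInv_eq'] at h2
  simp only [abs_neg] at h2
  rw [← h2]
  refine integral_congr_ae (Eventually.of_forall fun t => ?_)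
  simp only [smul_eq_mul]
  rw [mul_comm]
  congr 3
  simp only [RCLike.inner_apply, conj_trivial]
  ring_nf

/-- The translations entering the multiplier `exp (-∑ i, a i * |ξ i|)`. -/
def expShift (a : Fin d → ℝ) (t : Fin d → ℝ) : Rd d := WithLp.toLp 2 fun i => a i * t i

/-- One fixed kernel serves all dampings: the parameters enter only through the translations
`expShift a`, and may vanish in some coordinates. -/
def expKernel (t : Fin d → ℝ) : ℂ := ∏ i, lineDensity (t i)

lemma measurable_expShift (a : Fin d → ℝ) : Measurable (expShift a) := by
  unfold expShift
  fun_prop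

lemma integrable_expKernel : Integrable (expKernel (d := d)) :=
  Integrable.fintype_prod (f := fun _ => lineDensity) fun _ => integrable_lineDensity

/-- The density is nonnegative, so its `L^1` norm is the value at zero of its Fourier transform. All
dampings and `e^{-aΛ₁}` are therefore contractions of `L^p`, which is why the final constants do not
depend on time. -/
lemma lintegral_enorm_expKernel : ∫⁻ t, ‖expKernel (d := d) t‖ₑ = 1 := by
  have h1 : ∫ t : Fin d → ℝ, ‖expKernel t‖ = 1 := by
    have h0 : ∫ t : ℝ, ‖lineDensity t‖ = 1 := by
      have h := integral_lineDensity_mul_exp 0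
      simp only [mul_zero, neg_zero, Complex.ofReal_zero, zero_mul, Complex.exp_zero, mul_one,
        abs_zero, Real.exp_zero, Complex.ofReal_one] at h
      have h2 : ∀ t, lineDensity t = ((‖lineDensity t‖ : ℝ) : ℂ) := fun t => by
        rw [norm_lineDensity, lineDensity]; push_cast; rw [div_eq_mul_inv]
      rw [integral_congr_ae (Eventually.of_forall h2), integral_complex_ofReal] at h
      exact_mod_cast h
    simp only [expKernel, norm_prod]
    rw [integral_fintype_prod_volume_eq_prod (f := fun _ t => ‖lineDensity t‖)]
    exact Finset.prod_eq_one fun _ _ => h0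
  have h := ofReal_integral_norm_eq_lintegral_enorm (integrable_expKernel (d := d))
  rw [← h, h1, ENNReal.ofReal_one]

lemma avgSymbol_exp (a : Fin d → ℝ) (ξ : Rd d) :
    avgSymbol volume (expShift a) expKernel ξ = ((Real.exp (-∑ i, |a i * ξ i|) : ℝ) : ℂ) := by
  have h : ∀ t : Fin d → ℝ, expKernel t *
      Complex.exp (((-(2 * Real.pi * inner ℝ (expShift a t) ξ) : ℝ) : ℂ) * Complex.I) =
      ∏ i, (lineDensity (t i) *
        Complex.exp ((↑(-(2 * Real.pi * (t i * (a i * ξ i)))) : ℂ) * Complex.I)) := fun t => by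
    rw [Finset.prod_mul_distrib, ← Complex.exp_sum, expKernel]
    congr 2
    rw [← Finset.sum_mul, ← Complex.ofReal_sum]
    congr 2
    rw [PiLp.inner_apply, Finset.sum_neg_distrib, ← Finset.mul_sum]
    congr 2
    refine Finset.sum_congr rfl fun i _ => ?_
    change ξ i * (a i * t i) = _
    ring
  unfold avgSymbol
  refine (integral_congr_ae (Eventually.of_forall h)).trans ?_
  rw [integral_fintype_prod_volume_eq_prod (f := fun i t => lineDensity t *
        Complex.exp ((↑(-(2 * Real.pi * (t * (a i * ξ i)))) : ℂ) * Complex.I))]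
  simp only [integral_lineDensity_mul_exp]
  rw [← Finset.sum_neg_distrib, Real.exp_sum]
  push_cast
  rfl

lemma isSym_exp (a : Fin d → ℝ) :
    IsSym (fun ξ : Rd d => ((Real.exp (-∑ i, |a i * ξ i|) : ℝ) : ℂ)) := by
  refine Complex.ofRealCLM.contDiff.comp_contDiffOn ?_
  refine ContDiffOn.exp (ContDiffOn.neg (ContDiffOn.sum fun i _ => ?_))
  rcases eq_or_ne (a i) 0 with h | h
  · simp only [h, zero_mul, abs_zero]; exact contDiffOn_const
  · intro ξ hξ
    have h1 : ContDiffAt ℝ ∞ (fun ξ : Rd d => a i * ξ i) ξ :=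
      (contDiff_const.mul (EuclideanSpace.proj (𝕜 := ℝ) i).contDiff).contDiffAt
    exact ((contDiffAt_abs (mul_ne_zero h (hξ i))).comp ξ h1).contDiffWithinAt

/-- The operator `exp (-a Λ₁)` on functions. -/
def expAvg (a : ℝ) (u : Rd d → ℂ) : Rd d → ℂ :=
  avg volume (expShift fun _ => 2 * Real.pi * a) expKernel u

/-- The symbol of `exp (-a Λ₁)`. -/
def expSym (a : ℝ) (ξ : Rd d) : ℂ := ((Real.exp (-a * l1 ((2 * Real.pi) • ξ)) : ℝ) : ℂ)

lemma avgSymbol_expAvg {a : ℝ} (ha : 0 ≤ a) :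
    avgSymbol volume (expShift fun _ => 2 * Real.pi * a) expKernel = expSym (d := d) a := by
  ext ξ
  rw [avgSymbol_exp, expSym]
  congr 2
  rw [l1, neg_mul, Finset.mul_sum]
  congr 1
  refine Finset.sum_congr rfl fun i _ => ?_
  have e : (2 * Real.pi * a) * ξ i = a * ((2 * Real.pi) * ξ i) := by ring
  rw [PiLp.smul_apply, smul_eq_mul, e, abs_mul a, abs_of_nonneg ha]

lemma isSym_expSym {a : ℝ} (ha : 0 ≤ a) : IsSym (expSym (d := d) a) := by
  rw [← avgSymbol_expAvg ha, funext (avgSymbol_exp _)]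
  exact isSym_exp _

lemma memLp_expAvg {p : ℝ≥0∞} (hp : 1 ≤ p) (a : ℝ) {u : Rd d → ℂ} (hu : MemLp u p volume) :
    MemLp (expAvg a u) p volume := memLp_avg (measurable_expShift _) integrable_expKernel hu hp

lemma eLpNorm_expAvg_le {p : ℝ≥0∞} (hp : 1 ≤ p) (a : ℝ) {u : Rd d → ℂ}
    (hu : AEStronglyMeasurable u volume) : eLpNorm (expAvg a u) p volume ≤ eLpNorm u p volume :=
  (eLpNorm_avg_le (measurable_expShift _) integrable_expKernel hu hp).trans_eq
    (by rw [lintegral_enorm_expKernel, one_mul])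

lemma expAvg_fourierInv {a : ℝ} (ha : 0 ≤ a) {g : Rd d → ℂ} (hg : Integrable g) :
    expAvg a (𝓕⁻ g) = 𝓕⁻ (fun ξ => expSym a ξ * g ξ) := by
  rw [expAvg, avg_fourierInv (measurable_expShift _) integrable_expKernel hg, avgSymbol_expAvg ha]

lemma expNegTest_eq {a : ℝ} (ha : 0 ≤ a) (φ : 𝓢(Rd d, ℂ)) : expNegTest a φ = expAvg a φ := by
  have h : (φ : Rd d → ℂ) = 𝓕⁻ ⇑(𝓕 φ : 𝓢(Rd d, ℂ)) := by
    rw [← SchwartzMap.fourierInv_coe, FourierTransform.fourierInv_fourier_eq]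
  conv_rhs => rw [h, expAvg_fourierInv ha (SchwartzMap.integrable _)]
  rfl

lemma avg_neg_expShift (a : ℝ) (u : Rd d → ℂ) :
    avg volume (fun t => -expShift (fun _ => 2 * Real.pi * a) t) expKernel u = expAvg a u := by
  ext x
  unfold expAvg avg
  rw [← integral_neg_eq_self]
  refine integral_congr_ae (Eventually.of_forall fun t => ?_)
  have h1 : expKernel (-t) = expKernel t := by simp [expKernel, lineDensity]
  have h2 : expShift (fun _ => 2 * Real.pi * a) (-t) = -expShift (fun _ => 2 * Real.pi * a) t := by
    ext i; simp [expShift]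
  simp only [h1, h2, neg_neg]

lemma integral_expAvg_mul {p q : ℝ≥0∞} [hpq : ENNReal.HolderConjugate p q] (a : ℝ) {u v : Rd d → ℂ}
    (hu : MemLp u p volume) (hv : MemLp v q volume) :
    ∫ x, expAvg a u x * v x = ∫ x, u x * expAvg a v x := by
  rw [expAvg, integral_avg_mul (measurable_expShift _) integrable_expKernel hu hv,
    avg_neg_expShift]

lemma Rel.of_expAvg {p : ℝ≥0∞} (hp : 1 ≤ p) {a : ℝ} (ha : 0 ≤ a) {f : Rd d → ℂ}
    (hf : MemLp f p volume) : Rel (expSym a) f (expAvg a f) := by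
  rw [← avgSymbol_expAvg ha]
  exact Rel.of_avg (measurable_expShift _) integrable_expKernel hp hf

lemma ampMul_exp {p : ℝ≥0∞} (hp : 1 ≤ p) (a : Fin d → ℝ) :
    AmpMul p (fun ξ : Rd d => ((Real.exp (-∑ i, |a i * ξ i|) : ℝ) : ℂ)) 1 := by
  have h := (MulL.avgSymbol (measurable_expShift a) (integrable_expKernel (d := d)) hp).ampMul
  rwa [funext (avgSymbol_exp a), lintegral_enorm_expKernel] at h

/-! ### Trilinear identities read off on the Fourier side. -/

lemma IsAmp.eq_zero_of_notMem {g : Rd d → ℂ} (hg : IsAmp g) {ξ : Rd d} (h : ξ ∉ offHyper d) :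
    g ξ = 0 := by
  by_contra h0
  exact h (hg.off (subset_tsupport g h0))

lemma neg_mem_offHyper {ξ : Rd d} (h : ξ ∈ offHyper d) : -ξ ∈ offHyper d := fun i => by
  simpa using h i

/-- The integral of a triple product is an integral over frequencies with sum zero, here `ξ`, `η`
and `-ξ - η`. -/
lemma IsAmp.integral_mul_mul {f g h : Rd d → ℂ} (hf : IsAmp f) (hg : IsAmp g) (hh : IsAmp h) :
    Integrable (fun ξ => h ξ * ∫ η, f η * g (-ξ - η)) ∧
    ∫ x, (𝓕⁻ f x * 𝓕⁻ g x) * 𝓕⁻ h x = ∫ ξ, h ξ * ∫ η, f η * g (-ξ - η) := by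
  have hG : Integrable (fun x => 𝓕⁻ f x * 𝓕⁻ g x) := by
    have : ENNReal.HolderConjugate (2 : ℝ≥0∞) 2 := ENNReal.HolderConjugate.instTwoTwo
    exact integrable_mul_of_holder (p := 2) (q := 2) (hf.memLp 2) (hg.memLp 2)
  have e1 : ∀ ξ, 𝓕⁻ (fun x => 𝓕⁻ f x * 𝓕⁻ g x) ξ = ∫ η, f η * g (-ξ - η) := fun ξ => by
    rw [Real.fourierInv_eq_fourier_neg, fourier_fourierInv_mul hf.integrable
      (memLp_one_iff_integrable.1 (hg.memLp 1)), hg.fourier_fourierInv]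
  have e2 := integral_fourierInv_mul hh.integrable hG
  have e3 : ∫ x, (𝓕⁻ f x * 𝓕⁻ g x) * 𝓕⁻ h x = ∫ x, 𝓕⁻ h x * (𝓕⁻ f x * 𝓕⁻ g x) := by
    simp only [mul_comm]
  refine ⟨?_, ?_⟩
  · simp_rw [← e1]
    refine hh.integrable.mul_bdd (c := ∫ x, ‖𝓕⁻ f x * 𝓕⁻ g x‖) ?_ ?_
    · have : Continuous (𝓕 (fun x => 𝓕⁻ f x * 𝓕⁻ g x)) :=
        VectorFourier.fourierIntegral_continuous Real.continuous_fourierChar (L := innerₗ (Rd d))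
          continuous_inner hG
      have h2 : 𝓕⁻ (fun x => 𝓕⁻ f x * 𝓕⁻ g x) = fun ξ => 𝓕 (fun x => 𝓕⁻ f x * 𝓕⁻ g x) (-ξ) := by
        ext ξ; rw [Real.fourierInv_eq_fourier_neg]
      rw [h2]
      exact (this.comp continuous_neg).aestronglyMeasurable
    · exact Eventually.of_forall fun ξ => by
        rw [Real.fourierInv_eq_fourier_neg]
        exact VectorFourier.norm_fourierIntegral_le_integral_norm _ _ _ _ _
  · rw [e3, e2]
    simp_rw [e1]

/-- If `∑ e, z e ξ * z' e η * k e (ξ + η) = 0`, then `∑ e, k e(D) (z e(D) u * z' e(D) v) = 0`. -/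
lemma sum_integral_eq_zero_amp {ι : Type*} (s : Finset ι) {z z' k : ι → Rd d → ℂ}
    (hz : ∀ e ∈ s, IsSym (z e)) (hz' : ∀ e ∈ s, IsSym (z' e)) (hk : ∀ e ∈ s, IsSym (k e))
    (hsum : ∀ ξ ∈ offHyper d, ∀ η ∈ offHyper d, ξ + η ∈ offHyper d →
      ∑ e ∈ s, z e ξ * z' e η * k e (ξ + η) = 0)
    {f g h : Rd d → ℂ} (hf : IsAmp f) (hg : IsAmp g) (hh : IsAmp h) :
    ∑ e ∈ s, ∫ x, (𝓕⁻ (fun ξ => z e ξ * f ξ) x * 𝓕⁻ (fun ξ => z' e ξ * g ξ) x) *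
      𝓕⁻ (fun ξ => k e (-ξ) * h ξ) x = 0 := by
  have h1 := fun e (he : e ∈ s) => (hf.mul_sym (hz e he)).integral_mul_mul
    (hg.mul_sym (hz' e he)) (hh.mul_sym (hk e he).neg_arg)
  rw [Finset.sum_congr rfl fun e he => (h1 e he).2, ← integral_finsetSum _ fun e he => (h1 e he).1]
  refine integral_eq_zero_of_ae (Eventually.of_forall fun ξ => ?_)
  have h2 : ∀ e ∈ s, Integrable fun η => k e (-ξ) * h ξ *
      ((z e η * f η) * (z' e (-ξ - η) * g (-ξ - η))) := fun e he => by
    have a1 := hf.mul_sym (hz e he)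
    have a2 := hg.mul_sym (hz' e he)
    refine Integrable.const_mul ?_ _
    refine Continuous.integrable_of_hasCompactSupport
      (a1.smooth.continuous.mul (a2.smooth.continuous.comp (by fun_prop))) ?_
    exact a1.compact.mul_right
  change ∑ e ∈ s, _ = (0 : ℂ)
  simp_rw [← integral_const_mul]
  rw [← integral_finsetSum _ h2]
  refine integral_eq_zero_of_ae (Eventually.of_forall fun η => ?_)
  change ∑ e ∈ s, _ = (0 : ℂ)
  -- The amplitudes kill the integrand unless `ξ`, `η` and `-ξ - η` all avoid the hyperplanes, which
  -- is where `hsum` is assumed.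
  by_cases c1 : ξ ∈ offHyper d
  swap
  · simp [hh.eq_zero_of_notMem c1]
  by_cases c2 : η ∈ offHyper d
  swap
  · simp [hf.eq_zero_of_notMem c2]
  by_cases c3 : -ξ - η ∈ offHyper d
  swap
  · simp [hg.eq_zero_of_notMem c3]
  have c4 : η + (-ξ - η) = -ξ := by abel
  have := hsum η c2 _ c3 (by rw [c4]; exact neg_mem_offHyper c1)
  rw [c4] at this
  calc _ = ∑ e ∈ s, h ξ * f η * g (-ξ - η) * (z e η * z' e (-ξ - η) * k e (-ξ)) :=
        Finset.sum_congr rfl fun e _ => by ring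
    _ = 0 := by rw [← Finset.mul_sum, this, mul_zero]

lemma tendsto_fourierInv_mul {q C : ℝ≥0∞} (hq : 1 < q) (hqt : q ≠ ⊤) {m : Rd d → ℂ} (hs : IsSym m)
    (hm : AmpMul q m C) (hC : C ≠ ⊤) {f : ℕ → Rd d → ℂ} (hf : ∀ n, IsAmp (f n)) {u U : Rd d → ℂ}
    (hu : MemLp u q volume) (hU : MemLp U q volume) (hr : Rel m u U)
    (h : Tendsto (fun n => eLpNorm (𝓕⁻ (f n) - u) q volume) atTop (𝓝 0)) :
    Tendsto (fun n => eLpNorm (𝓕⁻ (fun ξ => m ξ * f n ξ) - U) q volume) atTop (𝓝 0) := by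
  refine tendsto_of_tendsto_of_tendsto_of_le_of_le tendsto_const_nhds
    (h := fun n => C * eLpNorm (𝓕⁻ (f n) - u) q volume) ?_ (fun n => zero_le) fun n => ?_
  · simpa using ENNReal.Tendsto.const_mul h (Or.inr hC)
  · exact Rel.bound hq hqt hs hm hC (((hf n).memLp q).sub hu)
      ((((hf n).mul_sym hs).memLp q).sub hU)
      (Rel.sub hq hqt hs ((hf n).memLp q) hu (((hf n).mul_sym hs).memLp q) hU
        (Rel.of_amp (hf n) hs) hr)

/-- For `q ≥ 2` one has `1/q ≤ 1/q'`, so Hölder's inequality applies with the complementary exponent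
`(1/q' - 1/q)⁻¹`, which is infinite when `q = 2`; the amplitude belongs to every `L^r`. -/
lemma memLp_mul_fourierInv {q q' : ℝ≥0∞} [hqq : ENNReal.HolderConjugate q q'] (h2 : 2 ≤ q)
    {U : Rd d → ℂ} (hU : MemLp U q volume) {h : Rd d → ℂ} (hh : IsAmp h) :
    MemLp (fun x => U x * 𝓕⁻ h x) q' volume := by
  have hle : q⁻¹ ≤ q'⁻¹ := by
    have h3 := ENNReal.HolderConjugate.inv_add_inv_eq_one q q'
    have h4 : q⁻¹ ≤ 2⁻¹ := ENNReal.inv_le_inv.2 h2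
    by_contra hlt
    push Not at hlt
    have : q⁻¹ + q'⁻¹ < 2⁻¹ + 2⁻¹ := ENNReal.add_lt_add_of_le_of_lt
      (ne_top_of_le_ne_top (by simp) h4) h4 (hlt.trans_le h4)
    rw [h3, ENNReal.inv_two_add_inv_two] at this
    exact lt_irrefl _ this
  have : ENNReal.HolderTriple q (q'⁻¹ - q⁻¹)⁻¹ q' :=
    ⟨by rw [inv_inv, add_tsub_cancel_of_le hle]⟩
  exact MemLp.mul' (p := q) (q := (q'⁻¹ - q⁻¹)⁻¹) (hh.memLp _) hU

/-- The identity for amplitudes is extended to `L^q` one factor at a time, by density. The condition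
`q ≥ 2` makes each remaining product with an amplitude a continuous functional on `L^q`. -/
lemma sum_integral_eq_zero {q : ℝ≥0∞} (h2 : 2 ≤ q) (hqt : q ≠ ⊤) {ι : Type*} (s : Finset ι)
    {z z' k : ι → Rd d → ℂ} (hz : ∀ e ∈ s, IsSym (z e)) (hz' : ∀ e ∈ s, IsSym (z' e))
    (hk : ∀ e ∈ s, IsSym (k e)) (hzm : ∀ e ∈ s, ∃ C : ℝ≥0∞, C ≠ ⊤ ∧ AmpMul q (z e) C)
    (hzm' : ∀ e ∈ s, ∃ C : ℝ≥0∞, C ≠ ⊤ ∧ AmpMul q (z' e) C)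
    (hsum : ∀ ξ ∈ offHyper d, ∀ η ∈ offHyper d, ξ + η ∈ offHyper d →
      ∑ e ∈ s, z e ξ * z' e η * k e (ξ + η) = 0)
    {u v : Rd d → ℂ} (hu : MemLp u q volume) (hv : MemLp v q volume) {U V : ι → Rd d → ℂ}
    (hU : ∀ e ∈ s, MemLp (U e) q volume) (hV : ∀ e ∈ s, MemLp (V e) q volume)
    (hrU : ∀ e ∈ s, Rel (z e) u (U e)) (hrV : ∀ e ∈ s, Rel (z' e) v (V e))
    {h : Rd d → ℂ} (hh : IsAmp h) :
    ∑ e ∈ s, ∫ x, (U e x * V e x) * 𝓕⁻ (fun ξ => k e (-ξ) * h ξ) x = 0 := by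
  have hq : 1 < q := lt_of_lt_of_le (by norm_num) h2
  obtain ⟨q', hqq, -, -⟩ := exists_holderConjugate hq hqt
  have hqq' : ENNReal.HolderConjugate q' q := hqq.symm
  obtain ⟨f, hf, hfu⟩ := exists_amp_dense hq hqt hu
  obtain ⟨g, hg, hgv⟩ := exists_amp_dense hq hqt hv
  have step1 : ∀ m, ∑ e ∈ s, ∫ x, (U e x * 𝓕⁻ (fun ξ => k e (-ξ) * h ξ) x) *
      𝓕⁻ (fun ξ => z' e ξ * g m ξ) x = 0 := fun m => by
    have hlim : Tendsto (fun n => ∑ e ∈ s, ∫ x, (𝓕⁻ (fun ξ => z' e ξ * g m ξ) x *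
        𝓕⁻ (fun ξ => k e (-ξ) * h ξ) x) * 𝓕⁻ (fun ξ => z e ξ * f n ξ) x) atTop
        (𝓝 (∑ e ∈ s, ∫ x, (𝓕⁻ (fun ξ => z' e ξ * g m ξ) x *
        𝓕⁻ (fun ξ => k e (-ξ) * h ξ) x) * U e x)) := by
      refine tendsto_finsetSum _ fun e he => ?_
      obtain ⟨C, hC, hm⟩ := hzm e he
      exact tendsto_integral_mul_of_eLpNorm (p := q') (q := q)
        (memLp_mul_fourierInv h2 (((hg m).mul_sym (hz' e he)).memLp q) (hh.mul_sym (hk e he).neg_arg))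
        (fun n => ((hf n).mul_sym (hz e he)).memLp q) (hU e he)
        (tendsto_fourierInv_mul hq hqt (hz e he) hm hC hf hu (hU e he) (hrU e he) hfu)
    have h0 : ∀ n, ∑ e ∈ s, ∫ x, (𝓕⁻ (fun ξ => z' e ξ * g m ξ) x *
        𝓕⁻ (fun ξ => k e (-ξ) * h ξ) x) * 𝓕⁻ (fun ξ => z e ξ * f n ξ) x = 0 := fun n => by
      rw [← sum_integral_eq_zero_amp s hz hz' hk hsum (hf n) (hg m) hh]
      refine Finset.sum_congr rfl fun e _ => integral_congr_ae (Eventually.of_forall fun x => ?_)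
      simp only; ring
    simp only [h0] at hlim
    rw [tendsto_nhds_unique (tendsto_const_nhds (x := (0 : ℂ))) hlim]
    refine Finset.sum_congr rfl fun e _ => integral_congr_ae (Eventually.of_forall fun x => ?_)
    simp only; ring
  have hlim : Tendsto (fun n => ∑ e ∈ s, ∫ x, (U e x * 𝓕⁻ (fun ξ => k e (-ξ) * h ξ) x) *
      𝓕⁻ (fun ξ => z' e ξ * g n ξ) x) atTop
      (𝓝 (∑ e ∈ s, ∫ x, (U e x * 𝓕⁻ (fun ξ => k e (-ξ) * h ξ) x) * V e x)) := by
    refine tendsto_finsetSum _ fun e he => ?_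
    obtain ⟨C, hC, hm⟩ := hzm' e he
    exact tendsto_integral_mul_of_eLpNorm (p := q') (q := q)
      (memLp_mul_fourierInv h2 (hU e he) (hh.mul_sym (hk e he).neg_arg))
      (fun n => ((hg n).mul_sym (hz' e he)).memLp q) (hV e he)
      (tendsto_fourierInv_mul hq hqt (hz' e he) hm hC hg hv (hV e he) (hrV e he) hgv)
  simp only [step1] at hlim
  rw [tendsto_nhds_unique (tendsto_const_nhds (x := (0 : ℂ))) hlim]
  refine Finset.sum_congr rfl fun e _ => integral_congr_ae (Eventually.of_forall fun x => ?_)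
  simp only; ring

/-! ### Smooth frequency cut-offs on functions and on distributions. -/

/-- A smooth compactly supported symbol. -/
structure Profile (d : ℕ) where
  toFun : Rd d → ℝ
  smooth : ContDiff ℝ ∞ toFun
  compact : HasCompactSupport toFun

namespace Profile

variable (m : Profile d)

/-- The symbol of the multiplier `m(r D)`, in the frequency variable of Mathlib. -/
def sym (r : ℝ) (ξ : Rd d) : ℂ := ((m.toFun (r • ((2 * Real.pi) • ξ)) : ℝ) : ℂ)

lemma contDiff_sym (r : ℝ) : ContDiff ℝ ∞ (m.sym r) := by
  have := m.smooth
  exact Complex.ofRealCLM.contDiff.comp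
    (by fun_prop : ContDiff ℝ ∞ fun ξ : Rd d => m.toFun (r • ((2 * Real.pi) • ξ)))

lemma isSym_sym (r : ℝ) : IsSym (m.sym r) := (m.contDiff_sym r).contDiffOn

lemma hasCompactSupport_sym {r : ℝ} (hr : r ≠ 0) : HasCompactSupport (m.sym r) := by
  have h1 : HasCompactSupport fun ξ : Rd d => m.toFun ((r * (2 * Real.pi)) • ξ) :=
    m.compact.comp_smul (mul_ne_zero hr (by positivity))
  have h2 := h1.comp_left (g := fun t : ℝ => (t : ℂ)) (by simp)
  convert h2 using 1
  ext ξ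
  simp [sym, smul_smul]

lemma hasTemperateGrowth_sym {r : ℝ} (hr : r ≠ 0) : (m.sym r).HasTemperateGrowth :=
  (m.hasCompactSupport_sym hr).hasTemperateGrowth (m.contDiff_sym r)

/-- The convolution kernel of `m(D)`. -/
def kernel : 𝓢(Rd d, ℂ) :=
  𝓕⁻ ((m.hasCompactSupport_sym one_ne_zero).toSchwartzMap (m.contDiff_sym 1))

/-- The operator `m(r D)` on functions. -/
def cut (r : ℝ) (u : Rd d → ℂ) : Rd d → ℂ := avg volume (fun y => r • y) m.kernel u

lemma measurable_shift (r : ℝ) : Measurable fun y : Rd d => r • y := by fun_prop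

lemma integrable_kernel : Integrable m.kernel := m.kernel.integrable

lemma fourier_kernel (ξ : Rd d) : 𝓕 m.kernel ξ = m.sym 1 ξ := by
  rw [kernel, FourierTransform.fourier_fourierInv_eq]
  rfl

lemma avgSymbol_cut (r : ℝ) : avgSymbol volume (fun y => r • y) m.kernel = m.sym r := by
  ext ξ
  have h : m.sym r ξ = 𝓕 (m.kernel : Rd d → ℂ) (r • ξ) := by
    rw [← SchwartzMap.fourier_coe, fourier_kernel, sym, sym, one_smul, smul_comm]
  rw [h, Real.fourier_eq', avgSymbol]
  refine integral_congr_ae (Eventually.of_forall fun y => ?_)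
  simp only [smul_eq_mul]
  rw [mul_comm, inner_smul_left, inner_smul_right]
  simp only [conj_trivial, neg_mul]

/-- The `L^p` bound of the operators `m(r D)`. -/
def bd : ℝ≥0∞ := ∫⁻ y, ‖m.kernel y‖ₑ

lemma bd_ne_top : m.bd ≠ ⊤ := m.integrable_kernel.2.ne

section

variable {p : ℝ≥0∞} {r : ℝ} {u v : Rd d → ℂ}

lemma memLp_cut (hp : 1 ≤ p) (hu : MemLp u p volume) : MemLp (m.cut r u) p volume :=
  memLp_avg (measurable_shift r) m.integrable_kernel hu hp

lemma eLpNorm_cut_le (hp : 1 ≤ p) (hu : AEStronglyMeasurable u volume) :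
    eLpNorm (m.cut r u) p volume ≤ m.bd * eLpNorm u p volume :=
  eLpNorm_avg_le (measurable_shift r) m.integrable_kernel hu hp

lemma rel_cut (hp : 1 ≤ p) (hu : MemLp u p volume) : Rel (m.sym r) u (m.cut r u) := by
  rw [← avgSymbol_cut]
  exact Rel.of_avg (measurable_shift r) m.integrable_kernel hp hu

lemma ampMul_sym (hp : 1 ≤ p) : AmpMul p (m.sym r) m.bd := by
  rw [← avgSymbol_cut]
  exact (MulL.avgSymbol (measurable_shift r) m.integrable_kernel hp).ampMul

lemma rel_cut_cut (hp : 1 ≤ p) {σ : Rd d → ℂ} (hs : IsSym σ) (hu : MemLp u p volume)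
    (hv : MemLp v p volume) (h : Rel σ u v) : Rel σ (m.cut r u) (m.cut r v) :=
  Rel.avg_comm (measurable_shift r) m.integrable_kernel hp hu hv
    (by rw [avgSymbol_cut]; exact m.isSym_sym r) hs h

/-- The constant in Bernstein's inequality from `L^p` to `L^∞`. -/
def bern (p : ℝ≥0∞) : ℝ≥0∞ := eLpNorm m.kernel (ENNReal.conjExponent p) volume

lemma bern_ne_top : m.bern p ≠ ⊤ := (m.kernel.memLp _ volume).eLpNorm_ne_top

lemma enorm_cut_le (hp : 1 ≤ p) (hpt : p ≠ ⊤) (hr : 0 < r) (hu : MemLp u p volume) (x : Rd d) :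
    ‖m.cut r u x‖ₑ ≤
      ENNReal.ofReal (r ^ (-(d / p.toReal))) * m.bern p * eLpNorm u p volume := by
  have := ENNReal.HolderConjugate.conjExponent hp
  exact enorm_avg_smul_le hpt (m.kernel.memLp _ volume) hu hr x

lemma eLpNorm_cut_top_le (hp : 1 ≤ p) (hpt : p ≠ ⊤) (hr : 0 < r) (hu : MemLp u p volume) :
    eLpNorm (m.cut r u) ⊤ volume ≤
      ENNReal.ofReal (r ^ (-(d / p.toReal))) * m.bern p * eLpNorm u p volume := by
  rw [eLpNorm_exponent_top]
  exact essSup_le_of_ae_le _ (Eventually.of_forall fun x => m.enorm_cut_le hp hpt hr hu x)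

lemma memLp_cut_top (hp : 1 ≤ p) (hpt : p ≠ ⊤) (hr : 0 < r) (hu : MemLp u p volume) :
    MemLp (m.cut r u) ⊤ volume :=
  ⟨(m.memLp_cut hp hu).1, (m.eLpNorm_cut_top_le hp hpt hr hu).trans_lt
    (ENNReal.mul_lt_top (ENNReal.mul_lt_top ENNReal.ofReal_lt_top m.bern_ne_top.lt_top) hu.2)⟩

end

/-- The transpose of `m(r D)` on Schwartz functions. -/
def test (r : ℝ) : 𝓢(Rd d, ℂ) →L[ℂ] 𝓢(Rd d, ℂ) :=
  FourierTransform.fourierCLM ℂ 𝓢(Rd d, ℂ) ∘L SchwartzMap.smulLeftCLM ℂ (m.sym r) ∘L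
    FourierTransform.fourierInvCLM ℂ 𝓢(Rd d, ℂ)

lemma multiplier_apply (r : ℝ) (T : Tempered d) (φ : 𝓢(Rd d, ℂ)) :
    multiplier (fun ξ => m.toFun (r • ξ)) T φ = T (m.test r φ) := rfl

lemma coe_test {r : ℝ} (hr : r ≠ 0) (φ : 𝓢(Rd d, ℂ)) :
    (m.test r φ : Rd d → ℂ) = avg volume (fun y => -(r • y)) m.kernel φ := by
  have h1 : (m.test r φ : Rd d → ℂ) = 𝓕 (fun ξ => m.sym r ξ * 𝓕⁻ (φ : Rd d → ℂ) ξ) := by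
    change ⇑(𝓕 (SchwartzMap.smulLeftCLM ℂ (m.sym r) (𝓕⁻ φ)) : 𝓢(Rd d, ℂ)) = _
    rw [SchwartzMap.fourier_coe, SchwartzMap.smulLeftCLM_apply (m.hasTemperateGrowth_sym hr),
      SchwartzMap.fourierInv_coe]
    rfl
  have h2 : (φ : Rd d → ℂ) = 𝓕⁻ ⇑(𝓕 φ : 𝓢(Rd d, ℂ)) := by
    rw [← SchwartzMap.fourierInv_coe, FourierTransform.fourierInv_fourier_eq]
  conv_rhs => rw [h2]
  have hm : Measurable fun y : Rd d => -(r • y) := by fun_prop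
  rw [avg_fourierInv hm m.integrable_kernel (SchwartzMap.integrable _), h1]
  refine Eq.trans ?_ (Real.fourierInv_eq_fourier_comp_neg _).symm
  congr 1
  ext ξ
  rw [avgSymbol_neg, avgSymbol_cut, neg_neg, SchwartzMap.fourier_coe,
    Real.fourierInv_eq_fourier_neg]

lemma integral_cut_mul {p : ℝ≥0∞} (hp : 1 ≤ p) {r : ℝ} (hr : r ≠ 0) {u : Rd d → ℂ}
    (hu : MemLp u p volume) (φ : 𝓢(Rd d, ℂ)) :
    ∫ x, m.cut r u x * φ x = ∫ x, u x * m.test r φ x := by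
  have : p.HolderConjugate p.conjExponent := ENNReal.HolderConjugate.conjExponent hp
  rw [cut, integral_avg_mul (measurable_shift r) m.integrable_kernel hu
      (φ.memLp p.conjExponent volume),
    coe_test m hr]

lemma represents_cut {p : ℝ≥0∞} (hp : 1 ≤ p) {r : ℝ} (hr : r ≠ 0) {u : Rd d → ℂ}
    (hu : MemLp u p volume) {T : Tempered d} (h : Represents u T) :
    Represents (m.cut r u) (multiplier (fun ξ => m.toFun (r • ξ)) T) := fun φ => by
  rw [multiplier_apply, h]
  have := m.integral_cut_mul hp hr hu φ
  simp only [mul_comm] at this ⊢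
  exact this.symm

end Profile

lemma Represents.ae_eq {p q : ℝ≥0∞} (hp : 1 ≤ p) (hq : 1 ≤ q) {u v : Rd d → ℂ} {T : Tempered d}
    (hu : MemLp u p volume) (hv : MemLp v q volume) (h : Represents u T) (h' : Represents v T) :
    u =ᵐ[volume] v := by
  have h0 : u - v =ᵐ[volume] 0 := by
    refine ae_eq_zero_of_forall_schwartz
      ((hu.locallyIntegrable hp).sub (hv.locallyIntegrable hq)) fun φ => ?_
    have := ENNReal.HolderConjugate.conjExponent hp
    have := ENNReal.HolderConjugate.conjExponent hq
    have i1 := integrable_mul_of_holder (q := p.conjExponent) hu (φ.memLp _ volume)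
    have i2 := integrable_mul_of_holder (q := q.conjExponent) hv (φ.memLp _ volume)
    simp only [Pi.sub_apply, sub_mul]
    rw [integral_sub i1 i2]
    have e1 := h φ
    have e2 := h' φ
    simp only [mul_comm (φ _)] at e1 e2
    rw [← e1, ← e2, sub_self]
  filter_upwards [h0] with x hx
  exact sub_eq_zero.1 hx

lemma lebesgueNorm_le {q : ℝ≥0∞} {u : Rd d → ℂ} {T : Tempered d} (hu : MemLp u q volume)
    (h : Represents u T) : lebesgueNorm q T ≤ eLpNorm u q volume :=
  iInf₂_le u ⟨hu, h⟩

lemma lebesgueNorm_eq {q : ℝ≥0∞} (hq : 1 ≤ q) {u : Rd d → ℂ} {T : Tempered d}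
    (hu : MemLp u q volume) (h : Represents u T) : lebesgueNorm q T = eLpNorm u q volume :=
  le_antisymm (lebesgueNorm_le hu h) (le_iInf₂ fun _ hv =>
    (eLpNorm_congr_ae (Represents.ae_eq hq hq hu hv.1 h hv.2)).le)

lemma exists_represents_of_lebesgueNorm_lt_top {q : ℝ≥0∞} {T : Tempered d}
    (h : lebesgueNorm q T < ⊤) : ∃ u, MemLp u q volume ∧ Represents u T := by
  by_contra hcon
  push Not at hcon
  refine h.ne (iInf₂_eq_top.2 fun u hu => absurd hu.2 (hcon u hu.1))

lemma Rel.congr_sym {m n : Rd d → ℂ} (h : ∀ ξ ∈ offHyper d, m ξ = n ξ) {u w : Rd d → ℂ}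
    (hr : Rel m u w) : Rel n u w := fun g hg => by
  rw [hr g hg]
  have : (fun ξ => m (-ξ) * g ξ) = fun ξ => n (-ξ) * g ξ := by
    ext ξ
    by_cases hξ : ξ ∈ offHyper d
    · rw [h _ (neg_mem_offHyper hξ)]
    · rw [hg.eq_zero_of_notMem hξ, mul_zero, mul_zero]
  rw [this]

/-! ### Powers of two and Bernstein's inequality from `L^p` to `L^q`. -/

/-- `2 ^ x` as an extended nonnegative number. -/
def two (x : ℝ) : ℝ≥0∞ := ENNReal.ofReal ((2 : ℝ) ^ x)

lemma two_add (x y : ℝ) : two (x + y) = two x * two y := by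
  rw [two, Real.rpow_add two_pos, ENNReal.ofReal_mul (by positivity), two, two]

lemma two_ne_top (x : ℝ) : two x ≠ ⊤ := ENNReal.ofReal_ne_top

lemma two_pos' (x : ℝ) : 0 < two x := ENNReal.ofReal_pos.2 (by positivity)

lemma two_ne_zero' (x : ℝ) : two x ≠ 0 := (two_pos' x).ne'

lemma two_mono {x y : ℝ} (h : x ≤ y) : two x ≤ two y :=
  ENNReal.ofReal_le_ofReal (Real.rpow_le_rpow_of_exponent_le one_le_two h)

lemma two_rpow (x θ : ℝ) : two x ^ θ = two (x * θ) := by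
  rw [two, ENNReal.ofReal_rpow_of_pos (by positivity), ← Real.rpow_mul two_pos.le, two]

lemma two_lt_one {x : ℝ} (h : x < 0) : two x < 1 := by
  rw [two, ENNReal.ofReal_lt_one]
  exact Real.rpow_lt_one_of_one_lt_of_neg one_lt_two h

lemma ofReal_zpow_rpow (j : ℤ) (c : ℝ) :
    ENNReal.ofReal (((2 : ℝ) ^ (-j)) ^ (-c)) = two (j * c) := by
  rw [two, ← Real.rpow_intCast, ← Real.rpow_mul two_pos.le]
  push_cast
  ring_nf

lemma exists_tsum_two_le {ε : ℝ} (hε : 0 < ε) : ∃ G : ℝ≥0∞, G ≠ ⊤ ∧ ∀ M : ℤ,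
    ∑' m : ℤ, (if m ≤ M then two (m * ε) else 0) ≤ G * two (M * ε) := by
  refine ⟨(1 - two (-ε))⁻¹, ?_, fun M => ?_⟩
  · rw [Ne, ENNReal.inv_eq_top, tsub_eq_zero_iff_le, not_le]
    exact two_lt_one (by linarith)
  · have hinj : Function.Injective fun n : ℕ => M - (n : ℤ) := fun a b h => by
      simpa using h
    have h : ∑' n : ℕ, (fun m : ℤ => if m ≤ M then two (m * ε) else 0) (M - n) =
        ∑' m : ℤ, (if m ≤ M then two (m * ε) else 0) := by
      refine Function.Injective.tsum_eq (f := fun m : ℤ => if m ≤ M then two (m * ε) else 0) hinj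
        fun m hm => ?_
      have hm' : m ≤ M := by
        by_contra hcon
        simp [hcon] at hm
      exact ⟨(M - m).toNat, by simp only; omega⟩
    rw [← h, ← ENNReal.tsum_geometric, ← ENNReal.tsum_mul_right]
    refine ENNReal.tsum_le_tsum fun n => ?_
    have : M - (n : ℤ) ≤ M := by omega
    simp only [this, if_true]
    rw [← ENNReal.rpow_natCast, two_rpow, ← two_add]
    push_cast
    exact two_mono (by linarith)

namespace Profile

variable (m : Profile d) {p q : ℝ≥0∞} {u : Rd d → ℂ}

/-- Bernstein's inequality from `L^p` to `L^q`. -/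
lemma exists_eLpNorm_cut_le (hp : 1 ≤ p) (hpq : p ≤ q) (hq : q ≠ ⊤) :
    ∃ C : ℝ≥0∞, C ≠ ⊤ ∧ ∀ (j : ℤ) (u : Rd d → ℂ), MemLp u p volume →
      eLpNorm (m.cut ((2 : ℝ) ^ (-j)) u) q volume ≤
        C * two (j * (d * (1 / p.toReal - 1 / q.toReal))) * eLpNorm u p volume := by
  have hpt : p ≠ ⊤ := ne_top_of_le_ne_top hq hpq
  have hp0 : 0 < p.toReal := ENNReal.toReal_pos (zero_lt_one.trans_le hp).ne' hpt
  have hpq' : p.toReal ≤ q.toReal := ENNReal.toReal_mono hq hpq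
  have hq0 : 0 < q.toReal := hp0.trans_le hpq'
  -- The weight with which `L^q` is interpolated between `L^p`, where the cut-off is bounded at
  -- every scale, and `L^∞`, where it costs `2^(jd/p)`.
  set θ := p.toReal / q.toReal with hθ
  have hθ0 : 0 ≤ θ := by positivity
  have hθ1 : 0 ≤ 1 - θ := by
    rw [sub_nonneg, hθ]; exact div_le_one_of_le₀ hpq' hq0.le
  refine ⟨m.bd ^ θ * m.bern p ^ (1 - θ), ENNReal.mul_ne_top
    (ENNReal.rpow_ne_top_of_nonneg hθ0 m.bd_ne_top)
    (ENNReal.rpow_ne_top_of_nonneg hθ1 m.bern_ne_top), fun j u hu => ?_⟩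
  refine (eLpNorm_le_rpow_mul_rpow_top (m.memLp_cut hp hu).1 (zero_lt_one.trans_le hp).ne' hpq
    hq).trans ?_
  calc _ ≤ (m.bd * eLpNorm u p volume) ^ θ *
        (two (j * (d / p.toReal)) * m.bern p * eLpNorm u p volume) ^ (1 - θ) := by
        gcongr
        · exact m.eLpNorm_cut_le hp hu.1
        · refine (m.eLpNorm_cut_top_le hp hpt (by positivity) hu).trans_eq ?_
          rw [ofReal_zpow_rpow]
    _ = m.bd ^ θ * m.bern p ^ (1 - θ) * two (j * (d / p.toReal)) ^ (1 - θ) *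
        (eLpNorm u p volume ^ θ * eLpNorm u p volume ^ (1 - θ)) := by
        rw [ENNReal.mul_rpow_of_nonneg _ _ hθ0, ENNReal.mul_rpow_of_nonneg _ _ hθ1,
          ENNReal.mul_rpow_of_nonneg _ _ hθ1]
        ring
    _ = _ := by
        rw [← ENNReal.rpow_add_of_nonneg _ _ hθ0 hθ1, add_sub_cancel, ENNReal.rpow_one, two_rpow]
        congr 3
        rw [hθ]
        field_simp

end Profile

/-! ### Littlewood–Paley profiles and localized functions. -/

namespace Cutoff

variable (X : Cutoff d)

lemma chi_eq_zero {ξ : Rd d} (h : 4 / 3 < ‖ξ‖) : X.χ ξ = 0 := by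
  by_contra h0
  have := X.support_subset h0
  rw [mem_closedBall_zero_iff] at this
  linarith

lemma chi_eq_one {ξ : Rd d} (h : ‖ξ‖ < 3 / 4) : X.χ ξ = 1 :=
  X.eq_one ξ (by rwa [mem_ball_zero_iff])

lemma hasCompactSupport_chi : HasCompactSupport X.χ :=
  HasCompactSupport.of_support_subset_isCompact (isCompact_closedBall 0 (4 / 3)) X.support_subset

/-- The profile of the operators `S_j`. -/
def low : Profile d := ⟨X.χ, X.smooth, X.hasCompactSupport_chi⟩

/-- The profile of the operators `Δ_j`. -/
def ann : Profile d where
  toFun := X.phi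
  smooth := by
    have := X.smooth
    unfold phi
    fun_prop
  compact := (X.hasCompactSupport_chi.comp_smul (by norm_num)).sub X.hasCompactSupport_chi

/-- A profile which is equal to one on the support of the profile of `Δ_0`. -/
def fat : Profile d where
  toFun ξ := X.χ ((1 / 4 : ℝ) • ξ) - X.χ ((2 : ℝ) • ξ)
  smooth := by
    have := X.smooth
    fun_prop
  compact := (X.hasCompactSupport_chi.comp_smul (by norm_num)).sub
    (X.hasCompactSupport_chi.comp_smul (by norm_num))

lemma norm_of_phi_ne_zero {ξ : Rd d} (h : X.phi ξ ≠ 0) : 3 / 4 ≤ ‖ξ‖ ∧ ‖ξ‖ ≤ 8 / 3 := by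
  constructor <;> by_contra! hcon <;> refine h ?_
  · rw [phi, X.chi_eq_one hcon, X.chi_eq_one, sub_self]
    rw [norm_smul, Real.norm_of_nonneg (by norm_num)]
    linarith [norm_nonneg ξ]
  · have h1 : 4 / 3 < ‖(2 : ℝ)⁻¹ • ξ‖ := by
      rw [norm_smul, Real.norm_of_nonneg (by norm_num)]
      linarith
    rw [phi, X.chi_eq_zero h1, X.chi_eq_zero (by linarith), sub_self]

lemma norm_of_fat_ne_zero {ξ : Rd d} (h : X.fat.toFun ξ ≠ 0) : 3 / 8 ≤ ‖ξ‖ ∧ ‖ξ‖ ≤ 16 / 3 := by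
  constructor <;> by_contra! hcon <;> refine h ?_
  · change X.χ _ - X.χ _ = 0
    rw [X.chi_eq_one, X.chi_eq_one, sub_self] <;> rw [norm_smul, Real.norm_of_nonneg (by norm_num)]
      <;> linarith [norm_nonneg ξ]
  · change X.χ _ - X.χ _ = 0
    rw [X.chi_eq_zero, X.chi_eq_zero, sub_self] <;> rw [norm_smul, Real.norm_of_nonneg (by norm_num)]
      <;> linarith [norm_nonneg ξ]

lemma fat_eq_one {ξ : Rd d} (h1 : 3 / 4 ≤ ‖ξ‖) (h2 : ‖ξ‖ ≤ 8 / 3) : X.fat.toFun ξ = 1 := by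
  change X.χ _ - X.χ _ = 1
  rw [X.chi_eq_one, X.chi_eq_zero, sub_zero] <;> rw [norm_smul, Real.norm_of_nonneg (by norm_num)]
    <;> linarith [norm_nonneg ξ]

lemma norm_smul_two_zpow (j : ℤ) (ζ : Rd d) : ‖((2 : ℝ) ^ (-j)) • ζ‖ = ‖ζ‖ / 2 ^ j := by
  rw [norm_smul, Real.norm_of_nonneg (by positivity), zpow_neg, div_eq_inv_mul]

lemma norm_of_ann_sym_ne_zero {j : ℤ} {ξ : Rd d} (h : X.ann.sym (2 ^ (-j)) ξ ≠ 0) :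
    3 / 4 * (2 : ℝ) ^ j ≤ ‖(2 * Real.pi) • ξ‖ ∧ ‖(2 * Real.pi) • ξ‖ ≤ 8 / 3 * 2 ^ j := by
  have h1 : X.phi (((2 : ℝ) ^ (-j)) • ((2 * Real.pi) • ξ)) ≠ 0 := fun h0 => h (by
    change ((X.phi _ : ℝ) : ℂ) = 0
    rw [h0]; simp)
  have h2 := X.norm_of_phi_ne_zero h1
  rw [norm_smul_two_zpow] at h2
  have h3 : (0 : ℝ) < 2 ^ j := by positivity
  exact ⟨(le_div_iff₀ h3).1 h2.1, (div_le_iff₀ h3).1 h2.2⟩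

lemma norm_of_fat_sym_ne_zero {j : ℤ} {ξ : Rd d} (h : X.fat.sym (2 ^ (-j)) ξ ≠ 0) :
    3 / 8 * (2 : ℝ) ^ j ≤ ‖(2 * Real.pi) • ξ‖ ∧ ‖(2 * Real.pi) • ξ‖ ≤ 16 / 3 * 2 ^ j := by
  have h1 : X.fat.toFun (((2 : ℝ) ^ (-j)) • ((2 * Real.pi) • ξ)) ≠ 0 := fun h0 => h (by
    rw [Profile.sym, h0]; simp)
  have h2 := X.norm_of_fat_ne_zero h1
  rw [norm_smul_two_zpow] at h2
  have h3 : (0 : ℝ) < 2 ^ j := by positivity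
  exact ⟨(le_div_iff₀ h3).1 h2.1, (div_le_iff₀ h3).1 h2.2⟩

lemma norm_of_low_sym_ne_zero {j : ℤ} {ξ : Rd d} (h : X.low.sym (2 ^ (-j)) ξ ≠ 0) :
    ‖(2 * Real.pi) • ξ‖ ≤ 4 / 3 * 2 ^ j := by
  have h1 : X.χ (((2 : ℝ) ^ (-j)) • ((2 * Real.pi) • ξ)) ≠ 0 := fun h0 => h (by
    change ((X.χ _ : ℝ) : ℂ) = 0
    rw [h0]; simp)
  have h2 := X.support_subset h1
  rw [mem_closedBall_zero_iff, norm_smul_two_zpow] at h2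
  have h3 : (0 : ℝ) < 2 ^ j := by positivity
  exact (div_le_iff₀ h3).1 h2

lemma ann_sym_mul_fat_sym (j : ℤ) (ξ : Rd d) :
    X.ann.sym (2 ^ (-j)) ξ * X.fat.sym (2 ^ (-j)) ξ = X.ann.sym (2 ^ (-j)) ξ := by
  by_cases h : X.phi (((2 : ℝ) ^ (-j)) • ((2 * Real.pi) • ξ)) = 0
  · have : X.ann.sym (2 ^ (-j)) ξ = 0 := by
      change ((X.phi _ : ℝ) : ℂ) = 0
      rw [h]; simp
    rw [this, zero_mul]
  · have h2 := X.norm_of_phi_ne_zero h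
    have : X.fat.sym (2 ^ (-j)) ξ = 1 := by
      rw [Profile.sym, X.fat_eq_one h2.1 h2.2]; simp
    rw [this, mul_one]

lemma Delta_apply (j : ℤ) (T : Tempered d) (φ : 𝓢(Rd d, ℂ)) :
    X.Delta j T φ = T (X.ann.test (2 ^ (-j)) φ) := rfl

lemma S_apply (j : ℤ) (T : Tempered d) (φ : 𝓢(Rd d, ℂ)) :
    X.S j T φ = T (X.low.test (2 ^ (-j)) φ) := rfl

lemma test_fat_ann (j : ℤ) (φ : 𝓢(Rd d, ℂ)) :
    X.ann.test (2 ^ (-j)) (X.fat.test (2 ^ (-j)) φ) = X.ann.test (2 ^ (-j)) φ := by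
  have h2 : (2 : ℝ) ^ (-j) ≠ 0 := by positivity
  simp only [Profile.test, ContinuousLinearMap.comp_apply, FourierTransform.fourierCLM_apply,
    FourierTransform.fourierInvCLM_apply, FourierTransform.fourierInv_fourier_eq]
  rw [SchwartzMap.smulLeftCLM_smulLeftCLM_apply (X.ann.hasTemperateGrowth_sym h2)
    (X.fat.hasTemperateGrowth_sym h2)]
  congr 3
  ext ξ
  exact X.ann_sym_mul_fat_sym j ξ

/-- A function whose spectrum lies in an annulus of radius `2 ^ j`. -/
def IsLoc (j : ℤ) (u : Rd d → ℂ) : Prop := X.fat.cut (2 ^ (-j)) u =ᵐ[volume] u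

lemma isLoc_of_represents_Delta {p : ℝ≥0∞} (hp : 1 ≤ p) {j : ℤ} {u : Rd d → ℂ}
    (hu : MemLp u p volume) {T : Tempered d} (h : Represents u (X.Delta j T)) : X.IsLoc j u := by
  have h1 := X.fat.represents_cut hp (r := 2 ^ (-j)) (by positivity) hu h
  have h2 : multiplier (fun ξ => X.fat.toFun ((2 : ℝ) ^ (-j) • ξ)) (X.Delta j T) = X.Delta j T := by
    ext φ
    rw [Profile.multiplier_apply, Delta_apply, Delta_apply, test_fat_ann]
  rw [h2] at h1
  exact h1.ae_eq hp hp (X.fat.memLp_cut hp hu) hu h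

section

variable {X} {p : ℝ≥0∞} {j : ℤ} {u w : Rd d → ℂ}

lemma IsLoc.rel (hp : 1 ≤ p) (hu : MemLp u p volume) (h : X.IsLoc j u) :
    Rel (X.fat.sym (2 ^ (-j))) u u :=
  (X.fat.rel_cut hp hu).congr EventuallyEq.rfl h

/-- Multipliers commute with the fat cut-off. In particular, octant projections and `e^{-aΛ₁}`
preserve localization at frequency `2 ^ j`. -/
lemma IsLoc.of_rel (hp : 1 < p) (hpt : p ≠ ⊤) (hu : MemLp u p volume) (hw : MemLp w p volume)
    (h : X.IsLoc j u) {σ : Rd d → ℂ} (hs : IsSym σ) (hr : Rel σ u w) : X.IsLoc j w := by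
  have h1 := X.fat.rel_cut_cut (r := 2 ^ (-j)) hp.le hs hu hw hr
  exact Rel.unique hp hpt (X.fat.memLp_cut hp.le hw) hw h1 (hr.congr h.symm EventuallyEq.rfl)

lemma isLoc_ann_cut (hp : 1 < p) (hpt : p ≠ ⊤) (hu : MemLp u p volume) :
    X.IsLoc j (X.ann.cut (2 ^ (-j)) u) := by
  have h1 := X.ann.rel_cut (r := 2 ^ (-j)) hp.le hu
  have h2 := X.fat.rel_cut (r := 2 ^ (-j)) hp.le (X.ann.memLp_cut (r := 2 ^ (-j)) hp.le hu)
  refine Rel.unique hp hpt (X.fat.memLp_cut hp.le (X.ann.memLp_cut hp.le hu))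
    (X.ann.memLp_cut hp.le hu) ((h1.comp h2 (X.fat.isSym_sym _)).congr_sym fun ξ _ => ?_) h1
  exact X.ann_sym_mul_fat_sym j ξ

lemma IsLoc.eLpNorm_top_le (hp : 1 ≤ p) (hpt : p ≠ ⊤) (hu : MemLp u p volume) (h : X.IsLoc j u) :
    eLpNorm u ⊤ volume ≤ two (j * (d / p.toReal)) * X.fat.bern p * eLpNorm u p volume := by
  rw [← ofReal_zpow_rpow, ← eLpNorm_congr_ae h]
  exact X.fat.eLpNorm_cut_top_le hp hpt (by positivity) hu

lemma IsLoc.memLp_top (hp : 1 ≤ p) (hpt : p ≠ ⊤) (hu : MemLp u p volume) (h : X.IsLoc j u) :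
    MemLp u ⊤ volume :=
  (X.fat.memLp_cut_top hp hpt (by positivity) hu).ae_eq h

end

end Cutoff

/-! ### Products of two localized functions: far and comparable frequencies. -/

/-- The sum has norm at most `(32/3) 2^j`, below `(3/4) 2^(j+5) = 24 · 2^j`. -/
lemma zpow_separation_upper {x y : Rd d} {j k m : ℤ} (hkj : k ≤ j) (hm : j + 5 ≤ m)
    (hx : ‖x‖ ≤ 16 / 3 * (2 : ℝ) ^ j) (hy : ‖y‖ ≤ 16 / 3 * (2 : ℝ) ^ k)
    (h : 3 / 4 * (2 : ℝ) ^ m ≤ ‖x + y‖) : False := by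
  have h1 : (2 : ℝ) ^ k ≤ 2 ^ j := zpow_le_zpow_right₀ one_le_two hkj
  have h2 : (2 : ℝ) ^ (j + 5) ≤ 2 ^ m := zpow_le_zpow_right₀ one_le_two hm
  rw [zpow_add₀ two_ne_zero] at h2
  have h3 : (2 : ℝ) ^ (5 : ℤ) = 32 := by norm_num
  have h4 : (0 : ℝ) < 2 ^ j := by positivity
  rw [h3] at h2
  linarith [norm_add_le x y]

/-- The sum has norm at least `(3/8 - 1/6) 2^j = (5/24) 2^j`, above `(8/3) 2^(j-4) = (1/6) 2^j`. -/
lemma zpow_separation_lower {x y : Rd d} {j k m : ℤ} (hkj : k + 5 ≤ j) (hm : m + 4 ≤ j)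
    (hx : 3 / 8 * (2 : ℝ) ^ j ≤ ‖x‖) (hy : ‖y‖ ≤ 16 / 3 * (2 : ℝ) ^ k)
    (h : ‖x + y‖ ≤ 8 / 3 * (2 : ℝ) ^ m) : False := by
  have h1 : (2 : ℝ) ^ (k + 5) ≤ 2 ^ j := zpow_le_zpow_right₀ one_le_two hkj
  have h2 : (2 : ℝ) ^ (m + 4) ≤ 2 ^ j := zpow_le_zpow_right₀ one_le_two hm
  rw [zpow_add₀ two_ne_zero] at h1 h2
  have h3 : (2 : ℝ) ^ (5 : ℤ) = 32 := by norm_num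
  have h3' : (2 : ℝ) ^ (4 : ℤ) = 16 := by norm_num
  have h4 : (0 : ℝ) < 2 ^ j := by positivity
  rw [h3] at h1
  rw [h3'] at h2
  have h5 : ‖x‖ ≤ ‖x + y‖ + ‖y‖ := by
    calc ‖x‖ = ‖(x + y) - y‖ := by rw [add_sub_cancel_right]
      _ ≤ _ := norm_sub_le _ _
  linarith

lemma memLp_mul_top {p : ℝ≥0∞} {u v : Rd d → ℂ} (hu : MemLp u p volume)
    (hv : MemLp v ⊤ volume) : MemLp (fun x => u x * v x) p volume :=
  MemLp.mul' (p := p) (q := ⊤) (r := p) hv hu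

lemma eLpNorm_mul_le_top {p : ℝ≥0∞} {u v : Rd d → ℂ} (hu : AEStronglyMeasurable u volume) :
    eLpNorm (fun x => u x * v x) p volume ≤ eLpNorm u p volume * eLpNorm v ⊤ volume :=
  eLpNorm_le_eLpNorm_mul_eLpNorm_top p hu v (fun a b => a * b) 1
    (Eventually.of_forall fun x => by simp) |>.trans_eq (by simp)

lemma eLpNorm_mul_le_half {q : ℝ≥0∞} {u v : Rd d → ℂ} (hu : AEStronglyMeasurable u volume)
    (hv : AEStronglyMeasurable v volume) :
    eLpNorm (fun x => u x * v x) (q / 2) volume ≤ eLpNorm u q volume * eLpNorm v q volume := by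
  have : ENNReal.HolderTriple q q (q / 2) := ⟨by
    rw [ENNReal.inv_div (Or.inl (by simp)) (Or.inl (by simp)), ENNReal.div_eq_inv_mul, mul_comm,
      two_mul]⟩
  exact (eLpNorm_le_eLpNorm_mul_eLpNorm_of_nnnorm (p := q) (q := q) (r := q / 2) hu hv
    (fun a b => a * b) 1 (Eventually.of_forall fun x => by simp)).trans_eq (by simp)

namespace Cutoff

variable (X : Cutoff d)

/-- The exponent `max 2 p`. -/
abbrev expTwo (p : ℝ≥0∞) : ℝ≥0∞ := max 2 p

variable {X} {p : ℝ≥0∞}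

lemma expTwo_ne_top (hpt : p ≠ ⊤) : expTwo p ≠ ⊤ := by simp [expTwo, hpt]

/-- Bernstein's inequality raises the integrability to at least `2`. There the trilinear identity is
available, and the product of two such functions lies in a space `L^r` with `r ≥ 1`. -/
lemma exists_isLoc_expTwo (X : Cutoff d) (hp : 1 ≤ p) (hpt : p ≠ ⊤) : ∃ C : ℝ≥0∞, C ≠ ⊤ ∧
    ∀ (j : ℤ) (u : Rd d → ℂ), MemLp u p volume → X.IsLoc j u →
      MemLp u (expTwo p) volume ∧ eLpNorm u (expTwo p) volume ≤
        C * two (j * (d * (1 / p.toReal - 1 / (expTwo p).toReal))) * eLpNorm u p volume := by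
  obtain ⟨C, hC, h⟩ := X.fat.exists_eLpNorm_cut_le (d := d) hp (le_max_right 2 p) (expTwo_ne_top hpt)
  refine ⟨C, hC, fun j u hu hl => ?_⟩
  have h1 := h j u hu
  rw [eLpNorm_congr_ae hl] at h1
  exact ⟨⟨hu.1, h1.trans_lt (ENNReal.mul_lt_top (ENNReal.mul_lt_top hC.lt_top
    (two_ne_top _).lt_top) hu.2)⟩, h1⟩

/-- The trilinear identity with a single term: the spectrum of a product lies in the sum of the
spectra. -/
lemma ann_cut_mul_eq_zero (hp : 1 < p) (hpt : p ≠ ⊤) {j k m : ℤ} {u v : Rd d → ℂ}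
    (hu : MemLp u p volume) (hv : MemLp v p volume) (hlu : X.IsLoc j u) (hlv : X.IsLoc k v)
    (h : ∀ ξ η : Rd d, X.fat.sym (2 ^ (-j)) ξ * X.fat.sym (2 ^ (-k)) η *
      X.ann.sym (2 ^ (-m)) (ξ + η) = 0) :
    X.ann.cut (2 ^ (-m)) (fun x => u x * v x) =ᵐ[volume] 0 := by
  have hw := memLp_mul_top hu (hlv.memLp_top hp.le hpt hv)
  obtain ⟨C, -, hC⟩ := exists_isLoc_expTwo X hp.le hpt
  have hu2 := (hC j u hu hlu).1
  have hv2 := (hC k v hv hlv).1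
  have hq1 : 1 ≤ expTwo p := hp.le.trans (le_max_right _ _)
  refine ae_eq_of_forall_amp hp hpt (X.ann.memLp_cut hp.le hw) MemLp.zero fun g hg => ?_
  have h1 := sum_integral_eq_zero (le_max_left 2 p) (expTwo_ne_top hpt) (Finset.univ : Finset Unit)
    (z := fun _ => X.fat.sym (2 ^ (-j))) (z' := fun _ => X.fat.sym (2 ^ (-k)))
    (k := fun _ => X.ann.sym (2 ^ (-m)))
    (fun _ _ => X.fat.isSym_sym _) (fun _ _ => X.fat.isSym_sym _) (fun _ _ => X.ann.isSym_sym _)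
    (fun _ _ => ⟨_, X.fat.bd_ne_top, X.fat.ampMul_sym hq1⟩)
    (fun _ _ => ⟨_, X.fat.bd_ne_top, X.fat.ampMul_sym hq1⟩)
    (fun ξ _ η _ _ => by simpa using h ξ η) hu2 hv2 (U := fun _ => u) (V := fun _ => v)
    (fun _ _ => hu2) (fun _ _ => hv2) (fun _ _ => hlu.rel hq1 hu2) (fun _ _ => hlv.rel hq1 hv2) hg
  rw [X.ann.rel_cut hp.le hw g hg]
  simpa using h1

lemma ann_cut_mul_eq_zero_of_upper (hp : 1 < p) (hpt : p ≠ ⊤) {j k m : ℤ} {u v : Rd d → ℂ}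
    (hu : MemLp u p volume) (hv : MemLp v p volume) (hlu : X.IsLoc j u) (hlv : X.IsLoc k v)
    (hkj : k ≤ j) (hm : j + 5 ≤ m) :
    X.ann.cut (2 ^ (-m)) (fun x => u x * v x) =ᵐ[volume] 0 := by
  refine ann_cut_mul_eq_zero hp hpt hu hv hlu hlv fun ξ η => ?_
  by_contra h
  simp only [mul_eq_zero, not_or] at h
  obtain ⟨⟨h1, h2⟩, h3⟩ := h
  have h4 := (X.norm_of_ann_sym_ne_zero h3).1
  rw [smul_add] at h4
  exact zpow_separation_upper hkj hm (X.norm_of_fat_sym_ne_zero h1).2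
    (X.norm_of_fat_sym_ne_zero h2).2 h4

lemma ann_cut_mul_eq_zero_of_lower (hp : 1 < p) (hpt : p ≠ ⊤) {j k m : ℤ} {u v : Rd d → ℂ}
    (hu : MemLp u p volume) (hv : MemLp v p volume) (hlu : X.IsLoc j u) (hlv : X.IsLoc k v)
    (hkj : k + 5 ≤ j) (hm : m + 4 ≤ j) :
    X.ann.cut (2 ^ (-m)) (fun x => u x * v x) =ᵐ[volume] 0 := by
  refine ann_cut_mul_eq_zero hp hpt hu hv hlu hlv fun ξ η => ?_
  by_contra h
  simp only [mul_eq_zero, not_or] at h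
  obtain ⟨⟨h1, h2⟩, h3⟩ := h
  have h4 := (X.norm_of_ann_sym_ne_zero h3).2
  rw [smul_add] at h4
  exact zpow_separation_lower hkj hm (X.norm_of_fat_sym_ne_zero h1).1
    (X.norm_of_fat_sym_ne_zero h2).2 h4

/-- The loss of regularity in the remainder term of the product, when `p < 2`. -/
def loss (d : ℕ) (p : ℝ≥0∞) : ℝ := d * (1 / p.toReal - 1 / (expTwo p).toReal)

/-- The paraproduct. The spectrum of the product stays near `2^j`, so few blocks of it are nonzero;
the low-frequency factor is put in `L^∞` by Bernstein's inequality. Nothing is required of `s₁` or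
of `s₁ + s₂`. -/
lemma exists_far_product_le (X : Cutoff d) (hp : 1 < p) (hpt : p ≠ ⊤) {s₁ s₂ : ℝ}
    (h2 : s₂ ≤ d / p.toReal) : ∃ C : ℝ≥0∞, C ≠ ⊤ ∧ ∀ (j k : ℤ) (u v : Rd d → ℂ), k + 5 ≤ j →
      MemLp u p volume → MemLp v p volume → X.IsLoc j u → X.IsLoc k v →
      ∑' m : ℤ, two (m * (s₁ + s₂ - d / p.toReal)) *
        eLpNorm (X.ann.cut (2 ^ (-m)) (fun x => u x * v x)) p volume ≤
      C * (two (j * s₁) * eLpNorm u p volume) * (two (k * s₂) * eLpNorm v p volume) := by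
  set σ := s₁ + s₂ - d / p.toReal with hσ
  refine ⟨8 * two (4 * |σ|) * X.ann.bd * X.fat.bern p, ?_, fun j k u v hkj hu hv hlu hlv => ?_⟩
  · exact ENNReal.mul_ne_top (ENNReal.mul_ne_top (ENNReal.mul_ne_top (by simp) (two_ne_top _))
      X.ann.bd_ne_top) X.fat.bern_ne_top
  set A := eLpNorm u p volume
  set B := eLpNorm v p volume
  have hterm : ∀ m : ℤ, m ∈ Finset.Icc (j - 3) (j + 4) → two (m * σ) *
      eLpNorm (X.ann.cut (2 ^ (-m)) (fun x => u x * v x)) p volume ≤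
      two (j * σ) * two (4 * |σ|) *
        (X.ann.bd * (A * (two (k * (d / p.toReal)) * X.fat.bern p * B))) := fun m hm => by
    rw [Finset.mem_Icc] at hm
    gcongr
    · rw [← two_add]
      refine two_mono ?_
      have h1 : |(m : ℝ) - j| ≤ 4 := by
        rw [abs_le]
        have h3 : (j : ℝ) - 3 ≤ m := by exact_mod_cast hm.1
        have h4 : (m : ℝ) ≤ j + 4 := by exact_mod_cast hm.2
        constructor <;> linarith
      have h2 : ((m : ℝ) - j) * σ ≤ 4 * |σ| := by
        calc ((m : ℝ) - j) * σ ≤ |((m : ℝ) - j) * σ| := le_abs_self _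
          _ = |(m : ℝ) - j| * |σ| := abs_mul _ _
          _ ≤ 4 * |σ| := by gcongr
      linarith
    · refine (X.ann.eLpNorm_cut_le hp.le (hu.1.mul hv.1)).trans ?_
      gcongr
      refine (eLpNorm_mul_le_top hu.1).trans ?_
      gcongr
      exact hlv.eLpNorm_top_le hp.le hpt hv
  rw [tsum_eq_sum (s := Finset.Icc (j - 3) (j + 4))]
  · refine (Finset.sum_le_sum hterm).trans ?_
    rw [Finset.sum_const, Int.card_Icc, nsmul_eq_mul]
    have h8 : (j + 4 + 1 - (j - 3)).toNat = 8 := by omega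
    rw [h8]
    -- The exponents differ by `(j - k)(s₂ - d/p)`, which is nonpositive.
    have hw : two (j * σ) * two (k * (d / p.toReal)) ≤ two (j * s₁) * two (k * s₂) := by
      rw [← two_add, ← two_add]
      refine two_mono ?_
      have h3 : (k : ℝ) ≤ j := by
        have : k ≤ j := by omega
        exact_mod_cast this
      nlinarith [mul_nonneg (sub_nonneg.2 h3) (sub_nonneg.2 h2)]
    calc _ = (8 * two (4 * |σ|) * X.ann.bd * X.fat.bern p) * (A * B) *
          (two (j * σ) * two (k * (d / p.toReal))) := by push_cast; ring
      _ ≤ (8 * two (4 * |σ|) * X.ann.bd * X.fat.bern p) * (A * B) *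
          (two (j * s₁) * two (k * s₂)) := by gcongr
      _ = _ := by ring
  · intro m hm
    rw [Finset.mem_Icc, not_and_or, not_le, not_le] at hm
    have h0 : X.ann.cut (2 ^ (-m)) (fun x => u x * v x) =ᵐ[volume] 0 := by
      rcases hm with hm | hm
      · exact ann_cut_mul_eq_zero_of_lower hp hpt hu hv hlu hlv hkj (by omega)
      · exact ann_cut_mul_eq_zero_of_upper hp hpt hu hv hlu hlv (by omega) (by omega)
    rw [eLpNorm_congr_ae h0]
    simp

/-- The remainder. Comparable frequencies can interact into any frequency `2^m` with `m ≤ j + 4`.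
With the product placed in `L^{q/2}`, `q = max(2, p)`, Bernstein's inequality from `L^{q/2}` to
`L^p` makes the `m`-th term of size `2^(mε)` with `ε = s₁ + s₂ - 2 loss > 0`, so the sum is governed
by its top frequency. -/
lemma exists_near_product_le (X : Cutoff d) (hp : 1 < p) (hpt : p ≠ ⊤) {s₁ s₂ : ℝ}
    (hs : 2 * loss d p < s₁ + s₂) : ∃ C : ℝ≥0∞, C ≠ ⊤ ∧ ∀ (j k : ℤ) (u v : Rd d → ℂ), k ≤ j →
      j ≤ k + 4 → MemLp u p volume → MemLp v p volume → X.IsLoc j u → X.IsLoc k v →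
      ∑' m : ℤ, two (m * (s₁ + s₂ - d / p.toReal)) *
        eLpNorm (X.ann.cut (2 ^ (-m)) (fun x => u x * v x)) p volume ≤
      C * (two (j * s₁) * eLpNorm u p volume) * (two (k * s₂) * eLpNorm v p volume) := by
  have hp0 : 0 < p.toReal := ENNReal.toReal_pos (zero_lt_one.trans hp).ne' hpt
  have hqt := expTwo_ne_top hpt
  have hq0 : 0 < (expTwo p).toReal :=
    ENNReal.toReal_pos (ne_of_gt (lt_of_lt_of_le (by simp) (le_max_left 2 p))) hqt
  have hr1 : 1 ≤ expTwo p / 2 := by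
    rw [ENNReal.le_div_iff_mul_le (by simp) (by simp), one_mul]
    exact le_max_left _ _
  have hrp : expTwo p / 2 ≤ p := by
    rw [ENNReal.div_le_iff (by simp) (by simp)]
    refine max_le ?_ ?_
    · calc (2 : ℝ≥0∞) = 1 * 2 := (one_mul _).symm
        _ ≤ p * 2 := by gcongr
    · calc p = p * 1 := (mul_one _).symm
        _ ≤ p * 2 := by gcongr; simp
  have hrt : (expTwo p / 2).toReal = (expTwo p).toReal / 2 := by simp [ENNReal.toReal_div]
  obtain ⟨Cq, hCq, hq⟩ := exists_isLoc_expTwo X hp.le hpt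
  obtain ⟨Cb, hCb, hb⟩ := X.ann.exists_eLpNorm_cut_le (d := d) hr1 hrp hpt
  set σ := s₁ + s₂ - d / p.toReal with hσ
  set δ := loss d p with hδ
  set ε := s₁ + s₂ - 2 * δ with hε
  obtain ⟨G, hG, hsum⟩ := exists_tsum_two_le (ε := ε) (by linarith)
  -- The regularity of the product plus the cost of returning to `L^p`: `s₁ + s₂ - d/p + d(2/q -
  -- 1/p)`, which is `s₁ + s₂` minus twice the cost of going from `L^p` to `L^q`.
  have hexp : σ + d * (1 / (expTwo p / 2).toReal - 1 / p.toReal) = ε := by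
    rw [hrt, hσ, hε, hδ, loss]
    field_simp
    ring
  refine ⟨Cb * (Cq * Cq) * (G * (two (4 * ε) * two (4 * |s₂ - δ|))), ?_,
    fun j k u v hkj hjk hu hv hlu hlv => ?_⟩
  · refine ENNReal.mul_ne_top (ENNReal.mul_ne_top hCb (ENNReal.mul_ne_top hCq hCq))
      (ENNReal.mul_ne_top hG (ENNReal.mul_ne_top (two_ne_top _) (two_ne_top _)))
  set A := eLpNorm u p volume
  set B := eLpNorm v p volume
  have huq := hq j u hu hlu
  have hvq := hq k v hv hlv
  have hur : eLpNorm (fun x => u x * v x) (expTwo p / 2) volume ≤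
      (Cq * two (j * δ) * A) * (Cq * two (k * δ) * B) :=
    (eLpNorm_mul_le_half hu.1 hv.1).trans (mul_le_mul' huq.2 hvq.2)
  have hwr : MemLp (fun x => u x * v x) (expTwo p / 2) volume :=
    ⟨hu.1.mul hv.1, (eLpNorm_mul_le_half hu.1 hv.1).trans_lt
      (ENNReal.mul_lt_top huq.1.2 hvq.1.2)⟩
  have hterm : ∀ m : ℤ, two (m * σ) *
      eLpNorm (X.ann.cut (2 ^ (-m)) (fun x => u x * v x)) p volume ≤
      Cb * ((Cq * two (j * δ) * A) * (Cq * two (k * δ) * B)) *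
        (if m ≤ j + 4 then two (m * ε) else 0) := fun m => by
    split_ifs with hm
    · calc _ ≤ two (m * σ) * (Cb * two (m * (d * (1 / (expTwo p / 2).toReal - 1 / p.toReal))) *
            ((Cq * two (j * δ) * A) * (Cq * two (k * δ) * B))) := by
            gcongr
            refine (hb m _ hwr).trans ?_
            gcongr
        _ = Cb * ((Cq * two (j * δ) * A) * (Cq * two (k * δ) * B)) *
            (two (m * σ) * two (m * (d * (1 / (expTwo p / 2).toReal - 1 / p.toReal)))) := by ring
        _ = _ := by rw [← two_add, ← mul_add, hexp]
    · rw [eLpNorm_congr_ae (ann_cut_mul_eq_zero_of_upper hp hpt hu hv hlu hlv hkj (by omega))]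
      simp
  refine (ENNReal.tsum_le_tsum hterm).trans ?_
  rw [ENNReal.tsum_mul_left]
  have hw : two (((j + 4 : ℤ) : ℝ) * ε) * (two (j * δ) * two (k * δ)) ≤
      two (4 * ε) * two (4 * |s₂ - δ|) * (two (j * s₁) * two (k * s₂)) := by
    simp only [← two_add]
    refine two_mono ?_
    have h3 : (k : ℝ) ≤ j := by exact_mod_cast hkj
    have h4 : (j : ℝ) ≤ k + 4 := by exact_mod_cast hjk
    have h5 : ((j : ℝ) - k) * (s₂ - δ) ≤ 4 * |s₂ - δ| := by
      calc ((j : ℝ) - k) * (s₂ - δ) ≤ ((j : ℝ) - k) * |s₂ - δ| := by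
            exact mul_le_mul_of_nonneg_left (le_abs_self _) (by linarith)
        _ ≤ _ := by gcongr; linarith
    push_cast
    rw [hε] at *
    linarith
  calc _ ≤ Cb * ((Cq * two (j * δ) * A) * (Cq * two (k * δ) * B)) *
        (G * two (((j + 4 : ℤ) : ℝ) * ε)) := by gcongr; exact hsum _
    _ = Cb * (Cq * Cq) * G * (A * B) *
        (two (((j + 4 : ℤ) : ℝ) * ε) * (two (j * δ) * two (k * δ))) := by ring
    _ ≤ Cb * (Cq * Cq) * G * (A * B) *
        (two (4 * ε) * two (4 * |s₂ - δ|) * (two (j * s₁) * two (k * s₂))) := by gcongr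
    _ = _ := by ring

lemma exists_product_le_of_le (X : Cutoff d) (hp : 1 < p) (hpt : p ≠ ⊤) {s₁ s₂ : ℝ}
    (h2 : s₂ ≤ d / p.toReal) (hs : 2 * loss d p < s₁ + s₂) :
    ∃ C : ℝ≥0∞, C ≠ ⊤ ∧ ∀ (j k : ℤ) (u v : Rd d → ℂ), k ≤ j →
      MemLp u p volume → MemLp v p volume → X.IsLoc j u → X.IsLoc k v →
      ∑' m : ℤ, two (m * (s₁ + s₂ - d / p.toReal)) *
        eLpNorm (X.ann.cut (2 ^ (-m)) (fun x => u x * v x)) p volume ≤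
      C * (two (j * s₁) * eLpNorm u p volume) * (two (k * s₂) * eLpNorm v p volume) := by
  obtain ⟨C, hC, h⟩ := exists_far_product_le X hp hpt (s₁ := s₁) h2
  obtain ⟨C', hC', h'⟩ := exists_near_product_le X hp hpt hs
  refine ⟨C + C', ENNReal.add_ne_top.2 ⟨hC, hC'⟩, fun j k u v hkj hu hv hlu hlv => ?_⟩
  rcases le_or_gt (k + 5) j with hc | hc
  · refine (h j k u v hc hu hv hlu hlv).trans ?_
    gcongr
    exact le_self_add
  · refine (h' j k u v hkj (by omega) hu hv hlu hlv).trans ?_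
    gcongr
    exact le_add_self

lemma exists_product_le (X : Cutoff d) (hp : 1 < p) (hpt : p ≠ ⊤) {s₁ s₂ : ℝ}
    (h1 : s₁ ≤ d / p.toReal) (h2 : s₂ ≤ d / p.toReal) (hs : 2 * loss d p < s₁ + s₂) :
    ∃ C : ℝ≥0∞, C ≠ ⊤ ∧ ∀ (j k : ℤ) (u v : Rd d → ℂ),
      MemLp u p volume → MemLp v p volume → X.IsLoc j u → X.IsLoc k v →
      ∑' m : ℤ, two (m * (s₁ + s₂ - d / p.toReal)) *
        eLpNorm (X.ann.cut (2 ^ (-m)) (fun x => u x * v x)) p volume ≤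
      C * (two (j * s₁) * eLpNorm u p volume) * (two (k * s₂) * eLpNorm v p volume) := by
  obtain ⟨C, hC, h⟩ := exists_product_le_of_le X hp hpt h2 hs
  obtain ⟨C', hC', h'⟩ := exists_product_le_of_le X hp hpt h1 (by rwa [add_comm] at hs)
  refine ⟨C + C', ENNReal.add_ne_top.2 ⟨hC, hC'⟩, fun j k u v hu hv hlu hlv => ?_⟩
  rcases le_total k j with hc | hc
  · refine (h j k u v hc hu hv hlu hlv).trans ?_
    gcongr
    exact le_self_add
  · have h3 := h' k j v u hc hv hu hlv hlu
    rw [add_comm s₂ s₁] at h3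
    simp only [mul_comm (v _) (u _)] at h3
    refine h3.trans ?_
    rw [mul_assoc, mul_comm (two _ * _), ← mul_assoc]
    gcongr
    exact le_add_self

end Cutoff

/-! ### Octant decomposition of the Gevrey symbol and the twisted product. -/

/-- The sign attached to a boolean. -/
def sg (b : Bool) : ℝ := if b then 1 else -1

lemma sg_ne_zero (b : Bool) : sg b ≠ 0 := by cases b <;> simp [sg]

/-- The damping of a factor of the product whose frequency has a sign different from that of the
product. -/
def damp (α : ℝ) (b b' : Bool) : ℝ := if b = b' then 0 else 2 * α

/-- A damped half line cut-off. -/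
def lineSym (s c t : ℝ) : ℝ := if 0 < s * t then Real.exp (-|c * t|) else 0

lemma lineSym_true {α : ℝ} (hα : 0 ≤ α) (b : Bool) (t : ℝ) :
    lineSym (sg true) (damp α true b) t =
      if 0 < t then (if b then 1 else Real.exp (-(2 * α * |t|))) else 0 := by
  have h2α : |2 * α| = 2 * α := abs_of_nonneg (by linarith)
  cases b <;> simp [lineSym, sg, damp, abs_mul _ t, h2α]

lemma lineSym_false {α : ℝ} (hα : 0 ≤ α) (b : Bool) (t : ℝ) :
    lineSym (sg false) (damp α false b) t =
      if t < 0 then (if b then Real.exp (-(2 * α * |t|)) else 1) else 0 := by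
  have h2α : |2 * α| = 2 * α := abs_of_nonneg (by linarith)
  cases b <;> simp [lineSym, sg, damp, abs_mul _ t, h2α]

/-- Only the pattern formed by the actual signs of `x`, `y` and `x + y` contributes. If `x` and `y`
have the same sign the exponent is zero. Otherwise the one whose sign is opposite to that of `x + y`
contributes `-2α` times its modulus. -/
lemma sum_lineSym {α : ℝ} (hα : 0 ≤ α) {x y : ℝ} (hx : x ≠ 0) (hy : y ≠ 0) (hxy : x + y ≠ 0) :
    ∑ b : Bool × Bool × Bool, lineSym (sg b.1) (damp α b.1 b.2.2) x *
      lineSym (sg b.2.1) (damp α b.2.1 b.2.2) y * lineSym (sg b.2.2) 0 (x + y) =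
      Real.exp (α * |x + y| - α * |x| - α * |y|) := by
  have h0 : ∀ b, lineSym (sg b) 0 (x + y) = lineSym (sg b) (damp 0 b b) (x + y) := fun b => by
    simp [damp]
  simp only [Fintype.sum_prod_type, Fintype.sum_bool, h0, lineSym_true hα, lineSym_false hα,
    lineSym_true le_rfl, lineSym_false le_rfl, if_true]
  have e1 : x < 0 → y < 0 → x + y < 0 := fun h h' => by linarith
  have e2 : 0 < x → 0 < y → 0 < x + y := fun h h' => by linarith
  generalize hz : x + y = z at *
  rcases lt_or_gt_of_ne hx with h1 | h1 <;> rcases lt_or_gt_of_ne hy with h2 | h2 <;>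
    rcases lt_or_gt_of_ne hxy with h3 | h3 <;>
    simp only [h1, h2, h3, h1.not_gt, h2.not_gt, h3.not_gt, if_true, if_false, abs_of_neg,
      abs_of_pos, mul_zero, zero_mul, add_zero, zero_add, mul_one, one_mul, Bool.false_eq_true]
  · rw [← hz, ← Real.exp_zero]; congr 1; ring
  · exact absurd (e1 h1 h2) h3.not_gt
  · rw [← hz]; congr 1; ring
  · rw [← hz]; congr 1; ring
  · rw [← hz]; congr 1; ring
  · rw [← hz]; congr 1; ring
  · exact absurd (e2 h1 h2) h3.not_gt
  · rw [← hz, ← Real.exp_zero]; congr 1; ring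

/-- Damped cut-offs to the octants of frequency space. -/
def octant (b : Fin d → Bool) (c : Fin d → ℝ) (ξ : Rd d) : ℂ :=
  ∏ i, ((lineSym (sg (b i)) (c i) (ξ i) : ℝ) : ℂ)

lemma lineSym_eq (i : Fin d) (s c : ℝ) : (fun ξ : Rd d => ((lineSym s c (ξ i) : ℝ) : ℂ)) =
    fun ξ => half i s ξ * ((Real.exp (-∑ k, |(Pi.single i c : Fin d → ℝ) k * ξ k|) : ℝ) : ℂ) := by
  ext ξ
  have : ∑ k, |(Pi.single i c : Fin d → ℝ) k * ξ k| = |c * ξ i| := by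
    rw [Finset.sum_eq_single i]
    · simp
    · intro k _ hk; simp [Pi.single_eq_of_ne hk]
    · simp
  rw [this, lineSym, half]
  split_ifs <;> simp

lemma isSym_octant (b : Fin d → Bool) (c : Fin d → ℝ) : IsSym (octant b c) := by
  refine IsSym.prod (m := fun i (ξ : Rd d) => ((lineSym (sg (b i)) (c i) (ξ i) : ℝ) : ℂ))
    fun i _ => ?_
  rw [lineSym_eq]
  exact (isSym_half i (sg_ne_zero _)).mul (isSym_exp _)

/-- Uniformity in the damping `c` is the point: the dampings have norm at most one, so only the
half-space projections enter the constant. -/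
lemma exists_ampMul_octant {p : ℝ≥0∞} (hp : 1 < p) (hpt : p ≠ ⊤) : ∃ C : ℝ≥0∞, C ≠ ⊤ ∧
    ∀ (b : Fin d → Bool) (c : Fin d → ℝ), AmpMul p (octant b c) C := by
  choose C hC hm using fun (i : Fin d) (b : Bool) => exists_ampMul_half hp hpt i (sg_ne_zero b)
  refine ⟨(∑ i, ∑ b, C i b) ^ (Finset.univ : Finset (Fin d)).card, ?_, fun b c => ?_⟩
  · exact ENNReal.pow_ne_top (ENNReal.sum_ne_top.2 fun i _ => ENNReal.sum_ne_top.2 fun b _ => hC i b)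
  refine AmpMul.prod (m := fun i (ξ : Rd d) => ((lineSym (sg (b i)) (c i) (ξ i) : ℝ) : ℂ))
    Finset.univ (fun i _ => ?_) fun i _ => ?_
  · rw [lineSym_eq]
    refine ((hm i (b i)).mul (ampMul_exp hp.le _) (isSym_exp _)).mono ?_
    rw [mul_one]
    exact (Finset.single_le_sum (f := fun b => C i b) (fun _ _ => zero_le) (Finset.mem_univ (b i))).trans
      (Finset.single_le_sum (f := fun i => ∑ b, C i b) (fun _ _ => zero_le) (Finset.mem_univ i))
  · rw [lineSym_eq]
    exact (isSym_half i (sg_ne_zero _)).mul (isSym_exp _)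

lemma expSym_eq {a : ℝ} (ha : 0 ≤ a) (ξ : Rd d) :
    expSym a ξ = ((Real.exp (-∑ i, (2 * Real.pi * a) * |ξ i|) : ℝ) : ℂ) := by
  rw [← avgSymbol_expAvg ha, avgSymbol_exp]
  have : 0 ≤ 2 * Real.pi * a := by positivity
  congr 3
  exact Finset.sum_congr rfl fun i _ => by rw [abs_mul, abs_of_nonneg this]

/-- The symbol of the product in the Gevrey variables splits into tensor products. -/
lemma sum_octant {a : ℝ} (ha : 0 ≤ a) {ξ η : Rd d} (hξ : ξ ∈ offHyper d) (hη : η ∈ offHyper d)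
    (hξη : ξ + η ∈ offHyper d) :
    ∑ e : Fin d → Bool × Bool × Bool,
      octant (fun i => (e i).1) (fun i => damp (2 * Real.pi * a) (e i).1 (e i).2.2) ξ *
      octant (fun i => (e i).2.1) (fun i => damp (2 * Real.pi * a) (e i).2.1 (e i).2.2) η *
      (octant (fun i => (e i).2.2) (fun _ => 0) (ξ + η) * expSym a (ξ + η)) =
    expSym a ξ * expSym a η := by
  have hα : 0 ≤ 2 * Real.pi * a := by positivity
  set α := 2 * Real.pi * a with hαdef
  have h1 : ∑ e : Fin d → Bool × Bool × Bool,
      octant (fun i => (e i).1) (fun i => damp α (e i).1 (e i).2.2) ξ *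
      octant (fun i => (e i).2.1) (fun i => damp α (e i).2.1 (e i).2.2) η *
      octant (fun i => (e i).2.2) (fun _ => 0) (ξ + η) =
      ((Real.exp (∑ i, (α * |ξ i + η i| - α * |ξ i| - α * |η i|)) : ℝ) : ℂ) := by
    rw [Real.exp_sum, Complex.ofReal_prod]
    simp_rw [← sum_lineSym hα (hξ _) (hη _) (hξη _), Complex.ofReal_sum]
    rw [Finset.prod_univ_sum, Fintype.piFinset_univ]
    refine Finset.sum_congr rfl fun e _ => ?_
    simp only [octant, ← Finset.prod_mul_distrib, Complex.ofReal_mul]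
    rfl
  simp_rw [← mul_assoc]
  rw [← Finset.sum_mul, h1, expSym_eq ha, expSym_eq ha, expSym_eq ha, ← Complex.ofReal_mul,
    ← Complex.ofReal_mul, ← Real.exp_add, ← Real.exp_add]
  congr 2
  simp only [Finset.sum_sub_distrib, ← hαdef, PiLp.add_apply]
  ring

namespace Cutoff

variable {X : Cutoff d} {p : ℝ≥0∞}

/-- The product of two functions with spectra in annuli, in the Gevrey variables. -/
lemma exists_twisted_product (X : Cutoff d) (hp : 1 < p) (hpt : p ≠ ⊤) {s₁ s₂ : ℝ}
    (h1 : s₁ ≤ d / p.toReal) (h2 : s₂ ≤ d / p.toReal) (hs : 2 * loss d p < s₁ + s₂) :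
    ∃ C : ℝ≥0∞, C ≠ ⊤ ∧ ∀ (a : ℝ) (j k : ℤ) (u v : Rd d → ℂ), 0 ≤ a →
      MemLp u p volume → MemLp v p volume → X.IsLoc j u → X.IsLoc k v →
      ∃ w, MemLp w p volume ∧ expAvg a w =ᵐ[volume] (fun x => expAvg a u x * expAvg a v x) ∧
        ∑' m : ℤ, two (m * (s₁ + s₂ - d / p.toReal)) *
          eLpNorm (X.ann.cut (2 ^ (-m)) w) p volume ≤
        C * (two (j * s₁) * eLpNorm u p volume) * (two (k * s₂) * eLpNorm v p volume) := by
  obtain ⟨Co, hCo, ho⟩ := exists_ampMul_octant (d := d) hp hpt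
  obtain ⟨Cp, hCp, hprod⟩ := exists_product_le X hp hpt h1 h2 hs
  have hq1 : 1 < expTwo p := hp.trans_le (le_max_right _ _)
  have hqt := expTwo_ne_top hpt
  obtain ⟨Co', hCo', ho'⟩ := exists_ampMul_octant (d := d) hq1 hqt
  obtain ⟨_, _, hloc⟩ := exists_isLoc_expTwo X hp.le hpt
  -- The number of sign patterns, three signs per coordinate. In the constant below, one `Co` stands
  -- for the projection of the product and the other two for the projections of the factors.
  set N : ℝ≥0∞ := ((Finset.univ : Finset (Fin d → Bool × Bool × Bool)).card : ℝ≥0∞)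
  refine ⟨N * (Co * (Cp * (Co * Co))), ENNReal.mul_ne_top (by simp [N]) (ENNReal.mul_ne_top hCo
    (ENNReal.mul_ne_top hCp (ENNReal.mul_ne_top hCo hCo))), fun a j k u v ha hu hv hlu hlv => ?_⟩
  have exU := fun e : Fin d → Bool × Bool × Bool => Rel.exists_of_ampMul hp hpt (isSym_octant
    (fun i => (e i).1) (fun i => damp (2 * Real.pi * a) (e i).1 (e i).2.2)) (ho _ _) hCo hu
  have exV := fun e : Fin d → Bool × Bool × Bool => Rel.exists_of_ampMul hp hpt (isSym_octant
    (fun i => (e i).2.1) (fun i => damp (2 * Real.pi * a) (e i).2.1 (e i).2.2)) (ho _ _) hCo hv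
  choose U hU hrU hbU using exU
  choose V hV hrV hbV using exV
  have hlU := fun e => hlu.of_rel hp hpt hu (hU e) (isSym_octant _ _) (hrU e)
  have hlV := fun e => hlv.of_rel hp hpt hv (hV e) (isSym_octant _ _) (hrV e)
  have hUV := fun e => memLp_mul_top (hU e) ((hlV e).memLp_top hp.le hpt (hV e))
  have exW := fun e : Fin d → Bool × Bool × Bool => Rel.exists_of_ampMul hp hpt (isSym_octant
    (fun i => (e i).2.2) (fun _ => 0)) (ho _ _) hCo (hUV e)
  choose W hW hrW hbW using exW
  have hw : MemLp (fun x => ∑ e, W e x) p volume := memLp_finsetSum _ fun e _ => hW e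
  refine ⟨fun x => ∑ e, W e x, hw, ?_, ?_⟩
  · have hPu := memLp_expAvg hp.le a hu
    have hPv := memLp_expAvg hp.le a hv
    have hlPu := hlu.of_rel hp hpt hu hPu (isSym_expSym ha) (Rel.of_expAvg hp.le ha hu)
    have hlPv := hlv.of_rel hp hpt hv hPv (isSym_expSym ha) (Rel.of_expAvg hp.le ha hv)
    have hPuv := memLp_mul_top hPu (hlPv.memLp_top hp.le hpt hPv)
    have hexp : ∃ C : ℝ≥0∞, C ≠ ⊤ ∧ AmpMul (expTwo p) (expSym (d := d) a) C := by
      refine ⟨1, by simp, ?_⟩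
      rw [← avgSymbol_expAvg ha, funext (avgSymbol_exp _)]
      exact ampMul_exp hq1.le _
    refine ae_eq_of_forall_amp hp hpt (memLp_expAvg hp.le a hw) hPuv fun g hg => ?_
    -- The index `none`, with output symbol `-1`, carries the untwisted product `expAvg a u * expAvg
    -- a v`. The vanishing of the total sum is then the desired equality, after `sum_octant` on the
    -- symbols.
    have key := sum_integral_eq_zero (le_max_left 2 p) hqt
      (Finset.univ : Finset (Option (Fin d → Bool × Bool × Bool)))
      (z := fun o => o.elim (expSym a) fun e =>
        octant (fun i => (e i).1) (fun i => damp (2 * Real.pi * a) (e i).1 (e i).2.2))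
      (z' := fun o => o.elim (expSym a) fun e =>
        octant (fun i => (e i).2.1) (fun i => damp (2 * Real.pi * a) (e i).2.1 (e i).2.2))
      (k := fun o => o.elim (fun _ => -1) fun e ξ =>
        octant (fun i => (e i).2.2) (fun _ => 0) ξ * expSym a ξ)
      (fun o _ => by cases o; exacts [isSym_expSym ha, isSym_octant _ _])
      (fun o _ => by cases o; exacts [isSym_expSym ha, isSym_octant _ _])
      (fun o _ => by cases o; exacts [contDiffOn_const, (isSym_octant _ _).mul (isSym_expSym ha)])
      (fun o _ => by cases o; exacts [hexp, ⟨Co', hCo', ho' _ _⟩])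
      (fun o _ => by cases o; exacts [hexp, ⟨Co', hCo', ho' _ _⟩])
      (fun ξ hξ η hη hξη => by
        rw [Fintype.sum_option]
        simp only [Option.elim_none, Option.elim_some]
        rw [sum_octant ha hξ hη hξη]
        ring)
      (hloc j u hu hlu).1 (hloc k v hv hlv).1
      (U := fun o => o.elim (expAvg a u) U) (V := fun o => o.elim (expAvg a v) V)
      (fun o _ => by
        cases o
        exacts [(hloc j _ hPu hlPu).1, (hloc j _ (hU _) (hlU _)).1])
      (fun o _ => by
        cases o
        exacts [(hloc k _ hPv hlPv).1, (hloc k _ (hV _) (hlV _)).1])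
      (fun o _ => by cases o; exacts [Rel.of_expAvg hp.le ha hu, hrU _])
      (fun o _ => by cases o; exacts [Rel.of_expAvg hp.le ha hv, hrV _]) hg
    rw [Fintype.sum_option] at key
    simp only [Option.elim_none, Option.elim_some, fourierInv_const_mul] at key
    rw [Rel.of_expAvg hp.le ha hw g hg]
    have hgE := hg.mul_sym (isSym_expSym ha).neg_arg
    obtain ⟨p', hpp, -, -⟩ := exists_holderConjugate hp hpt
    have e1 : ∫ x, (∑ e, W e x) * 𝓕⁻ (fun ξ => expSym a (-ξ) * g ξ) x =
        ∑ e, ∫ x, (U e x * V e x) * 𝓕⁻ (fun ξ => octant (fun i => (e i).2.2) (fun _ => 0) (-ξ) *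
          expSym a (-ξ) * g ξ) x := by
      simp only [Finset.sum_mul]
      rw [integral_finsetSum _ fun e _ => integrable_mul_of_holder (q := p') (hW e) (hgE.memLp p')]
      refine Finset.sum_congr rfl fun e _ => ?_
      rw [hrW e _ hgE]
      simp only [mul_assoc]
    rw [e1]
    simp only [mul_neg, neg_mul, one_mul, integral_neg] at key
    linear_combination key
  · have hcut : ∀ m : ℤ, eLpNorm (X.ann.cut (2 ^ (-m)) fun x => ∑ e, W e x) p volume ≤
        ∑ e, Co * eLpNorm (X.ann.cut (2 ^ (-m)) fun x => U e x * V e x) p volume := fun m => by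
      have hr : Rel (X.ann.sym (2 ^ (-m))) (fun x => ∑ e, W e x)
          (fun x => ∑ e, X.ann.cut (2 ^ (-m)) (W e) x) := fun g hg => by
        obtain ⟨p', hpp, -, -⟩ := exists_holderConjugate hp hpt
        have hg' := hg.mul_sym (X.ann.isSym_sym (2 ^ (-m))).neg_arg
        simp only [Finset.sum_mul]
        rw [integral_finsetSum _ fun e _ => integrable_mul_of_holder (q := p') (hW e) (hg'.memLp p'),
          integral_finsetSum _ fun e _ => integrable_mul_of_holder (q := p')
            (X.ann.memLp_cut hp.le (hW e)) (hg.memLp p')]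
        exact Finset.sum_congr rfl fun e _ => X.ann.rel_cut hp.le (hW e) g hg
      have hsum : MemLp (fun x => ∑ e, X.ann.cut (2 ^ (-m)) (W e) x) p volume :=
        memLp_finsetSum _ fun e _ => X.ann.memLp_cut hp.le (hW e)
      rw [eLpNorm_congr_ae (Rel.unique hp hpt (X.ann.memLp_cut hp.le hw) hsum
        (X.ann.rel_cut hp.le hw) hr)]
      refine ((congrArg (fun f => eLpNorm f p volume) (by ext x; simp)).le.trans
        (eLpNorm_sum_le (f := fun e => X.ann.cut (2 ^ (-m)) (W e)) (s := Finset.univ)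
          (fun e _ => (X.ann.memLp_cut hp.le (hW e)).1) hp.le)).trans ?_
      refine Finset.sum_le_sum fun e _ => ?_
      -- The outer projection commutes with the dyadic block, so it acts on the block of `U e * V e`
      -- and costs only `Co`.
      exact Rel.bound hp hpt (isSym_octant _ _) (ho _ _) hCo (X.ann.memLp_cut hp.le (hUV e))
        (X.ann.memLp_cut hp.le (hW e)) (X.ann.rel_cut_cut hp.le (isSym_octant _ _) (hUV e) (hW e)
          (hrW e))
    set A := eLpNorm u p volume
    set B := eLpNorm v p volume
    calc _ ≤ ∑' m : ℤ, ∑ e, Co * (two (m * (s₁ + s₂ - d / p.toReal)) *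
          eLpNorm (X.ann.cut (2 ^ (-m)) fun x => U e x * V e x) p volume) := by
          refine ENNReal.tsum_le_tsum fun m => ?_
          refine (mul_le_mul_right (hcut m) _).trans_eq ?_
          rw [Finset.mul_sum]
          exact Finset.sum_congr rfl fun e _ => by ring
      _ = ∑ e, Co * ∑' m : ℤ, (two (m * (s₁ + s₂ - d / p.toReal)) *
          eLpNorm (X.ann.cut (2 ^ (-m)) fun x => U e x * V e x) p volume) := by
          rw [Summable.tsum_finsetSum fun _ _ => ENNReal.summable]
          simp only [ENNReal.tsum_mul_left]
      _ ≤ ∑ e : Fin d → Bool × Bool × Bool, Co * (Cp * (two (j * s₁) * (Co * A)) *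
            (two (k * s₂) * (Co * B))) := by
          refine Finset.sum_le_sum fun e _ => ?_
          gcongr
          refine (hprod j k _ _ (hU e) (hV e) (hlU e) (hlV e)).trans ?_
          gcongr
          · exact hbU e
          · exact hbV e
      _ = _ := by
          rw [Finset.sum_const, nsmul_eq_mul]
          ring

end Cutoff

/-! ### Convergence of low-frequency cut-offs and of series of functions. -/

/-- Cutting off a Schwartz function at high frequencies is a small perturbation. -/
lemma tendsto_smulLeftCLM_low (X : Cutoff d) (ψ : 𝓢(Rd d, ℂ)) :
    Tendsto (fun n : ℕ => SchwartzMap.smulLeftCLM ℂ (X.low.sym ((2 : ℝ) ^ (-(n : ℤ)))) ψ) atTop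
      (𝓝 ψ) := by
  rw [(schwartz_withSeminorms ℂ (Rd d) ℂ).tendsto_nhds]
  rintro ⟨k, l⟩ ε hε
  set σ : ℕ → Rd d → ℂ := fun n => X.low.sym ((2 : ℝ) ^ (-(n : ℤ))) with hσ
  have hr : ∀ n : ℕ, (2 : ℝ) ^ (-(n : ℤ)) ≠ 0 := fun n => by positivity
  set base : 𝓢(Rd d, ℂ) := (X.low.hasCompactSupport_sym one_ne_zero).toSchwartzMap
    (X.low.contDiff_sym 1) with hbase
  have hσb : ∀ n, σ n = fun x => base (((2 : ℝ) ^ (-(n : ℤ))) • x) := fun n => by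
    ext x
    change _ = X.low.sym 1 _
    simp only [hσ, Profile.sym, one_smul]
    rw [smul_comm]
  have hD : ∀ n i x, ‖iteratedFDeriv ℝ i (σ n) x‖ ≤ SchwartzMap.seminorm ℂ 0 i base := fun n i x => by
    rw [hσb, iteratedFDeriv_comp_const_smul _ (base.smooth i), norm_smul, norm_pow]
    have h1 : ‖(2 : ℝ) ^ (-(n : ℤ))‖ ^ i ≤ 1 := by
      refine pow_le_one₀ (norm_nonneg _) ?_
      rw [Real.norm_of_nonneg (by positivity), zpow_neg, zpow_natCast]
      exact inv_le_one_of_one_le₀ (one_le_pow₀ one_le_two)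
    calc _ ≤ 1 * ‖iteratedFDeriv ℝ i base (((2 : ℝ) ^ (-(n : ℤ))) • x)‖ := by gcongr
      _ ≤ _ := by rw [one_mul]; exact base.norm_iteratedFDeriv_le_seminorm ℂ i _
  set M : ℝ := ∑ i ∈ Finset.range (l + 1), (l.choose i : ℝ) * SchwartzMap.seminorm ℂ 0 i base *
    SchwartzMap.seminorm ℂ (k + 1) (l - i) ψ + SchwartzMap.seminorm ℂ (k + 1) l ψ with hM
  have hM0 : 0 ≤ M := by positivity
  have hbound : ∀ n : ℕ, SchwartzMap.seminorm ℂ k l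
      (SchwartzMap.smulLeftCLM ℂ (σ n) ψ - ψ) ≤ (M * (3 * Real.pi)) * (2⁻¹ : ℝ) ^ n := fun n => by
    refine SchwartzMap.seminorm_le_bound ℂ k l _ (by positivity) fun x => ?_
    set f := SchwartzMap.smulLeftCLM ℂ (σ n) ψ - ψ with hf
    have hsm := X.low.hasTemperateGrowth_sym (hr n)
    have hfx : ⇑f = fun x => σ n x • ψ x - ψ x := by
      ext x
      rw [hf, ← SchwartzMap.smulLeftCLM_apply_apply hsm]
      rfl
    -- Here the cut-off equals one in a neighbourhood of `x`, so the difference and all its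
    -- derivatives vanish.
    by_cases hx : ‖(2 * Real.pi) • x‖ < 3 / 4 * 2 ^ n
    · have h0 : ⇑f =ᶠ[𝓝 x] 0 := by
        have ho : IsOpen {x : Rd d | ‖(2 * Real.pi) • x‖ < 3 / 4 * 2 ^ n} :=
          isOpen_lt (by fun_prop) continuous_const
        filter_upwards [ho.mem_nhds hx] with y hy
        have h1 : σ n y = 1 := by
          have : X.χ ((2 : ℝ) ^ (-(n : ℤ)) • (2 * Real.pi) • y) = 1 := by
            refine X.chi_eq_one ?_
            rw [Cutoff.norm_smul_two_zpow, div_lt_iff₀ (by positivity)]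
            exact_mod_cast hy
          change ((X.χ _ : ℝ) : ℂ) = 1
          rw [this]; simp
        rw [hfx]
        simp [h1]
      rw [h0.iteratedFDeriv ℝ l |>.eq_of_nhds]
      simp only [Pi.zero_def, iteratedFDeriv_fun_zero, Pi.zero_apply, norm_zero, mul_zero]
      positivity
    -- Elsewhere `|x|` is at least of order `2^n`: trading one more power of `|x|` for a factor
    -- `2^{-n}` gives the decay. The constant `3π` is a convenient majorant of `8π/3`.
    · have hx1 : 1 ≤ ‖x‖ * (3 * Real.pi * (2⁻¹ : ℝ) ^ n) := by
        rw [norm_smul, Real.norm_of_nonneg (by positivity), not_lt] at hx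
        have h2 : (2⁻¹ : ℝ) ^ n * 2 ^ n = 1 := by rw [← mul_pow]; norm_num
        have h3 : (0 : ℝ) < 2⁻¹ ^ n := by positivity
        nlinarith [mul_le_mul_of_nonneg_right hx h3.le, Real.pi_pos, norm_nonneg x]
      have h1 : ‖iteratedFDeriv ℝ l (⇑f) x‖ ≤ ∑ i ∈ Finset.range (l + 1), (l.choose i : ℝ) *
          SchwartzMap.seminorm ℂ 0 i base * ‖iteratedFDeriv ℝ (l - i) ψ x‖ +
          ‖iteratedFDeriv ℝ l ψ x‖ := by
        have hσs : ContDiff ℝ l (σ n) := (X.low.contDiff_sym _).of_le (by exact_mod_cast le_top)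
        have hψs : ContDiff ℝ l ψ := ψ.smooth l
        have hsub : iteratedFDeriv ℝ l (⇑f) x =
            iteratedFDeriv ℝ l (fun x => σ n x • ψ x) x - iteratedFDeriv ℝ l ψ x := by
          rw [hfx]
          exact fun_iteratedFDeriv_sub_apply (hσs.smul hψs).contDiffAt hψs.contDiffAt
        rw [hsub]
        refine (norm_sub_le _ _).trans ?_
        gcongr
        refine (norm_iteratedFDeriv_smul_le hσs hψs x le_rfl).trans ?_
        gcongr with i hi
        exact hD n i x
      have h2 : ‖x‖ ^ (k + 1) * ‖iteratedFDeriv ℝ l (⇑f) x‖ ≤ M := by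
        calc _ ≤ ‖x‖ ^ (k + 1) * (∑ i ∈ Finset.range (l + 1), (l.choose i : ℝ) *
          SchwartzMap.seminorm ℂ 0 i base * ‖iteratedFDeriv ℝ (l - i) ψ x‖ +
          ‖iteratedFDeriv ℝ l ψ x‖) := by gcongr
          _ = ∑ i ∈ Finset.range (l + 1), (l.choose i : ℝ) * SchwartzMap.seminorm ℂ 0 i base *
              (‖x‖ ^ (k + 1) * ‖iteratedFDeriv ℝ (l - i) ψ x‖) +
              ‖x‖ ^ (k + 1) * ‖iteratedFDeriv ℝ l ψ x‖ := by
            rw [mul_add, Finset.mul_sum]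
            congr 1
            exact Finset.sum_congr rfl fun i _ => by ring
          _ ≤ M := by
            rw [hM]
            gcongr with i hi
            · exact SchwartzMap.le_seminorm ℂ _ _ ψ x
            · exact SchwartzMap.le_seminorm ℂ _ _ ψ x
      calc ‖x‖ ^ k * ‖iteratedFDeriv ℝ l (⇑f) x‖
          ≤ (‖x‖ ^ k * ‖iteratedFDeriv ℝ l (⇑f) x‖) * (‖x‖ * (3 * Real.pi * (2⁻¹ : ℝ) ^ n)) :=
            le_mul_of_one_le_right (by positivity) hx1
        _ = (‖x‖ ^ (k + 1) * ‖iteratedFDeriv ℝ l (⇑f) x‖) * (3 * Real.pi * (2⁻¹ : ℝ) ^ n) := by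
            ring
        _ ≤ M * (3 * Real.pi * (2⁻¹ : ℝ) ^ n) := by gcongr
        _ = _ := by ring
  have hlim : Tendsto (fun n : ℕ => (M * (3 * Real.pi)) * (2⁻¹ : ℝ) ^ n) atTop (𝓝 0) := by
    simpa using (tendsto_pow_atTop_nhds_zero_of_lt_one (by norm_num : (0 : ℝ) ≤ 2⁻¹)
      (by norm_num)).const_mul (M * (3 * Real.pi))
  filter_upwards [hlim.eventually_lt_const hε] with n hn
  exact (hbound n).trans_lt hn

lemma tendsto_test_low (X : Cutoff d) (φ : 𝓢(Rd d, ℂ)) :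
    Tendsto (fun n : ℕ => X.low.test ((2 : ℝ) ^ (-(n : ℤ))) φ) atTop (𝓝 φ) := by
  have h := ((FourierTransform.fourierCLM ℂ 𝓢(Rd d, ℂ)).continuous.tendsto _).comp
    (tendsto_smulLeftCLM_low X (𝓕⁻ φ))
  simpa [FourierTransform.fourierCLM_apply, FourierTransform.fourier_fourierInv_eq] using! h

lemma tendsto_S (X : Cutoff d) (T : Tempered d) (φ : 𝓢(Rd d, ℂ)) :
    Tendsto (fun n : ℕ => X.S n T φ) atTop (𝓝 (T φ)) :=
  (T.continuous.tendsto φ).comp (tendsto_test_low X φ)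

/-- The sum of a summable series of `L^r` functions. -/
lemma exists_sum_memLp {ι : Type*} {r r' : ℝ≥0∞} [hrr : ENNReal.HolderConjugate r r'] (hr : 1 ≤ r)
    {g : ι → Rd d → ℂ} (hg : ∀ i, MemLp (g i) r volume)
    (hsum : ∑' i, eLpNorm (g i) r volume ≠ ⊤) :
    ∃ G, MemLp G r volume ∧ eLpNorm G r volume ≤ ∑' i, eLpNorm (g i) r volume ∧
      ∀ ψ, MemLp ψ r' volume → HasSum (fun i => ∫ x, ψ x * g i x) (∫ x, ψ x * G x) := by
  have : Fact (1 ≤ r) := ⟨hr⟩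
  have hr' : Fact (1 ≤ r') := ⟨ENNReal.HolderConjugate.one_le r' r⟩
  set f : ι → Lp ℂ r (volume : Measure (Rd d)) := fun i => (hg i).toLp (g i)
  have hnorm : ∀ i, ‖f i‖ = (eLpNorm (g i) r volume).toReal := fun i => Lp.norm_toLp _ _
  have hs : Summable fun i => ‖f i‖ := by
    simp only [hnorm]
    exact ENNReal.summable_toReal hsum
  refine ⟨(∑' i, f i : Lp ℂ r (volume : Measure (Rd d))), Lp.memLp _, ?_, fun ψ hψ => ?_⟩
  · have h1 : ‖∑' i, f i‖ ≤ ∑' i, ‖f i‖ := norm_tsum_le_tsum_norm hs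
    simp only [hnorm] at h1
    rw [← ENNReal.tsum_toReal_eq fun i => (hg i).2.ne, Lp.norm_def] at h1
    exact (ENNReal.toReal_le_toReal (Lp.memLp _).2.ne hsum).1 h1
  · have h1 := (hs.of_norm.hasSum).mapL
      ((ContinuousLinearMap.mul ℂ ℂ).lpPairing volume r' r (hψ.toLp ψ))
    simp only [ContinuousLinearMap.lpPairing_eq_integral] at h1
    have e1 : ∀ G : Lp ℂ r (volume : Measure (Rd d)), ∫ x, (ContinuousLinearMap.mul ℂ ℂ)
        ((hψ.toLp ψ) x) (G x) = ∫ x, ψ x * G x := fun G => by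
      refine integral_congr_ae ?_
      filter_upwards [hψ.coeFn_toLp] with x hx
      rw [hx]; rfl
    simp only [e1] at h1
    have e2 : ∀ i, ∫ x, ψ x * f i x = ∫ x, ψ x * g i x := fun i => by
      refine integral_congr_ae ?_
      filter_upwards [(hg i).coeFn_toLp] with x hx
      rw [hx]
    simp only [e2] at h1
    exact h1

/-- The tempered distribution defined by a dominated series of functions. -/
lemma exists_tempered_sum {ι : Type*} {b : ι → Rd d → ℂ} {β : ι → ℝ≥0∞} (hβ : ∑' i, β i ≠ ⊤)
    (hint : ∀ i (φ : 𝓢(Rd d, ℂ)), Integrable fun x => φ x * b i x)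
    {Q : 𝓢(Rd d, ℂ) → ℝ≥0∞} (hQ : ∀ φ, Q φ ≠ ⊤) (hQ0 : Tendsto Q (𝓝 0) (𝓝 0))
    (h : ∀ i φ, ‖∫ x, φ x * b i x‖ₑ ≤ β i * Q φ) :
    ∃ T : Tempered d, ∀ φ, HasSum (fun i => ∫ x, φ x * b i x) (T φ) := by
  have hs : ∀ φ : 𝓢(Rd d, ℂ), Summable fun i => ∫ x, φ x * b i x := fun φ => by
    have h1 : ∑' i, β i * Q φ ≠ ⊤ := by
      rw [ENNReal.tsum_mul_right]
      exact ENNReal.mul_ne_top hβ (hQ φ)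
    refine Summable.of_norm_bounded (ENNReal.summable_toReal h1) fun i => ?_
    rw [← toReal_enorm]
    exact ENNReal.toReal_mono (ENNReal.ne_top_of_tsum_ne_top h1 i) (h i φ)
  have hbound : ∀ φ : 𝓢(Rd d, ℂ), ‖∑' i, ∫ x, φ x * b i x‖ₑ ≤ (∑' i, β i) * Q φ := fun φ => by
    rw [← ENNReal.tsum_mul_right]
    exact enorm_tsum_le_tsum_enorm.trans (ENNReal.tsum_le_tsum fun i => h i φ)
  let L : 𝓢(Rd d, ℂ) →ₗ[ℂ] ℂ :=
    { toFun := fun φ => ∑' i, ∫ x, φ x * b i x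
      map_add' := fun φ ψ => by
        rw [← (hs φ).tsum_add (hs ψ)]
        refine tsum_congr fun i => ?_
        rw [← integral_add (hint i φ) (hint i ψ)]
        refine integral_congr_ae (Eventually.of_forall fun x => ?_)
        exact add_mul _ _ _
      map_smul' := fun c φ => by
        rw [RingHom.id_apply, smul_eq_mul, ← tsum_mul_left]
        refine tsum_congr fun i => ?_
        rw [← integral_const_mul]
        refine integral_congr_ae (Eventually.of_forall fun x => ?_)
        exact mul_assoc _ _ _ }
  have hL : Continuous L := by
    refine continuous_of_continuousAt_zero L ?_
    rw [ContinuousAt, map_zero, tendsto_zero_iff_enorm_tendsto_zero]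
    refine tendsto_of_tendsto_of_tendsto_of_le_of_le tendsto_const_nhds
      (h := fun φ => (∑' i, β i) * Q φ) ?_ (fun _ => zero_le) hbound
    simpa using ENNReal.Tendsto.const_mul hQ0 (Or.inr hβ)
  exact ⟨ContinuousLinearMap.toPointwiseConvergenceCLM _ _ _ _ ⟨L, hL⟩, fun φ => (hs φ).hasSum⟩

/-- Dominated convergence for the counting measure: each index is eventually excluded. -/
lemma tendsto_tsum_ite_atBot {ι : Type*} {β : ι → ℝ≥0∞} (hβ : ∑' i, β i ≠ ⊤) (l : ι → ℤ) :
    Tendsto (fun m : ℤ => ∑' i, if l i ≤ m then β i else 0) atBot (𝓝 0) := by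
  let _ : MeasurableSpace ι := ⊤
  have h := tendsto_lintegral_filter_of_dominated_convergence (μ := Measure.count) (l := atBot)
    (F := fun (m : ℤ) i => if l i ≤ m then β i else 0) (f := fun _ => 0) β
    (Eventually.of_forall fun _ => measurable_from_top)
    (Eventually.of_forall fun m => Eventually.of_forall fun i => by split_ifs <;> simp)
    (by rwa [lintegral_count]) (Eventually.of_forall fun i => by
      refine tendsto_const_nhds.congr' ?_
      filter_upwards [eventually_lt_atBot (l i)] with m hm
      rw [if_neg (not_le.2 hm)])
  simpa only [lintegral_count, lintegral_zero, tsum_zero] using h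

namespace Profile

variable (m : Profile d)

lemma eLpNorm_test_le {q : ℝ≥0∞} (hq : 1 ≤ q) {r : ℝ} (hr : r ≠ 0) (φ : 𝓢(Rd d, ℂ)) :
    eLpNorm (m.test r φ) q volume ≤ m.bd * eLpNorm φ q volume := by
  rw [coe_test m hr]
  have hm : Measurable fun y : Rd d => -(r • y) := by fun_prop
  exact eLpNorm_avg_le hm m.integrable_kernel φ.continuous.aestronglyMeasurable hq

end Profile

/-! ### Pairing with Schwartz functions and summation in Besov spaces. -/

/-- The symbol of the powers of the Laplace operator. -/
def powSym (N : ℕ) (ξ : Rd d) : ℂ := ((‖(2 * Real.pi) • ξ‖ ^ 2 : ℝ) : ℂ) ^ N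

lemma hasTemperateGrowth_powSym (N : ℕ) : (powSym (d := d) N).HasTemperateGrowth := by
  unfold powSym
  simp only [norm_smul, mul_pow]
  fun_prop

/-- Powers of the Laplace operator on Schwartz functions. -/
def lapTest (N : ℕ) : 𝓢(Rd d, ℂ) →L[ℂ] 𝓢(Rd d, ℂ) :=
  FourierTransform.fourierCLM ℂ 𝓢(Rd d, ℂ) ∘L SchwartzMap.smulLeftCLM ℂ (powSym N) ∘L
    FourierTransform.fourierInvCLM ℂ 𝓢(Rd d, ℂ)

namespace Cutoff

variable (X : Cutoff d)

/-- The profile of `Δ_0` divided by the symbol of a power of the Laplace operator. -/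
def fatDiv (N : ℕ) : Profile d where
  toFun ξ := X.fat.toFun ξ * ((‖ξ‖ ^ 2) ^ N)⁻¹
  smooth := by
    rw [contDiff_iff_contDiffAt]
    intro ξ
    by_cases h : ‖ξ‖ < 3 / 8
    · have h0 : (fun ξ => X.fat.toFun ξ * ((‖ξ‖ ^ 2) ^ N)⁻¹) =ᶠ[𝓝 ξ] fun _ => 0 := by
        filter_upwards [(isOpen_lt continuous_norm continuous_const).mem_nhds h] with ζ hζ
        have : X.fat.toFun ζ = 0 := by
          by_contra hcon
          exact absurd (X.norm_of_fat_ne_zero hcon).1 (not_le.2 hζ)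
        rw [this, zero_mul]
      exact contDiffAt_const.congr_of_eventuallyEq h0
    · have hξ : ‖ξ‖ ^ 2 ≠ 0 := by
        have : 0 < ‖ξ‖ := by
          push Not at h
          linarith
        positivity
      exact X.fat.smooth.contDiffAt.mul
        (((contDiff_norm_sq ℝ).contDiffAt.pow N).inv (pow_ne_zero _ hξ))
  compact := X.fat.compact.mul_right

/-- The fat profile avoids the origin, so `|ξ|^{2N}` can be divided out of it. Moving that factor to
the Schwartz function gains `2^{-2Nj}`, as needed at high frequencies. -/
lemma test_fat_eq (N : ℕ) (j : ℤ) (φ : 𝓢(Rd d, ℂ)) :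
    X.fat.test (2 ^ (-j)) φ =
      ((((2 : ℝ) ^ (-j)) ^ 2) ^ N : ℂ) • (X.fatDiv N).test (2 ^ (-j)) (lapTest N φ) := by
  have h2 : (2 : ℝ) ^ (-j) ≠ 0 := by positivity
  simp only [Profile.test, lapTest, ContinuousLinearMap.comp_apply, FourierTransform.fourierCLM_apply,
    FourierTransform.fourierInvCLM_apply, FourierTransform.fourierInv_fourier_eq]
  rw [← FourierTransform.fourier_smul, SchwartzMap.smulLeftCLM_smulLeftCLM_apply
    ((X.fatDiv N).hasTemperateGrowth_sym h2) (hasTemperateGrowth_powSym N)]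
  congr 1
  ext ξ
  rw [SchwartzMap.smulLeftCLM_apply_apply (X.fat.hasTemperateGrowth_sym h2), smul_apply,
    SchwartzMap.smulLeftCLM_apply_apply
    (((X.fatDiv N).hasTemperateGrowth_sym h2).mul (hasTemperateGrowth_powSym N)), smul_smul]
  congr 1
  simp only [Pi.mul_apply, Profile.sym, fatDiv, powSym]
  by_cases h : X.fat.toFun (((2 : ℝ) ^ (-j)) • ((2 * Real.pi) • ξ)) = 0
  · rw [h]; simp
  · have h3 := (X.norm_of_fat_ne_zero h).1
    set ζ := (2 * Real.pi) • ξ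
    have h4 : ‖((2 : ℝ) ^ (-j)) • ζ‖ = 2 ^ (-j) * ‖ζ‖ := by
      rw [norm_smul, Real.norm_of_nonneg (by positivity)]
    have h5 : ((((2 : ℝ) ^ (-j)) * ‖ζ‖) ^ 2) ^ N ≠ 0 := by
      rw [← h4]
      have : 0 < ‖((2 : ℝ) ^ (-j)) • ζ‖ := by linarith
      positivity
    rw [h4]
    norm_cast
    rw [mul_pow, mul_pow] at h5 ⊢
    have h6 := left_ne_zero_of_mul h5
    have h7 := right_ne_zero_of_mul h5
    generalize X.fat.toFun _ = F
    generalize (((2 : ℝ) ^ (-j)) ^ 2) ^ N = A at *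
    generalize (‖ζ‖ ^ 2) ^ N = B at *
    field_simp

end Cutoff

lemma tendsto_eLpNorm_zero {q : ℝ≥0∞} (hq : 1 ≤ q) :
    Tendsto (fun φ : 𝓢(Rd d, ℂ) => eLpNorm φ q volume) (𝓝 0) (𝓝 0) := by
  have : Fact (1 ≤ q) := ⟨hq⟩
  have h : Continuous fun φ : 𝓢(Rd d, ℂ) => ‖SchwartzMap.toLpCLM ℂ ℂ q volume φ‖ₑ := by fun_prop
  have h0 := h.tendsto 0
  simp only [map_zero, enorm_zero] at h0
  refine h0.congr fun φ => ?_
  exact Lp.enorm_toLp (hf := φ.memLp q volume)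

namespace Cutoff

variable {X : Cutoff d} {p : ℝ≥0∞}

/-- A bound uniform in `j`, so that series summable in the Besov sense converge as tempered
distributions. For `j ≤ 0`, Bernstein's inequality gives `2^(jd/p) ≤ 2^(jσ)` because `σ ≤ d/p`. For
`j ≥ 0`, powers of the Laplace operator on the test function beat any `σ`. -/
lemma exists_pairing_le (X : Cutoff d) (hp : 1 < p) (hpt : p ≠ ⊤) {σ : ℝ} (hσ : σ ≤ d / p.toReal) :
    ∃ Q : 𝓢(Rd d, ℂ) → ℝ≥0∞, (∀ φ, Q φ ≠ ⊤) ∧ Tendsto Q (𝓝 0) (𝓝 0) ∧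
      ∀ (j : ℤ) (u : Rd d → ℂ) (φ : 𝓢(Rd d, ℂ)), MemLp u p volume → X.IsLoc j u →
        ‖∫ x, φ x * u x‖ₑ ≤ (two (j * σ) * eLpNorm u p volume) * Q φ := by
  obtain ⟨p', hpp, hp', hpt'⟩ := exists_holderConjugate hp hpt
  -- Large enough that `-2N ≤ σ`, hence `2^(-2Nj) ≤ 2^(jσ)` for `j ≥ 0`.
  set N := ⌈|σ|⌉₊ with hN
  have hNσ : |σ| ≤ N := Nat.le_ceil _
  refine ⟨fun φ => X.fat.bern p * eLpNorm φ 1 volume +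
    (X.fatDiv N).bd * eLpNorm (lapTest N φ) p' volume, fun φ => ?_, ?_, fun j u φ hu hl => ?_⟩
  · exact ENNReal.add_ne_top.2 ⟨ENNReal.mul_ne_top X.fat.bern_ne_top (φ.memLp _ _).2.ne,
      ENNReal.mul_ne_top (X.fatDiv N).bd_ne_top ((lapTest N φ).memLp _ _).2.ne⟩
  · have h1 := ENNReal.Tendsto.const_mul (tendsto_eLpNorm_zero (d := d) (q := 1) le_rfl)
      (Or.inr (X.fat.bern_ne_top (p := p)))
    have h2 : Tendsto (fun φ : 𝓢(Rd d, ℂ) => eLpNorm (lapTest N φ) p' volume) (𝓝 0) (𝓝 0) := by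
      have := (lapTest (d := d) N).continuous.tendsto 0
      rw [map_zero] at this
      exact (tendsto_eLpNorm_zero hp'.le).comp this
    have h3 := ENNReal.Tendsto.const_mul h2 (Or.inr (X.fatDiv N).bd_ne_top)
    simpa using h1.add h3
  · rcases le_total j 0 with hj | hj
    · have hut := hl.memLp_top hp.le hpt hu
      have h1 : ‖∫ x, φ x * u x‖ₑ ≤ eLpNorm φ 1 volume * eLpNorm u ⊤ volume :=
        enorm_integral_mul_le (φ.memLp 1 volume).1 hut.1
      have hj' : (j : ℝ) ≤ 0 := by exact_mod_cast hj
      calc _ ≤ eLpNorm φ 1 volume *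
            (two (j * (d / p.toReal)) * X.fat.bern p * eLpNorm u p volume) :=
            h1.trans (by gcongr; exact hl.eLpNorm_top_le hp.le hpt hu)
        _ ≤ eLpNorm φ 1 volume * (two (j * σ) * X.fat.bern p * eLpNorm u p volume) := by
            gcongr
            exact two_mono (mul_le_mul_of_nonpos_left hσ hj')
        _ = (two (j * σ) * eLpNorm u p volume) * (X.fat.bern p * eLpNorm φ 1 volume) := by ring
        _ ≤ _ := by gcongr; exact le_self_add
    · have h2 : (2 : ℝ) ^ (-j) ≠ 0 := by positivity
      have e1 : ∫ x, φ x * u x = ∫ x, X.fat.test (2 ^ (-j)) φ x * u x := by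
        calc ∫ x, φ x * u x = ∫ x, X.fat.cut (2 ^ (-j)) u x * φ x := by
              refine integral_congr_ae ?_
              filter_upwards [hl] with x hx
              rw [hx, mul_comm]
          _ = _ := by
              rw [X.fat.integral_cut_mul hp.le h2 hu]
              simp only [mul_comm]
      have hpp' : ENNReal.HolderConjugate p' p := hpp.symm
      have h1 : ‖∫ x, φ x * u x‖ₑ ≤
          eLpNorm (X.fat.test (2 ^ (-j)) φ) p' volume * eLpNorm u p volume := by
        rw [e1]
        exact enorm_integral_mul_le (SchwartzMap.memLp _ p' volume).1 hu.1
      have h3 : ‖((((2 : ℝ) ^ (-j)) ^ 2) ^ N : ℂ)‖ₑ ≤ two (j * σ) := by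
        have hj' : (0 : ℝ) ≤ j := by exact_mod_cast hj
        have e2 : ‖((((2 : ℝ) ^ (-j)) ^ 2) ^ N : ℂ)‖ₑ = two (j * (-(2 * N))) := by
          rw [← ofReal_norm, two]
          congr 1
          rw [norm_pow, norm_pow, ← Complex.ofReal_zpow, Complex.norm_real,
            Real.norm_of_nonneg (by positivity), ← Real.rpow_intCast, ← Real.rpow_natCast,
            ← Real.rpow_natCast, ← Real.rpow_mul two_pos.le, ← Real.rpow_mul two_pos.le]
          push_cast
          ring_nf
        rw [e2]
        refine two_mono (mul_le_mul_of_nonneg_left ?_ hj')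
        have := neg_abs_le σ
        have : (0 : ℝ) ≤ N := Nat.cast_nonneg N
        linarith
      have h4 : eLpNorm (X.fat.test (2 ^ (-j)) φ) p' volume ≤
          two (j * σ) * ((X.fatDiv N).bd * eLpNorm (lapTest N φ) p' volume) := by
        rw [X.test_fat_eq N]
        have : ⇑(((((2 : ℝ) ^ (-j)) ^ 2) ^ N : ℂ) • (X.fatDiv N).test (2 ^ (-j)) (lapTest N φ)) =
          ((((2 : ℝ) ^ (-j)) ^ 2) ^ N : ℂ) • ⇑((X.fatDiv N).test (2 ^ (-j)) (lapTest N φ)) := rfl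
        rw [this, eLpNorm_const_smul]
        exact mul_le_mul' h3 ((X.fatDiv N).eLpNorm_test_le hp'.le h2 _)
      calc _ ≤ two (j * σ) * ((X.fatDiv N).bd * eLpNorm (lapTest N φ) p' volume) *
            eLpNorm u p volume := h1.trans (by gcongr)
        _ = (two (j * σ) * eLpNorm u p volume) *
            ((X.fatDiv N).bd * eLpNorm (lapTest N φ) p' volume) := by ring
        _ ≤ _ := by gcongr; exact le_add_self

lemma IsLoc.cut_eq_zero (hp : 1 < p) (hpt : p ≠ ⊤) {l : ℤ} {u : Rd d → ℂ} (hu : MemLp u p volume)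
    (hl : X.IsLoc l u) {m : Profile d} {r : ℝ}
    (h : ∀ ξ, X.fat.sym (2 ^ (-l)) ξ ≠ 0 → m.sym r ξ ≠ 0 → False) : m.cut r u =ᵐ[volume] 0 := by
  have h1 := (hl.rel hp.le hu).comp (m.rel_cut (r := r) hp.le hu) (m.isSym_sym r)
  have h2 : Rel (fun _ : Rd d => 0) u 0 := fun g _ => by
    have : 𝓕⁻ (fun ξ : Rd d => (0 : ℂ) * g ξ) = 0 := by
      have h3 := fourierInv_const_mul 0 g
      rw [h3]; ext x; simp
    rw [this]
    simp
  refine Rel.unique hp hpt (m.memLp_cut hp.le hu) MemLp.zero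
    (h1.congr_sym fun ξ _ => ?_) h2
  by_contra hcon
  obtain ⟨h3, h4⟩ := mul_ne_zero_iff.1 hcon
  exact h ξ h3 h4

/-- A gap of three dyadic scales separates the annuli, as `8/3 < (3/8) · 8` and `16/3 < (3/4) · 8`.
-/
lemma IsLoc.ann_cut_eq_zero (hp : 1 < p) (hpt : p ≠ ⊤) {l m : ℤ} {u : Rd d → ℂ}
    (hu : MemLp u p volume) (hl : X.IsLoc l u) (h : m + 3 ≤ l ∨ l + 3 ≤ m) :
    X.ann.cut (2 ^ (-m)) u =ᵐ[volume] 0 := by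
  refine hl.cut_eq_zero hp hpt hu fun ξ h1 h2 => ?_
  have h3 := X.norm_of_fat_sym_ne_zero h1
  have h4 := X.norm_of_ann_sym_ne_zero h2
  have e8 : (2 : ℝ) ^ (3 : ℤ) = 8 := by norm_num
  have hm : (0 : ℝ) < 2 ^ m := by positivity
  have hl : (0 : ℝ) < 2 ^ l := by positivity
  rcases h with h | h
  · have h5 : (2 : ℝ) ^ (m + 3) ≤ 2 ^ l := zpow_le_zpow_right₀ one_le_two h
    rw [zpow_add₀ two_ne_zero, e8] at h5
    linarith
  · have h5 : (2 : ℝ) ^ (l + 3) ≤ 2 ^ m := zpow_le_zpow_right₀ one_le_two h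
    rw [zpow_add₀ two_ne_zero, e8] at h5
    linarith

lemma IsLoc.low_cut_eq_zero (hp : 1 < p) (hpt : p ≠ ⊤) {l m : ℤ} {u : Rd d → ℂ}
    (hu : MemLp u p volume) (hl : X.IsLoc l u) (h : m + 2 ≤ l) :
    X.low.cut (2 ^ (-m)) u =ᵐ[volume] 0 := by
  refine hl.cut_eq_zero hp hpt hu fun ξ h1 h2 => ?_
  have h3 := X.norm_of_fat_sym_ne_zero h1
  have h4 := X.norm_of_low_sym_ne_zero h2
  have e8 : (2 : ℝ) ^ (2 : ℤ) = 4 := by norm_num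
  have hm : (0 : ℝ) < 2 ^ m := by positivity
  have h5 : (2 : ℝ) ^ (m + 2) ≤ 2 ^ l := zpow_le_zpow_right₀ one_le_two h
  rw [zpow_add₀ two_ne_zero, e8] at h5
  linarith

lemma IsLoc.tsum_ann_cut_le (hp : 1 < p) (hpt : p ≠ ⊤) (σ : ℝ) {l : ℤ} {u : Rd d → ℂ}
    (hu : MemLp u p volume) (hl : X.IsLoc l u) :
    ∑' m : ℤ, two (m * σ) * eLpNorm (X.ann.cut (2 ^ (-m)) u) p volume ≤
      (5 * two (2 * |σ|) * X.ann.bd) * (two (l * σ) * eLpNorm u p volume) := by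
  rw [tsum_eq_sum (s := Finset.Icc (l - 2) (l + 2))]
  · have hterm : ∀ m ∈ Finset.Icc (l - 2) (l + 2),
        two (m * σ) * eLpNorm (X.ann.cut (2 ^ (-m)) u) p volume ≤
        (two (l * σ) * two (2 * |σ|)) * (X.ann.bd * eLpNorm u p volume) := fun m hm => by
      rw [Finset.mem_Icc] at hm
      gcongr
      · rw [← two_add]
        refine two_mono ?_
        have h1 : |(m : ℝ) - l| ≤ 2 := by
          rw [abs_le]
          have h3 : (l : ℝ) - 2 ≤ m := by exact_mod_cast hm.1
          have h4 : (m : ℝ) ≤ l + 2 := by exact_mod_cast hm.2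
          constructor <;> linarith
        have h2 : ((m : ℝ) - l) * σ ≤ 2 * |σ| := by
          calc ((m : ℝ) - l) * σ ≤ |((m : ℝ) - l) * σ| := le_abs_self _
            _ = |(m : ℝ) - l| * |σ| := abs_mul _ _
            _ ≤ 2 * |σ| := by gcongr
        linarith
      · exact X.ann.eLpNorm_cut_le hp.le hu.1
    refine (Finset.sum_le_sum hterm).trans_eq ?_
    rw [Finset.sum_const, Int.card_Icc, nsmul_eq_mul]
    have h8 : (l + 2 + 1 - (l - 2)).toNat = 5 := by omega
    rw [h8]
    push_cast
    ring
  · intro m hm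
    rw [Finset.mem_Icc, not_and_or, not_le, not_le] at hm
    rw [eLpNorm_congr_ae (hl.ann_cut_eq_zero hp hpt hu (by omega))]
    simp

/-- Summation of functions with spectra in annuli. -/
lemma exists_besov_sum (X : Cutoff d) (hp : 1 < p) (hpt : p ≠ ⊤) {σ : ℝ} (hσ : σ ≤ d / p.toReal) :
    ∃ C : ℝ≥0∞, C ≠ ⊤ ∧ ∀ {ι : Type} (b : ι → Rd d → ℂ) (l : ι → ℤ), (∀ i, MemLp (b i) p volume) →
      (∀ i, X.IsLoc (l i) (b i)) → ∑' i, two (l i * σ) * eLpNorm (b i) p volume ≠ ⊤ →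
      ∃ T : Tempered d, (∀ φ : 𝓢(Rd d, ℂ), HasSum (fun i => ∫ x, φ x * b i x) (T φ)) ∧
        X.MemSh T ∧
        ∑' m : ℤ, two (m * σ) * lebesgueNorm p (X.Delta m T) ≤
          C * ∑' i, two (l i * σ) * eLpNorm (b i) p volume ∧
        ∀ m : ℤ, ∃ W, MemLp W ⊤ volume ∧ Represents W (X.Delta m T) ∧
          ∀ ψ : Rd d → ℂ, MemLp ψ 1 volume →
            HasSum (fun i => ∫ x, ψ x * X.ann.cut (2 ^ (-m)) (b i) x) (∫ x, ψ x * W x) := by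
  obtain ⟨p', hpp, hp', hpt'⟩ := exists_holderConjugate hp hpt
  obtain ⟨Q, hQ, hQ0, hQb⟩ := exists_pairing_le X hp hpt hσ
  refine ⟨5 * two (2 * |σ|) * X.ann.bd, ENNReal.mul_ne_top (ENNReal.mul_ne_top (by simp)
    (two_ne_top _)) X.ann.bd_ne_top, fun {ι} b l hb hl hsum => ?_⟩
  set C := 5 * two (2 * |σ|) * X.ann.bd with hC
  have hCt : C ≠ ⊤ := ENNReal.mul_ne_top (ENNReal.mul_ne_top (by simp) (two_ne_top _))
    X.ann.bd_ne_top
  set β : ι → ℝ≥0∞ := fun i => two (l i * σ) * eLpNorm (b i) p volume with hβ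
  obtain ⟨T, hT⟩ := exists_tempered_sum (b := b) hsum (fun i φ => by
    have := integrable_mul_of_holder (q := p') (hb i) (φ.memLp p' volume)
    simpa only [mul_comm] using this) hQ hQ0 (fun i φ => hQb (l i) (b i) φ (hb i) (hl i))
  have hcut : ∀ (P : Profile d) (m : ℤ) (φ : 𝓢(Rd d, ℂ)),
      HasSum (fun i => ∫ x, φ x * P.cut (2 ^ (-m)) (b i) x) (T (P.test (2 ^ (-m)) φ)) :=
    fun P m φ => by
      have h := hT (P.test (2 ^ (-m)) φ)
      convert h using 2 with i
      have := P.integral_cut_mul hp.le (r := 2 ^ (-m)) (by positivity) (hb i) φ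
      simp only [mul_comm] at this ⊢
      exact this
  have hrep : ∀ (P : Profile d) (m : ℤ) (r r' : ℝ≥0∞) [ENNReal.HolderConjugate r r'],
      1 ≤ r → (∀ i, MemLp (P.cut (2 ^ (-m)) (b i)) r volume) →
      ∑' i, eLpNorm (P.cut (2 ^ (-m)) (b i)) r volume ≠ ⊤ →
      ∃ W, MemLp W r volume ∧
        eLpNorm W r volume ≤ ∑' i, eLpNorm (P.cut (2 ^ (-m)) (b i)) r volume ∧
        Represents W (multiplier (fun ξ => P.toFun ((2 : ℝ) ^ (-m) • ξ)) T) ∧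
        ∀ ψ, MemLp ψ r' volume →
          HasSum (fun i => ∫ x, ψ x * P.cut (2 ^ (-m)) (b i) x) (∫ x, ψ x * W x) :=
    fun P m r r' _ hr hm hs => by
      obtain ⟨W, hW, hWn, hWs⟩ := exists_sum_memLp (r' := r') hr hm hs
      refine ⟨W, hW, hWn, fun φ => ?_, hWs⟩
      rw [Profile.multiplier_apply]
      exact (hcut P m φ).unique (hWs φ (φ.memLp _ _))
  have hann : ∑' (m : ℤ) (i : ι), two (m * σ) * eLpNorm (X.ann.cut (2 ^ (-m)) (b i)) p volume ≤
      C * ∑' i, β i := by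
    rw [ENNReal.tsum_comm, ← ENNReal.tsum_mul_left]
    exact ENNReal.tsum_le_tsum fun i => (hl i).tsum_ann_cut_le hp hpt σ (hb i)
  have hannm : ∀ m : ℤ, ∑' i, eLpNorm (X.ann.cut (2 ^ (-m)) (b i)) p volume ≠ ⊤ := fun m => by
    have h1 := ENNReal.ne_top_of_tsum_ne_top
      (ne_top_of_le_ne_top (ENNReal.mul_ne_top hCt hsum) hann) m
    rw [ENNReal.tsum_mul_left] at h1
    intro h
    rw [h, ENNReal.mul_top (two_ne_zero' _)] at h1
    exact h1 rfl
  refine ⟨T, hT, ?_, ?_, fun m => ?_⟩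
  · set B := X.low.bd * X.fat.bern p with hB
    have hBt : B ≠ ⊤ := ENNReal.mul_ne_top X.low.bd_ne_top X.fat.bern_ne_top
    -- Membership in `S'_h`: only the terms with `l i ≤ m + 1` survive `S_m`. For `m ≤ -1` these
    -- have `l i ≤ 0`, so Bernstein's inequality and `σ ≤ d/p` bound their sup norms by `β i`, and
    -- the sum over them tends to zero as `m → -∞`.
    have hterm : ∀ m : ℤ, m ≤ -1 → ∀ i, eLpNorm (X.low.cut (2 ^ (-m)) (b i)) ⊤ volume ≤
        B * (if l i ≤ m + 1 then β i else 0) := fun m hm i => by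
      split_ifs with h
      · have hli : (l i : ℝ) ≤ 0 := by
          have : l i ≤ 0 := by omega
          exact_mod_cast this
        calc _ ≤ X.low.bd * (two (l i * (d / p.toReal)) * X.fat.bern p * eLpNorm (b i) p volume) := by
              refine (X.low.eLpNorm_cut_le le_top (hb i).1).trans ?_
              gcongr
              exact (hl i).eLpNorm_top_le hp.le hpt (hb i)
          _ ≤ X.low.bd * (two (l i * σ) * X.fat.bern p * eLpNorm (b i) p volume) := by
              gcongr
              exact two_mono (mul_le_mul_of_nonpos_left hσ hli)
          _ = _ := by rw [hB, hβ]; ring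
      · rw [eLpNorm_congr_ae ((hl i).low_cut_eq_zero hp hpt (hb i) (by omega))]
        simp
    have hle : ∀ m : ℤ, m ≤ -1 → lebesgueNorm ⊤ (X.S m T) ≤
        B * ∑' i, if l i ≤ m + 1 then β i else 0 := fun m hm => by
      have h1 : ∑' i, eLpNorm (X.low.cut (2 ^ (-m)) (b i)) ⊤ volume ≤
          B * ∑' i, if l i ≤ m + 1 then β i else 0 := by
        rw [← ENNReal.tsum_mul_left]
        exact ENNReal.tsum_le_tsum (hterm m hm)
      have h2 : B * (∑' i, if l i ≤ m + 1 then β i else 0) ≠ ⊤ := by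
        refine ENNReal.mul_ne_top hBt (ne_top_of_le_ne_top hsum (ENNReal.tsum_le_tsum fun i => ?_))
        split_ifs <;> simp [hβ]
      obtain ⟨W, hW, hWn, hWr, -⟩ := hrep X.low m ⊤ 1 le_top
        (fun i => X.low.memLp_cut_top hp.le hpt (by positivity) (hb i)) (ne_top_of_le_ne_top h2 h1)
      exact (lebesgueNorm_le hW hWr).trans (hWn.trans h1)
    have hlim := (tendsto_tsum_ite_atBot hsum l).comp
      (tendsto_atBot_add_const_right atBot (1 : ℤ) tendsto_id)
    have hlim2 := ENNReal.Tendsto.const_mul hlim (Or.inr hBt)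
    rw [mul_zero] at hlim2
    refine tendsto_of_tendsto_of_tendsto_of_le_of_le' tendsto_const_nhds hlim2
      (Eventually.of_forall fun _ => zero_le) ?_
    filter_upwards [eventually_le_atBot (-1 : ℤ)] with m hm
    exact hle m hm
  · refine le_trans (ENNReal.tsum_le_tsum fun m => ?_) hann
    rw [ENNReal.tsum_mul_left]
    gcongr
    obtain ⟨W, hW, hWn, hWr, -⟩ := hrep X.ann m p p' hp.le (fun i => X.ann.memLp_cut hp.le (hb i))
      (hannm m)
    exact (lebesgueNorm_le hW hWr).trans hWn
  · have h1 : ∑' i, eLpNorm (X.ann.cut (2 ^ (-m)) (b i)) ⊤ volume ≠ ⊤ := by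
      refine ne_top_of_le_ne_top (ENNReal.mul_ne_top (ENNReal.mul_ne_top
        (two_ne_top (m * (d / p.toReal))) (X.fat.bern_ne_top (p := p))) (hannm m)) ?_
      rw [← ENNReal.tsum_mul_left]
      exact ENNReal.tsum_le_tsum fun i => (isLoc_ann_cut hp hpt (hb i)).eLpNorm_top_le hp.le hpt
        (X.ann.memLp_cut hp.le (hb i))
    obtain ⟨W, hW, -, hWr, hWs⟩ := hrep X.ann m ⊤ 1 le_top
      (fun i => X.ann.memLp_cut_top hp.le hpt (by positivity) (hb i)) h1
    exact ⟨W, hW, hWr, hWs⟩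

end Cutoff

/-! ### Reconstruction of distributions and functions from their blocks. -/

lemma Represents.add {p q : ℝ≥0∞} (hp : 1 ≤ p) (hq : 1 ≤ q) {u v : Rd d → ℂ} {T T' : Tempered d}
    (hu : MemLp u p volume) (hv : MemLp v q volume) (h : Represents u T) (h' : Represents v T') :
    Represents (fun x => u x + v x) (T + T') := fun φ => by
  have : p.conjExponent.HolderConjugate p := (ENNReal.HolderConjugate.conjExponent hp).symm
  have : q.conjExponent.HolderConjugate q := (ENNReal.HolderConjugate.conjExponent hq).symm
  have i1 := integrable_mul_of_holder (p := p.conjExponent) (φ.memLp _ volume) hu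
  have i2 := integrable_mul_of_holder (p := q.conjExponent) (φ.memLp _ volume) hv
  change T φ + T' φ = _
  rw [h, h', ← integral_add i1 i2]
  simp only [mul_add]

lemma Represents.const_mul {u : Rd d → ℂ} {T : Tempered d} (h : Represents u T) (c : ℂ) :
    Represents (fun x => c * u x) (c • T) := fun φ => by
  change c * T φ = _
  rw [h, ← integral_const_mul]
  exact integral_congr_ae (Eventually.of_forall fun x => by ring)

lemma Represents.sum {ι : Type*} (s : Finset ι) {p : ℝ≥0∞} (hp : 1 ≤ p) {u : ι → Rd d → ℂ}
    {T : ι → Tempered d} (hu : ∀ i ∈ s, MemLp (u i) p volume)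
    (h : ∀ i ∈ s, Represents (u i) (T i)) :
    Represents (fun x => ∑ i ∈ s, u i x) (∑ i ∈ s, T i) := by
  classical
  induction s using Finset.induction_on with
  | empty => intro φ; simp
  | insert i s hi ih =>
    simp only [Finset.sum_insert hi]
    exact Represents.add hp hp (hu i (by simp)) (memLp_finsetSum s fun k hk => hu k (by simp [hk]))
      (h i (by simp)) (ih (fun k hk => hu k (by simp [hk])) fun k hk => h k (by simp [hk]))

lemma Represents.sub {p q : ℝ≥0∞} (hp : 1 ≤ p) (hq : 1 ≤ q) {u v : Rd d → ℂ} {T T' : Tempered d}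
    (hu : MemLp u p volume) (hv : MemLp v q volume) (h : Represents u T) (h' : Represents v T') :
    Represents (fun x => u x - v x) (T - T') := by
  have h1 := h.add hp hq hu (hv.const_mul (-1)) (h'.const_mul (-1))
  have h2 : T + (-1 : ℂ) • T' = T - T' := by module
  rw [h2] at h1
  simpa [sub_eq_add_neg] using h1

lemma tendsto_integral_mul_schwartz {p q : ℝ≥0∞} [p.HolderConjugate q] {w : Rd d → ℂ}
    (hw : MemLp w p volume) {φ : ℕ → 𝓢(Rd d, ℂ)} {ψ : 𝓢(Rd d, ℂ)}
    (h : Tendsto φ atTop (𝓝 ψ)) :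
    Tendsto (fun n => ∫ x, w x * φ n x) atTop (𝓝 (∫ x, w x * ψ x)) := by
  have : q.HolderConjugate p := ENNReal.HolderConjugate.symm
  have hq : 1 ≤ q := ENNReal.HolderConjugate.one_le q p
  have h0 : Tendsto (fun n => φ n - ψ) atTop (𝓝 0) := by
    simpa using h.sub_const ψ
  have h1 : Tendsto (fun n => eLpNorm (⇑(φ n - ψ)) q volume) atTop (𝓝 0) :=
    (tendsto_eLpNorm_zero hq).comp h0
  exact tendsto_integral_mul_of_eLpNorm (p := p) (q := q) (φ := fun n => ⇑(φ n)) (ψ := ⇑ψ) hw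
    (fun n => (φ n).memLp q volume) (ψ.memLp q volume) h1

namespace Cutoff

variable (X : Cutoff d)

lemma low_test_succ (j : ℤ) (φ : 𝓢(Rd d, ℂ)) :
    X.low.test (2 ^ (-(j + 1))) φ = X.low.test (2 ^ (-j)) φ + X.ann.test (2 ^ (-j)) φ := by
  have h1 : (2 : ℝ) ^ (-j) ≠ 0 := by positivity
  have h2 : (2 : ℝ) ^ (-(j + 1)) ≠ 0 := by positivity
  have hs : X.low.sym (2 ^ (-(j + 1))) = X.low.sym (2 ^ (-j)) + X.ann.sym (2 ^ (-j)) := by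
    ext ξ
    have h3 : (2 : ℝ) ^ (-(j + 1)) = 2⁻¹ * 2 ^ (-j) := by
      rw [neg_add, zpow_add₀ two_ne_zero, mul_comm]; simp
    change ((X.χ _ : ℝ) : ℂ) = ((X.χ _ : ℝ) : ℂ) + ((X.χ _ - X.χ _ : ℝ) : ℂ)
    rw [h3, mul_smul]
    push_cast
    ring
  simp only [Profile.test, ContinuousLinearMap.comp_apply, FourierTransform.fourierCLM_apply,
    FourierTransform.fourierInvCLM_apply]
  rw [hs, SchwartzMap.smulLeftCLM_add (X.low.hasTemperateGrowth_sym h1)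
    (X.ann.hasTemperateGrowth_sym h1), ← FourierTransform.fourier_add]
  rfl

lemma S_succ (j : ℤ) (T : Tempered d) : X.S (j + 1) T = X.S j T + X.Delta j T := by
  ext φ
  change X.S (j + 1) T φ = X.S j T φ + X.Delta j T φ
  rw [S_apply, S_apply, Delta_apply, low_test_succ, map_add]

lemma sum_Ico_succ_int {M : Type*} [AddCommMonoid M] (f : ℤ → M) {m n : ℤ} (h : m ≤ n) :
    ∑ j ∈ Finset.Ico m (n + 1), f j = ∑ j ∈ Finset.Ico m n, f j + f n := by
  have : Finset.Ico m (n + 1) = insert n (Finset.Ico m n) := by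
    ext j; simp only [Finset.mem_Ico, Finset.mem_insert]; omega
  rw [this, Finset.sum_insert (by simp), add_comm]

lemma S_eq_add_sum {m n : ℤ} (h : m ≤ n) (T : Tempered d) :
    X.S n T = X.S m T + ∑ j ∈ Finset.Ico m n, X.Delta j T := by
  induction n, h using Int.leInduction with
  | base => simp
  | succ n hn ih => rw [S_succ, ih, sum_Ico_succ_int _ hn, add_assoc]

variable {X}

/-- The low frequency cut-offs of a distribution in `S'_h` whose blocks are bounded functions. -/
lemma MemSh.exists_represents_S {T : Tempered d} (hT : X.MemSh T) {u : ℤ → Rd d → ℂ}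
    (hu : ∀ j, MemLp (u j) ⊤ volume) (hr : ∀ j, Represents (u j) (X.Delta j T)) (n : ℤ) :
    ∃ U, MemLp U ⊤ volume ∧ Represents U (X.S n T) ∧
      (∀ m ≤ n, eLpNorm (fun x => U x - ∑ j ∈ Finset.Ico m n, u j x) ⊤ volume =
        lebesgueNorm ⊤ (X.S m T)) := by
  -- By `S'_h` some low-frequency part is a bounded function, to which finitely many bounded blocks
  -- are added to reach `S_n T`.
  obtain ⟨m₀, hm₀, hmn⟩ := ((hT.eventually_lt_const (u := ⊤) (by simp)).and
    (eventually_le_atBot n)).exists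
  obtain ⟨E, hE, hEr⟩ := exists_represents_of_lebesgueNorm_lt_top hm₀
  have hsum : ∀ m : ℤ, MemLp (fun x => ∑ j ∈ Finset.Ico m n, u j x) ⊤ volume := fun m =>
    memLp_finsetSum _ fun j _ => hu j
  have hsr : ∀ m : ℤ, Represents (fun x => ∑ j ∈ Finset.Ico m n, u j x)
      (∑ j ∈ Finset.Ico m n, X.Delta j T) := fun m =>
    Represents.sum _ le_top (fun j _ => hu j) fun j _ => hr j
  have hU : MemLp (fun x => E x + ∑ j ∈ Finset.Ico m₀ n, u j x) ⊤ volume := hE.add (hsum m₀)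
  have hUr : Represents (fun x => E x + ∑ j ∈ Finset.Ico m₀ n, u j x) (X.S n T) := by
    rw [X.S_eq_add_sum hmn]
    exact hEr.add le_top le_top hE (hsum m₀) (hsr m₀)
  refine ⟨_, hU, hUr, fun m hm => ?_⟩
  have h1 := hUr.sub le_top le_top hU (hsum m) (hsr m)
  rw [X.S_eq_add_sum hm, add_sub_cancel_right] at h1
  exact (lebesgueNorm_eq le_top (hU.sub (hsum m)) h1).symm

/-- An `L^p` function is the sum of its blocks. -/
lemma hasSum_integral_ann_cut (hd : 1 ≤ d) {p : ℝ≥0∞} (hp : 1 < p) (hpt : p ≠ ⊤)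
    {w : Rd d → ℂ} (hw : MemLp w p volume) (φ : 𝓢(Rd d, ℂ))
    (hs : Summable fun m : ℤ => ∫ x, φ x * X.ann.cut (2 ^ (-m)) w x) :
    HasSum (fun m : ℤ => ∫ x, φ x * X.ann.cut (2 ^ (-m)) w x) (∫ x, φ x * w x) := by
  obtain ⟨p', hpp, hp', hpt'⟩ := exists_holderConjugate hp hpt
  have hpp' : ENNReal.HolderConjugate p' p := hpp.symm
  have : Fact (1 ≤ p') := ⟨hp'.le⟩
  have hcut : ∀ (P : Profile d) (m : ℤ),
      ∫ x, φ x * P.cut (2 ^ (-m)) w x = ∫ x, w x * P.test (2 ^ (-m)) φ x := fun P m => by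
    rw [← P.integral_cut_mul hp.le (by positivity) hw]
    simp only [mul_comm]
  have hint : ∀ ψ : 𝓢(Rd d, ℂ), Integrable fun x => w x * ψ x := fun ψ =>
    integrable_mul_of_holder (q := p') hw (ψ.memLp p' volume)
  have htel : ∀ n : ℕ, ∑ m ∈ Finset.Ico (-(n : ℤ)) n, ∫ x, φ x * X.ann.cut (2 ^ (-m)) w x =
      (∫ x, w x * X.low.test (2 ^ (-(n : ℤ))) φ x) -
        ∫ x, w x * X.low.test (2 ^ (-(-(n : ℤ)))) φ x := fun n => by
    have h : ∀ (a b : ℤ), a ≤ b → ∑ m ∈ Finset.Ico a b, ∫ x, φ x * X.ann.cut (2 ^ (-m)) w x =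
        (∫ x, w x * X.low.test (2 ^ (-b)) φ x) - ∫ x, w x * X.low.test (2 ^ (-a)) φ x := by
      intro a b hab
      induction b, hab using Int.leInduction with
      | base => simp
      | succ b hb ih =>
        rw [sum_Ico_succ_int _ hb, ih, hcut, low_test_succ]
        have e : ∫ x, w x * (X.low.test (2 ^ (-b)) φ + X.ann.test (2 ^ (-b)) φ) x =
            (∫ x, w x * X.low.test (2 ^ (-b)) φ x) + ∫ x, w x * X.ann.test (2 ^ (-b)) φ x := by
          rw [← integral_add (hint _) (hint _)]
          exact integral_congr_ae (Eventually.of_forall fun x => mul_add _ _ _)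
        rw [e]; ring
    exact h _ _ (by omega)
  have hlim1 : Tendsto (fun n : ℕ => ∫ x, w x * X.low.test (2 ^ (-(n : ℤ))) φ x) atTop
      (𝓝 (∫ x, w x * φ x)) := by
    exact tendsto_integral_mul_schwartz (q := p') hw (tendsto_test_low X φ)
  have hlim2 : Tendsto (fun n : ℕ => ∫ x, w x * X.low.test (2 ^ (-(-(n : ℤ)))) φ x) atTop
      (𝓝 0) := by
    rw [tendsto_zero_iff_enorm_tendsto_zero]
    -- Here `d ≥ 1` matters: the low-frequency part `S_{-n} w` has sup norm of order `2^(-nd/p)`,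
    -- which must decay.
    have hd' : (0 : ℝ) < d / p.toReal := by
      have : 0 < p.toReal := ENNReal.toReal_pos (zero_lt_one.trans hp).ne' hpt
      have : (0 : ℝ) < d := by exact_mod_cast hd
      positivity
    set A : ℝ≥0∞ := eLpNorm φ 1 volume * (X.low.bern p * eLpNorm w p volume) with hA
    have hAt : A ≠ ⊤ := ENNReal.mul_ne_top (φ.memLp 1 volume).2.ne
      (ENNReal.mul_ne_top X.low.bern_ne_top hw.2.ne)
    have hb : ∀ n : ℕ, ‖∫ x, w x * X.low.test (2 ^ (-(-(n : ℤ)))) φ x‖ₑ ≤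
        A * (two (-(d / p.toReal))) ^ n := fun n => by
      rw [← hcut]
      have h1 : ‖∫ x, φ x * X.low.cut (2 ^ (-(-(n : ℤ)))) w x‖ₑ ≤ eLpNorm φ 1 volume *
          eLpNorm (X.low.cut (2 ^ (-(-(n : ℤ)))) w) ⊤ volume :=
        enorm_integral_mul_le (φ.memLp 1 volume).1 (X.low.memLp_cut hp.le hw).1
      refine h1.trans ?_
      calc _ ≤ eLpNorm φ 1 volume * (ENNReal.ofReal (((2 : ℝ) ^ (-(-(n : ℤ)))) ^ (-(d / p.toReal))) *
            X.low.bern p * eLpNorm w p volume) := by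
            gcongr
            exact X.low.eLpNorm_cut_top_le hp.le hpt (by positivity) hw
        _ = _ := by
            rw [ofReal_zpow_rpow, ← ENNReal.rpow_natCast, two_rpow, hA]
            have : ((-(n : ℤ) : ℤ) : ℝ) * (d / p.toReal) = -(d / p.toReal) * n := by
              push_cast; ring
            rw [this]
            ring
    refine tendsto_of_tendsto_of_tendsto_of_le_of_le tendsto_const_nhds
      (h := fun n : ℕ => A * (two (-(d / p.toReal))) ^ n) ?_ (fun _ => zero_le) hb
    simpa using ENNReal.Tendsto.const_mul
      (ENNReal.tendsto_pow_atTop_nhds_zero_of_lt_one (two_lt_one (by linarith))) (Or.inr hAt)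
  have hlim := hlim1.sub hlim2
  rw [sub_zero] at hlim
  have hIco : Tendsto (fun n : ℕ => Finset.Ico (-(n : ℤ)) n) atTop atTop := by
    refine tendsto_atTop_finset_of_monotone (fun a b hab => ?_) fun m => ⟨m.natAbs + 1, ?_⟩
    · exact Finset.Ico_subset_Ico (by omega) (by omega)
    · rw [Finset.mem_Ico]; omega
  have h1 := (hs.hasSum).comp hIco
  have h2 := tendsto_nhds_unique h1 (hlim.congr fun n => (htel n).symm)
  have h3 := hs.hasSum
  rw [h2] at h3
  simpa only [mul_comm] using h3

end Cutoff

/-! ### Gevrey variables, products of distributions and the product estimate. -/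

lemma Profile.cut_expAvg (m : Profile d) {p : ℝ≥0∞} (hp : 1 < p) (hpt : p ≠ ⊤) {a : ℝ} (ha : 0 ≤ a)
    (r : ℝ) {u : Rd d → ℂ} (hu : MemLp u p volume) :
    m.cut r (expAvg a u) =ᵐ[volume] expAvg a (m.cut r u) :=
  Rel.unique hp hpt (m.memLp_cut hp.le (memLp_expAvg hp.le a hu))
    (memLp_expAvg hp.le a (m.memLp_cut hp.le hu))
    (m.rel_cut_cut hp.le (isSym_expSym ha) hu (memLp_expAvg hp.le a hu)
      (Rel.of_expAvg hp.le ha hu))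
    (Rel.of_expAvg hp.le ha (m.memLp_cut hp.le hu))

lemma tendsto_integral_mul_mul_top {ι : Type*} {l : Filter ι} {φ U V : Rd d → ℂ}
    (hφ : MemLp φ 1 volume) (hU : MemLp U ⊤ volume) (hV : MemLp V ⊤ volume) {A B : ι → Rd d → ℂ}
    (hA : ∀ i, MemLp (A i) ⊤ volume) (hB : ∀ i, MemLp (B i) ⊤ volume)
    (h : Tendsto (fun i => eLpNorm (fun x => U x - A i x) ⊤ volume) l (𝓝 0))
    (h' : Tendsto (fun i => eLpNorm (fun x => V x - B i x) ⊤ volume) l (𝓝 0)) :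
    Tendsto (fun i => ∫ x, φ x * (A i x * B i x)) l (𝓝 (∫ x, φ x * (U x * V x))) := by
  have hUV : MemLp (fun x => U x * V x) ⊤ volume := memLp_mul_top hU hV
  have hAB : ∀ i, MemLp (fun x => A i x * B i x) ⊤ volume := fun i =>
    memLp_mul_top (hA i) (hB i)
  rw [tendsto_iff_edist_tendsto_0]
  set e : ι → ℝ≥0∞ := fun i => eLpNorm (fun x => U x - A i x) ⊤ volume with he
  set e' : ι → ℝ≥0∞ := fun i => eLpNorm (fun x => V x - B i x) ⊤ volume with he'
  have hb : ∀ i, edist (∫ x, φ x * (A i x * B i x)) (∫ x, φ x * (U x * V x)) ≤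
      eLpNorm φ 1 volume * (e i * eLpNorm V ⊤ volume +
        (eLpNorm U ⊤ volume + e i) * e' i) := fun i => by
    have hUA : MemLp (fun x => U x - A i x) ⊤ volume := hU.sub (hA i)
    have hVB : MemLp (fun x => V x - B i x) ⊤ volume := hV.sub (hB i)
    have hD : MemLp (fun x => U x * V x - A i x * B i x) ⊤ volume := hUV.sub (hAB i)
    have h1 : (∫ x, φ x * (U x * V x)) - ∫ x, φ x * (A i x * B i x) =
        ∫ x, φ x * (U x * V x - A i x * B i x) := by
      rw [← integral_sub (integrable_mul_of_holder (q := ⊤) hφ hUV)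
        (integrable_mul_of_holder (q := ⊤) hφ (hAB i))]
      simp only [mul_sub]
    rw [edist_comm, edist_eq_enorm_sub, h1]
    refine (enorm_integral_mul_le (p := 1) (q := ⊤) hφ.1 hD.1).trans ?_
    gcongr
    have h2 : (fun x => U x * V x - A i x * B i x) =
        (fun x => (U x - A i x) * V x) + fun x => A i x * (V x - B i x) := by
      ext x; simp only [Pi.add_apply]; ring
    rw [h2]
    refine (eLpNorm_add_le (memLp_mul_top hUA hV).1 (memLp_mul_top (hA i) hVB).1
      le_top).trans (add_le_add (eLpNorm_mul_le_top hUA.1) ?_)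
    refine (eLpNorm_mul_le_top (hA i).1).trans ?_
    gcongr
    have h3 : A i = U - fun x => U x - A i x := by
      ext x; simp only [Pi.sub_apply]; ring
    calc eLpNorm (A i) ⊤ volume = eLpNorm (U - fun x => U x - A i x) ⊤ volume := by rw [← h3]
      _ ≤ _ := eLpNorm_sub_le hU.1 hUA.1 le_top
  refine tendsto_of_tendsto_of_tendsto_of_le_of_le tendsto_const_nhds ?_ (fun _ => zero_le) hb
  have h1 : Tendsto (fun i => e i * eLpNorm V ⊤ volume) l (𝓝 0) := by
    simpa using ENNReal.Tendsto.mul_const h (Or.inr hV.2.ne)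
  have h2 : Tendsto (fun i => (eLpNorm U ⊤ volume + e i) * e' i) l (𝓝 0) := by
    have h3 : Tendsto (fun i => eLpNorm U ⊤ volume + e i) l (𝓝 (eLpNorm U ⊤ volume)) := by
      simpa using h.const_add (eLpNorm U ⊤ volume)
    simpa using ENNReal.Tendsto.mul h3 (Or.inr ENNReal.zero_ne_top) h' (Or.inr hU.2.ne)
  simpa using ENNReal.Tendsto.const_mul (h1.add h2) (Or.inr hφ.2.ne)

namespace Cutoff

variable {X : Cutoff d}

lemma IsLoc.isLoc_expAvg {p : ℝ≥0∞} (hp : 1 < p) (hpt : p ≠ ⊤) {a : ℝ} (ha : 0 ≤ a) {j : ℤ}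
    {u : Rd d → ℂ} (hu : MemLp u p volume) (h : X.IsLoc j u) : X.IsLoc j (expAvg a u) :=
  IsLoc.of_rel hp hpt hu (memLp_expAvg hp.le a hu) h (isSym_expSym ha) (Rel.of_expAvg hp.le ha hu)

/-- The dyadic blocks of `F = e^{a Λ₁} f`, for `F` in a Besov space. -/
lemma IsExp.exists_blocks {a : ℝ} (ha : 0 ≤ a) {f F : Tempered d} (he : X.IsExp a f F) {s p : ℝ}
    (hp : 1 < p) (hF : X.besovNorm s p F < ⊤) :
    ∃ u : ℤ → Rd d → ℂ, (∀ j, MemLp (u j) (ENNReal.ofReal p) volume) ∧ (∀ j, X.IsLoc j (u j)) ∧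
      (∀ j, Represents (u j) (X.Delta j F)) ∧ (∀ j, Represents (expAvg a (u j)) (X.Delta j f)) ∧
      ∑' j : ℤ, two (j * s) * eLpNorm (u j) (ENNReal.ofReal p) volume = X.besovNorm s p F := by
  have hP : 1 < ENNReal.ofReal p := by simpa using hp
  have h : ∀ j : ℤ, lebesgueNorm (ENNReal.ofReal p) (X.Delta j F) < ⊤ := fun j =>
    ENNReal.lt_top_of_mul_ne_top_right ((ENNReal.le_tsum (f := fun j : ℤ => two (j * s) *
      lebesgueNorm (ENNReal.ofReal p) (X.Delta j F)) j).trans_lt hF).ne (two_ne_zero' _)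
  choose u hu hur using fun j => exists_represents_of_lebesgueNorm_lt_top (h j)
  refine ⟨u, hu, fun j => X.isLoc_of_represents_Delta hP.le (hu j) (hur j), hur, fun j φ => ?_, ?_⟩
  · obtain ⟨v, hv, hvr, hvf⟩ := he.2.2 j
    have huv : v =ᵐ[volume] u j := Represents.ae_eq le_top hP.le hv (hu j) hvr (hur j)
    have hc : (ENNReal.ofReal p).conjExponent.HolderConjugate (ENNReal.ofReal p) :=
      (ENNReal.HolderConjugate.conjExponent hP.le).symm
    rw [hvf, expNegTest_eq ha, integral_congr_ae (huv.mono fun x hx => by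
      simp only [hx] : _ =ᵐ[volume] fun x => expAvg a φ x * u j x),
      integral_expAvg_mul a (φ.memLp (ENNReal.ofReal p).conjExponent volume) (hu j)]
  · exact tsum_congr fun j => by rw [← lebesgueNorm_eq hP.le (hu j) (hur j)]; rfl

/-- A family of localized functions, summable in a Besov space, and the family of its images under
`e^{-a Λ₁}` have sums `H` and `h` with `H = e^{a Λ₁} h`. -/
lemma exists_isExp_sum (X : Cutoff d) {p : ℝ≥0∞} (hp : 1 < p) (hpt : p ≠ ⊤) {σ : ℝ}
    (hσ : σ ≤ d / p.toReal) :
    ∃ C : ℝ≥0∞, C ≠ ⊤ ∧ ∀ {a : ℝ}, 0 ≤ a → ∀ {ι : Type} (b : ι → Rd d → ℂ) (l : ι → ℤ),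
      (∀ i, MemLp (b i) p volume) → (∀ i, X.IsLoc (l i) (b i)) →
      ∑' i, two (l i * σ) * eLpNorm (b i) p volume ≠ ⊤ →
      ∃ h H : Tempered d,
        (∀ φ : 𝓢(Rd d, ℂ), HasSum (fun i => ∫ x, φ x * expAvg a (b i) x) (h φ)) ∧
        (∀ φ : 𝓢(Rd d, ℂ), HasSum (fun i => ∫ x, φ x * b i x) (H φ)) ∧
        X.IsExp a h H ∧
        ∑' m : ℤ, two (m * σ) * lebesgueNorm p (X.Delta m H) ≤
          C * ∑' i, two (l i * σ) * eLpNorm (b i) p volume := by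
  obtain ⟨C, hC, hsum⟩ := exists_besov_sum X hp hpt hσ
  refine ⟨C, hC, fun {a} ha {ι} b l hb hl hs => ?_⟩
  obtain ⟨H, hH, hHs, hHn, hHb⟩ := hsum b l hb hl hs
  obtain ⟨h, hh, hhs, -, hhb⟩ := hsum (fun i => expAvg a (b i)) l
    (fun i => memLp_expAvg hp.le a (hb i)) (fun i => (hl i).isLoc_expAvg hp hpt ha (hb i))
    (ne_top_of_le_ne_top hs (ENNReal.tsum_le_tsum fun i => by
      gcongr
      exact eLpNorm_expAvg_le hp.le a (hb i).1))
  refine ⟨h, H, hh, hH, ⟨hhs, hHs, fun m => ?_⟩, hHn⟩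
  obtain ⟨W, hW, hWr, hWs⟩ := hHb m
  obtain ⟨W', hW', hWr', hWs'⟩ := hhb m
  refine ⟨W, hW, hWr, fun φ => ?_⟩
  rw [hWr', expNegTest_eq ha]
  refine (hWs' φ (φ.memLp 1 volume)).unique ?_
  convert hWs (expAvg a φ) (memLp_expAvg le_rfl a (φ.memLp 1 volume)) using 2 with i
  have hc : p.conjExponent.HolderConjugate p := (ENNReal.HolderConjugate.conjExponent hp.le).symm
  rw [integral_expAvg_mul a (φ.memLp p.conjExponent volume) (X.ann.memLp_cut hp.le (hb i))]
  exact integral_congr_ae ((X.ann.cut_expAvg hp hpt ha (2 ^ (-m)) (hb i)).mono fun x hx => by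
    simp only [hx])

/-- The product of two distributions of `S'_h` is the sum of the products of their blocks. -/
lemma isProduct_of_hasSum {f g h : Tempered d} (hf : X.MemSh f) (hg : X.MemSh g)
    {u v : ℤ → Rd d → ℂ} (hu : ∀ j, MemLp (u j) ⊤ volume) (hv : ∀ j, MemLp (v j) ⊤ volume)
    (hur : ∀ j, Represents (u j) (X.Delta j f)) (hvr : ∀ j, Represents (v j) (X.Delta j g))
    (hs : ∀ φ : 𝓢(Rd d, ℂ),
      HasSum (fun i : ℤ × ℤ => ∫ x, φ x * (u i.1 x * v i.2 x)) (h φ)) :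
    X.IsProduct f g h := by
  choose U hU hUr hUs using fun n : ℕ => hf.exists_represents_S hu hur n
  choose V hV hVr hVs using fun n : ℕ => hg.exists_represents_S hv hvr n
  refine ⟨U, V, fun n => ⟨hU n, hUr n⟩, fun n => ⟨hV n, hVr n⟩, fun φ => ?_⟩
  set θ : ℤ × ℤ → ℂ := fun i => ∫ x, φ x * (u i.1 x * v i.2 x) with hθ
  have hlim : ∀ n : ℕ, Tendsto (fun m : ℤ => ∑ i ∈ Finset.Ico m (n : ℤ) ×ˢ Finset.Ico m (n : ℤ), θ i)
      atBot (𝓝 (∫ x, φ x * (U n x * V n x))) := fun n => by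
    have h1 : Tendsto (fun m : ℤ => eLpNorm (fun x => U n x - ∑ j ∈ Finset.Ico m (n : ℤ), u j x) ⊤
        volume) atBot (𝓝 0) :=
      hf.congr' ((eventually_le_atBot (n : ℤ)).mono fun m hm => (hUs n m hm).symm)
    have h2 : Tendsto (fun m : ℤ => eLpNorm (fun x => V n x - ∑ j ∈ Finset.Ico m (n : ℤ), v j x) ⊤
        volume) atBot (𝓝 0) :=
      hg.congr' ((eventually_le_atBot (n : ℤ)).mono fun m hm => (hVs n m hm).symm)
    refine (tendsto_integral_mul_mul_top (φ.memLp 1 volume) (hU n) (hV n)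
      (fun m => memLp_finsetSum _ fun j _ => hu j) (fun m => memLp_finsetSum _ fun j _ => hv j)
      h1 h2).congr fun m => ?_
    rw [hθ, ← integral_finsetSum _ fun i _ => integrable_mul_of_holder (p := 1) (q := ⊤)
      (φ.memLp 1 volume) (memLp_mul_top (hu i.1) (hv i.2))]
    refine integral_congr_ae (Eventually.of_forall fun x => ?_)
    simp only [Finset.sum_mul_sum (Finset.Ico m (n : ℤ)), ← Finset.sum_product', Finset.mul_sum]
  -- For each `n` a lower end `m n ≤ -n` is chosen for which the finite square sum is within
  -- `1/(n+1)` of the pairing with `S_n f S_n g`. The squares exhaust `ℤ × ℤ`, so unconditional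
  -- convergence of the double series gives the limit.
  have hM : ∀ n : ℕ, ∃ m : ℤ, m ≤ -n ∧
      dist (∑ i ∈ Finset.Ico m (n : ℤ) ×ˢ Finset.Ico m (n : ℤ), θ i)
        (∫ x, φ x * (U n x * V n x)) < 1 / ((n : ℝ) + 1) := fun n =>
    ((eventually_le_atBot (-(n : ℤ))).and
      (Metric.tendsto_nhds.1 (hlim n) _ (by positivity))).exists
  choose m hmn hm using hM
  have hF : Tendsto (fun n : ℕ => Finset.Ico (m n) (n : ℤ) ×ˢ Finset.Ico (m n) (n : ℤ)) atTop atTop := by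
    refine tendsto_atTop.2 fun s => ?_
    have hmem : ∀ i : ℤ × ℤ, ∀ᶠ n : ℕ in atTop,
        i ∈ Finset.Ico (m n) (n : ℤ) ×ˢ Finset.Ico (m n) (n : ℤ) := fun i => by
      filter_upwards [eventually_ge_atTop (i.1.natAbs + i.2.natAbs + 1)] with n hn
      have := hmn n
      simp only [Finset.mem_product, Finset.mem_Ico]
      omega
    exact (s.eventually_all.2 fun i _ => hmem i).mono fun n hn => hn
  have h1 := (hs φ).comp hF
  have h2 : Tendsto (fun n : ℕ => dist (∑ i ∈ Finset.Ico (m n) (n : ℤ) ×ˢ Finset.Ico (m n) (n : ℤ), θ i)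
      (∫ x, φ x * (U n x * V n x))) atTop (𝓝 0) :=
    squeeze_zero (fun _ => dist_nonneg) (fun n => (hm n).le) tendsto_one_div_add_atTop_nhds_zero_nat
  exact (tendsto_iff_of_dist h2).1 h1

lemma two_mul_loss {p : ℝ} (hp : 1 < p) :
    2 * loss d (ENNReal.ofReal p) = d * max 0 (2 / p - 1) := by
  have hp0 : 0 < p := by linarith
  have h1 : (expTwo (ENNReal.ofReal p)).toReal = max 2 p := by
    rw [expTwo, ENNReal.toReal_max (by simp) ENNReal.ofReal_ne_top, ENNReal.toReal_ofReal hp0.le]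
    simp
  rw [loss, h1, ENNReal.toReal_ofReal hp0.le]
  rcases le_total 2 p with h | h
  · have : 2 / p - 1 ≤ 0 := by rw [sub_nonpos, div_le_one hp0]; exact h
    rw [max_eq_right h, max_eq_left this]
    ring
  · have : 0 ≤ 2 / p - 1 := by rw [sub_nonneg, one_le_div hp0]; exact h
    rw [max_eq_left h, max_eq_right this]
    ring

/-- The product estimate in the Gevrey versions of Besov spaces. -/
theorem exists_product_estimate (hd : 1 ≤ d) (X : Cutoff d) {p : ℝ} (hp : 1 < p) {s₁ s₂ : ℝ}
    (h1 : s₁ ≤ d / p) (h2 : s₂ ≤ d / p) (hs : d * max 0 (2 / p - 1) < s₁ + s₂) :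
    ∃ C : ℝ≥0, ∀ a : ℝ, 0 ≤ a → ∀ f g F G : Tempered d, X.IsExp a f F → X.IsExp a g G →
      X.MemBesov s₁ p F → X.MemBesov s₂ p G →
      ∃ h H : Tempered d, X.IsProduct f g h ∧ X.IsExp a h H ∧
        X.MemBesov (s₁ + s₂ - d / p) p H ∧
        X.besovNorm (s₁ + s₂ - d / p) p H ≤ C * X.besovNorm s₁ p F * X.besovNorm s₂ p G := by
  have hP : 1 < ENNReal.ofReal p := by simpa using hp
  have hPt : ENNReal.ofReal p ≠ ⊤ := ENNReal.ofReal_ne_top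
  have hPr : (ENNReal.ofReal p).toReal = p := ENNReal.toReal_ofReal (by linarith)
  obtain ⟨C₁, hC₁, hprod⟩ := exists_twisted_product X hP hPt (s₁ := s₁) (s₂ := s₂)
    (by rwa [hPr]) (by rwa [hPr]) (by rwa [two_mul_loss hp])
  obtain ⟨C₂, hC₂, hsum⟩ := exists_isExp_sum X hP hPt (σ := s₁ + s₂ - d / p)
    (by rw [hPr]; linarith)
  rw [hPr] at hprod
  refine ⟨(C₂ * C₁).toNNReal, fun a ha f g F G hf hg hF hG => ?_⟩
  rw [ENNReal.coe_toNNReal (ENNReal.mul_ne_top hC₂ hC₁)]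
  obtain ⟨u, hu, hul, -, hur, hun⟩ := hf.exists_blocks ha hp hF.2
  obtain ⟨v, hv, hvl, -, hvr, hvn⟩ := hg.exists_blocks ha hp hG.2
  choose w hw hwa hwn using fun i : ℤ × ℤ => hprod a i.1 i.2 (u i.1) (v i.2) ha (hu _) (hv _)
    (hul _) (hvl _)
  -- The twisted product of the blocks `j` and `k` is not localized at one scale, so it is cut into
  -- its blocks `m`. The resulting family, indexed by `((j, k), m)`, is absolutely summable with the
  -- weight of the target space.
  have htot : ∑' i : (ℤ × ℤ) × ℤ, two (i.2 * (s₁ + s₂ - d / p)) *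
      eLpNorm (X.ann.cut (2 ^ (-i.2)) (w i.1)) (ENNReal.ofReal p) volume ≤
      C₁ * X.besovNorm s₁ p F * X.besovNorm s₂ p G := by
    rw [ENNReal.tsum_prod (f := fun (i : ℤ × ℤ) (m : ℤ) => two (m * (s₁ + s₂ - d / p)) *
      eLpNorm (X.ann.cut (2 ^ (-m)) (w i)) (ENNReal.ofReal p) volume), ← hun, ← hvn]
    refine (ENNReal.tsum_le_tsum hwn).trans_eq ?_
    rw [ENNReal.tsum_prod (f := fun j k : ℤ =>
      C₁ * (two (j * s₁) * eLpNorm (u j) (ENNReal.ofReal p) volume) *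
        (two (k * s₂) * eLpNorm (v k) (ENNReal.ofReal p) volume))]
    simp only [ENNReal.tsum_mul_left, ENNReal.tsum_mul_right]
  have htot' := htot.trans_lt (ENNReal.mul_lt_top (ENNReal.mul_lt_top hC₁.lt_top hF.2) hG.2)
  obtain ⟨h, H, hh, -, hE, hN⟩ := hsum ha (fun i : (ℤ × ℤ) × ℤ => X.ann.cut (2 ^ (-i.2)) (w i.1))
    (fun i => i.2) (fun i => X.ann.memLp_cut hP.le (hw _)) (fun i => isLoc_ann_cut hP hPt (hw _))
    htot'.ne
  have hN' : X.besovNorm (s₁ + s₂ - d / p) p H ≤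
      C₂ * (C₁ * X.besovNorm s₁ p F * X.besovNorm s₂ p G) := hN.trans (by gcongr)
  refine ⟨h, H, ?_, hE, ⟨hE.2.1, hN'.trans_lt (ENNReal.mul_lt_top hC₂.lt_top
    (ENNReal.mul_lt_top (ENNReal.mul_lt_top hC₁.lt_top hF.2) hG.2))⟩, hN'.trans_eq (by ring)⟩
  refine isProduct_of_hasSum hf.1 hg.1
    (fun j => ((hul j).isLoc_expAvg hP hPt ha (hu j)).memLp_top hP.le hPt (memLp_expAvg hP.le a (hu j)))
    (fun j => ((hvl j).isLoc_expAvg hP hPt ha (hv j)).memLp_top hP.le hPt (memLp_expAvg hP.le a (hv j)))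
    hur hvr fun φ => ?_
  -- Summing over `m` first, with the pair of input blocks fixed, recovers `expAvg a (w i)`, which
  -- is the product of the corresponding blocks of `f` and `g`.
  refine (hh φ).prod_fiberwise fun i => ?_
  have e1 : ∀ m : ℤ, ∫ x, φ x * expAvg a (X.ann.cut (2 ^ (-m)) (w i)) x =
      ∫ x, φ x * X.ann.cut (2 ^ (-m)) (expAvg a (w i)) x := fun m =>
    integral_congr_ae ((X.ann.cut_expAvg hP hPt ha (2 ^ (-m)) (hw i)).mono fun x hx => by simp only [hx])
  have e2 : ∫ x, φ x * (expAvg a (u i.1) x * expAvg a (v i.2) x) =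
      ∫ x, φ x * expAvg a (w i) x :=
    integral_congr_ae ((hwa i).mono fun x hx => by simp only [hx])
  have hsm := (hh φ).summable.prod_factor i
  simp only [e1] at hsm ⊢
  rw [e2]
  exact hasSum_integral_ann_cut hd hP hPt (memLp_expAvg hP.le a (hw i)) φ hsm

end Cutoff

/-! ### The critical space: bounded continuous functions and the algebra property. -/

lemma Profile.continuous_cut_boundedContinuous (m : Profile d) (r : ℝ) (v : Rd d →ᵇ ℂ) :
    Continuous (m.cut r v) := by
  refine continuous_of_dominated (bound := fun t => ‖m.kernel t‖ * ‖v‖) (fun x => ?_)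
    (fun x => Eventually.of_forall fun t => ?_) (m.integrable_kernel.norm.mul_const _)
    (Eventually.of_forall fun t => ?_)
  · exact (m.kernel.continuous.mul (v.continuous.comp (by fun_prop))).aestronglyMeasurable
  · rw [norm_mul]
    exact mul_le_mul_of_nonneg_left (v.norm_coe_le_norm _) (norm_nonneg _)
  · exact continuous_const.mul (v.continuous.comp (by fun_prop))

lemma integrable_kernel_mul (m : Profile d) {p : ℝ≥0∞} (hp : 1 ≤ p) {r : ℝ} (hr : 0 < r)
    {u : Rd d → ℂ} (hu : MemLp u p volume) (x : Rd d) :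
    Integrable fun t => m.kernel t * u (x - r • t) := by
  have hc : p.conjExponent.HolderConjugate p := (ENNReal.HolderConjugate.conjExponent hp).symm
  refine integrable_mul_of_holder (p := p.conjExponent) (q := p) (m.kernel.memLp _ volume) ?_
  have h1 : MemLp (fun y => u (x - y)) p volume :=
    hu.comp_measurePreserving (Measure.measurePreserving_sub_left volume x)
  have hme : MeasurableEmbedding (fun y : Rd d => r • y) :=
    (Homeomorph.smulOfNeZero r hr.ne').measurableEmbedding
  refine (hme.memLp_map_measure_iff (g := fun y => u (x - y))).1 ?_
  rw [Measure.map_addHaar_smul _ hr.ne']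
  exact h1.smul_measure ENNReal.ofReal_ne_top

/-- Frequency localized functions are continuous. -/
lemma Profile.continuous_cut (m : Profile d) {p : ℝ≥0∞} (hp : 1 ≤ p) (hpt : p ≠ ⊤) {r : ℝ}
    (hr : 0 < r) {u : Rd d → ℂ} (hu : MemLp u p volume) : Continuous (m.cut r u) := by
  set A : ℝ≥0∞ := ENNReal.ofReal (r ^ (-(d / p.toReal))) * m.bern p with hA
  have hAt : A ≠ ⊤ := ENNReal.mul_ne_top ENNReal.ofReal_ne_top m.bern_ne_top
  refine continuous_of_uniform_approx_of_continuous fun s hs => ?_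
  obtain ⟨ε, hε, hεs⟩ := mem_uniformity_edist.1 hs
  obtain ⟨δ, hδ, hδε⟩ : ∃ δ : ℝ≥0∞, δ ≠ 0 ∧ A * δ < ε := by
    have h : Tendsto (fun δ : ℝ≥0∞ => A * δ) (𝓝[>] 0) (𝓝 0) := by
      have := ENNReal.Tendsto.const_mul (a := A) (tendsto_id (α := ℝ≥0∞) (x := 𝓝 0)) (Or.inr hAt)
      rw [mul_zero] at this
      exact this.mono_left nhdsWithin_le_nhds
    obtain ⟨δ, h1, h2⟩ := ((h.eventually_lt_const hε).and self_mem_nhdsWithin).exists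
    exact ⟨δ, (show 0 < δ from h2).ne', h1⟩
  obtain ⟨v, hv, hvp⟩ := hu.exists_boundedContinuous_eLpNorm_sub_le hpt hδ
  refine ⟨m.cut r v, m.continuous_cut_boundedContinuous r v, fun x => hεs ?_⟩
  have h1 : m.cut r u x - m.cut r v x = m.cut r (u - v) x := by
    simp only [Profile.cut, avg, Pi.sub_apply, mul_sub]
    rw [integral_sub (integrable_kernel_mul m hp hr hu x) (integrable_kernel_mul m hp hr hvp x)]
  rw [edist_eq_enorm_sub, h1]
  refine (m.enorm_cut_le hp hpt hr (hu.sub hvp) x).trans_lt (lt_of_le_of_lt ?_ hδε)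
  gcongr

lemma lebesgueNorm_zero {q : ℝ≥0∞} : lebesgueNorm q (0 : Tempered d) = 0 :=
  le_antisymm ((lebesgueNorm_le (u := 0) MemLp.zero fun φ => by simp).trans_eq eLpNorm_zero)
    zero_le

lemma lebesgueNorm_add_le {q : ℝ≥0∞} (hq : 1 ≤ q) (T T' : Tempered d) :
    lebesgueNorm q (T + T') ≤ lebesgueNorm q T + lebesgueNorm q T' := by
  rcases eq_or_lt_of_le (le_top (a := lebesgueNorm q T)) with h | h
  · simp [h]
  rcases eq_or_lt_of_le (le_top (a := lebesgueNorm q T')) with h' | h'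
  · simp [h']
  obtain ⟨u, hu, hur⟩ := exists_represents_of_lebesgueNorm_lt_top h
  obtain ⟨v, hv, hvr⟩ := exists_represents_of_lebesgueNorm_lt_top h'
  rw [lebesgueNorm_eq hq hu hur, lebesgueNorm_eq hq hv hvr]
  exact (lebesgueNorm_le (hu.add hv) (hur.add hq hq hu hv hvr)).trans
    (eLpNorm_add_le hu.1 hv.1 hq)

lemma lebesgueNorm_smul_le {q : ℝ≥0∞} (hq : 1 ≤ q) (c : ℂ) (T : Tempered d) :
    lebesgueNorm q (c • T) ≤ ‖c‖ₑ * lebesgueNorm q T := by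
  rcases eq_or_ne c 0 with rfl | hc
  · have e : (0 : ℂ) • T = 0 := ContinuousLinearMap.ext fun φ => zero_mul (T φ)
    rw [e, lebesgueNorm_zero]; exact zero_le
  rcases eq_or_lt_of_le (le_top (a := lebesgueNorm q T)) with h | h
  · rw [h, ENNReal.mul_top (by simpa using hc)]; exact le_top
  obtain ⟨u, hu, hur⟩ := exists_represents_of_lebesgueNorm_lt_top h
  rw [lebesgueNorm_eq hq hu hur]
  exact (lebesgueNorm_le (hu.const_mul c) (hur.const_mul c)).trans
    (eLpNorm_const_smul_le (c := c) (f := u))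

namespace Cutoff

variable {X : Cutoff d}

lemma memSh_zero : X.MemSh 0 := by
  simp only [MemSh, map_zero, lebesgueNorm_zero]
  exact tendsto_const_nhds

lemma MemSh.add {f g : Tempered d} (hf : X.MemSh f) (hg : X.MemSh g) : X.MemSh (f + g) := by
  have h : Tendsto (fun j : ℤ => lebesgueNorm ⊤ (X.S j f) + lebesgueNorm ⊤ (X.S j g)) atBot
      (𝓝 0) := by simpa using Tendsto.add hf hg
  refine tendsto_of_tendsto_of_tendsto_of_le_of_le tendsto_const_nhds h (fun _ => zero_le)
    fun j => ?_
  simp only [map_add]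
  exact lebesgueNorm_add_le le_top _ _

lemma MemSh.const_smul {f : Tempered d} (hf : X.MemSh f) (c : ℂ) : X.MemSh (c • f) := by
  have h : Tendsto (fun j : ℤ => ‖c‖ₑ * lebesgueNorm ⊤ (X.S j f)) atBot (𝓝 0) := by
    simpa using ENNReal.Tendsto.const_mul hf (Or.inr enorm_ne_top)
  refine tendsto_of_tendsto_of_tendsto_of_le_of_le tendsto_const_nhds h (fun _ => zero_le)
    fun j => ?_
  simp only [map_smul]
  exact lebesgueNorm_smul_le le_top _ _

section

variable {s p : ℝ}

lemma memBesov_zero : X.MemBesov s p 0 :=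
  ⟨memSh_zero, by simp [besovNorm, lebesgueNorm_zero]⟩

lemma MemBesov.add (hp : 1 < p) {f g : Tempered d} (hf : X.MemBesov s p f)
    (hg : X.MemBesov s p g) : X.MemBesov s p (f + g) := by
  refine ⟨hf.1.add hg.1, lt_of_le_of_lt ?_ (ENNReal.add_lt_top.2 ⟨hf.2, hg.2⟩)⟩
  rw [besovNorm, besovNorm, besovNorm, ← ENNReal.tsum_add]
  refine ENNReal.tsum_le_tsum fun j => ?_
  rw [← mul_add, map_add]
  gcongr
  exact lebesgueNorm_add_le (by simpa using hp.le) _ _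

lemma MemBesov.const_smul (hp : 1 < p) {f : Tempered d} (hf : X.MemBesov s p f) (c : ℂ) :
    X.MemBesov s p (c • f) := by
  refine ⟨hf.1.const_smul c, lt_of_le_of_lt ?_ (ENNReal.mul_lt_top (enorm_lt_top (x := c)) hf.2)⟩
  rw [besovNorm, besovNorm, ← ENNReal.tsum_mul_left]
  refine ENNReal.tsum_le_tsum fun j => ?_
  rw [map_smul, mul_left_comm]
  gcongr
  exact lebesgueNorm_smul_le (by simpa using hp.le) _ _

variable {a : ℝ}

lemma isExp_zero : X.IsExp a 0 0 :=
  ⟨memSh_zero, memSh_zero, fun j => ⟨0, MemLp.zero, fun φ => by simp, fun φ => by simp⟩⟩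

lemma IsExp.add (ha : 0 ≤ a) {f g F G : Tempered d} (hf : X.IsExp a f F) (hg : X.IsExp a g G) :
    X.IsExp a (f + g) (F + G) := by
  refine ⟨hf.1.add hg.1, hf.2.1.add hg.2.1, fun j => ?_⟩
  obtain ⟨u, hu, hur, huf⟩ := hf.2.2 j
  obtain ⟨v, hv, hvr, hvg⟩ := hg.2.2 j
  refine ⟨fun x => u x + v x, hu.add hv, ?_, fun φ => ?_⟩
  · rw [map_add]
    exact hur.add le_top le_top hu hv hvr
  · rw [map_add]
    change X.Delta j f φ + X.Delta j g φ = _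
    have h := memLp_expAvg le_rfl a (φ.memLp 1 volume)
    rw [huf, hvg, expNegTest_eq ha, ← integral_add (integrable_mul_of_holder (q := ⊤) h hu)
      (integrable_mul_of_holder (q := ⊤) h hv)]
    simp only [mul_add]

lemma IsExp.const_smul {f F : Tempered d} (hf : X.IsExp a f F) (c : ℂ) :
    X.IsExp a (c • f) (c • F) := by
  refine ⟨hf.1.const_smul c, hf.2.1.const_smul c, fun j => ?_⟩
  obtain ⟨u, hu, hur, huf⟩ := hf.2.2 j
  refine ⟨fun x => c * u x, hu.const_mul c, ?_, fun φ => ?_⟩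
  · rw [map_smul]
    exact hur.const_mul c
  · rw [map_smul]
    change c * X.Delta j f φ = _
    rw [huf, ← integral_const_mul]
    exact integral_congr_ae (Eventually.of_forall fun x => by ring)

lemma IsExp.besovNorm_le (ha : 0 ≤ a) (hp : 1 < p) {f F : Tempered d} (h : X.IsExp a f F)
    (hF : X.besovNorm s p F < ⊤) : X.besovNorm s p f ≤ X.besovNorm s p F := by
  have hP : 1 ≤ ENNReal.ofReal p := by simpa using hp.le
  obtain ⟨u, hu, -, -, hur, hun⟩ := h.exists_blocks ha hp hF
  rw [← hun]
  refine ENNReal.tsum_le_tsum fun j => mul_le_mul_right ?_ _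
  exact (lebesgueNorm_le (memLp_expAvg hP a (hu j)) (hur j)).trans (eLpNorm_expAvg_le hP a (hu j).1)

lemma IsExp.memBesov (ha : 0 ≤ a) (hp : 1 < p) {f F : Tempered d} (h : X.IsExp a f F)
    (hF : X.MemBesov s p F) : X.MemBesov s p f :=
  ⟨h.1, (h.besovNorm_le ha hp hF.2).trans_lt hF.2⟩

/-- The elements of the critical Besov space are bounded continuous functions. -/
lemma MemBesov.exists_boundedContinuous (hp : 1 < p) {f : Tempered d}
    (hf : X.MemBesov (d / p) p f) :
    ∃ u : Rd d →ᵇ ℂ, Represents u f ∧ ∀ U : ℕ → Rd d → ℂ,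
      (∀ n, MemLp (U n) ⊤ volume ∧ Represents (U n) (X.S n f)) →
      Tendsto (fun n => eLpNorm (fun x => u x - U n x) ⊤ volume) atTop (𝓝 0) := by
  have hP : 1 < ENNReal.ofReal p := by simpa using hp
  have hPt : ENNReal.ofReal p ≠ ⊤ := ENNReal.ofReal_ne_top
  have hPr : (ENNReal.ofReal p).toReal = p := ENNReal.toReal_ofReal (by linarith)
  have h : ∀ j : ℤ, lebesgueNorm (ENNReal.ofReal p) (X.Delta j f) < ⊤ := fun j =>
    ENNReal.lt_top_of_mul_ne_top_right ((ENNReal.le_tsum (f := fun j : ℤ => two (j * (d / p)) *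
      lebesgueNorm (ENNReal.ofReal p) (X.Delta j f)) j).trans_lt hf.2).ne (two_ne_zero' _)
  choose u hu hur using fun j => exists_represents_of_lebesgueNorm_lt_top (h j)
  have hul := fun j => X.isLoc_of_represents_Delta hP.le (hu j) (hur j)
  set B : ℤ → ℝ≥0∞ := fun j => two (j * (d / p)) * X.fat.bern (ENNReal.ofReal p) *
    eLpNorm (u j) (ENNReal.ofReal p) volume with hB
  have hBt : ∀ j, B j ≠ ⊤ := fun j => ENNReal.mul_ne_top (ENNReal.mul_ne_top (two_ne_top _)
    X.fat.bern_ne_top) (hu j).2.ne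
  have hBs : ∑' j, B j ≠ ⊤ := by
    have e : ∀ j, B j = X.fat.bern (ENNReal.ofReal p) * (two (j * (d / p)) *
        lebesgueNorm (ENNReal.ofReal p) (X.Delta j f)) := fun j => by
      rw [lebesgueNorm_eq hP.le (hu j) (hur j), hB]; ring
    simp only [e, ENNReal.tsum_mul_left]
    exact ENNReal.mul_ne_top X.fat.bern_ne_top hf.2.ne
  have hcb : ∀ j x, ‖X.fat.cut (2 ^ (-j)) (u j) x‖ ≤ (B j).toReal := fun j x => by
    have h1 := X.fat.enorm_cut_le (r := (2 : ℝ) ^ (-j)) hP.le hPt (by positivity) (hu j) x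
    rw [ofReal_zpow_rpow, hPr] at h1
    rw [← toReal_enorm]
    exact ENNReal.toReal_mono (hBt j) h1
  -- The fat cut-off of a block is a continuous representative of it. By Bernstein's inequality at
  -- the critical regularity, the sup norms are summable, so the series converges uniformly.
  set c : ℤ → (Rd d →ᵇ ℂ) := fun j => BoundedContinuousFunction.ofNormedAddCommGroup
    (X.fat.cut (2 ^ (-j)) (u j)) (X.fat.continuous_cut hP.le hPt (by positivity) (hu j))
    (B j).toReal (hcb j) with hc
  have hcu : ∀ j, ⇑(c j) =ᵐ[volume] u j := fun j => hul j
  have hct : ∀ j, MemLp (c j) ⊤ volume := fun j => (c j).memLp_top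
  have hcr : ∀ j, Represents (c j) (X.Delta j f) := fun j φ => by
    rw [hur]
    exact integral_congr_ae ((hcu j).mono fun x hx => by simp only [hx])
  have hcs : Summable c := by
    refine Summable.of_norm_bounded (ENNReal.summable_toReal hBs) fun j => ?_
    exact BoundedContinuousFunction.norm_ofNormedAddCommGroup_le _ ENNReal.toReal_nonneg (hcb j)
  have hIco : Tendsto (fun n : ℕ => Finset.Ico (-(n : ℤ)) n) atTop atTop := by
    refine tendsto_atTop_finset_of_monotone (fun a b hab => ?_) fun m => ⟨m.natAbs + 1, ?_⟩
    · exact Finset.Ico_subset_Ico (by omega) (by omega)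
    · rw [Finset.mem_Ico]; omega
  have hsum : Tendsto (fun n : ℕ => ‖(∑' j, c j) - ∑ j ∈ Finset.Ico (-(n : ℤ)) n, c j‖ₑ) atTop
      (𝓝 0) := by
    have := (hcs.hasSum.comp hIco).const_sub (∑' j, c j)
    rw [sub_self] at this
    simpa using this.enorm
  choose V hV hVr hVs using fun n : ℕ => hf.1.exists_represents_S hct hcr n
  have hlim : Tendsto (fun n : ℕ => eLpNorm (fun x => (∑' j, c j) x - V n x) ⊤ volume) atTop
      (𝓝 0) := by
    have hneg : Tendsto (fun n : ℕ => -(n : ℤ)) atTop atBot :=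
      tendsto_neg_atTop_atBot.comp tendsto_natCast_atTop_atTop
    have h1 := hsum.add (hf.1.comp hneg)
    rw [add_zero] at h1
    refine tendsto_of_tendsto_of_tendsto_of_le_of_le tendsto_const_nhds h1 (fun _ => zero_le)
      fun n => ?_
    -- The error splits into the tail of the uniformly convergent series outside `[-n, n)` and the
    -- low-frequency part `S_{-n} f`, small because `f` is in `S'_h`.
    have e : (fun x => (∑' j, c j) x - V n x) =
        ⇑((∑' j, c j) - ∑ j ∈ Finset.Ico (-(n : ℤ)) n, c j) -
          fun x => V n x - ∑ j ∈ Finset.Ico (-(n : ℤ)) n, c j x := by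
      ext x
      simp
    rw [e]
    have h2 : MemLp (fun x => V n x - ∑ j ∈ Finset.Ico (-(n : ℤ)) n, c j x) ⊤ volume :=
      (hV n).sub (memLp_finsetSum _ fun j _ => hct j)
    refine (eLpNorm_sub_le (BoundedContinuousFunction.memLp_top _).1 h2.1 le_top).trans ?_
    refine add_le_add ?_ (hVs n _ (by omega)).le
    rw [eLpNorm_exponent_top]
    refine essSup_le_of_ae_le _ (Eventually.of_forall fun x => ?_)
    exact enorm_le_iff_norm_le.2 (BoundedContinuousFunction.norm_coe_le_norm _ x)
  have hU : ∀ U : ℕ → Rd d → ℂ, (∀ n, MemLp (U n) ⊤ volume ∧ Represents (U n) (X.S n f)) →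
      Tendsto (fun n => eLpNorm (fun x => (∑' j, c j) x - U n x) ⊤ volume) atTop (𝓝 0) :=
    fun U hU => hlim.congr fun n => eLpNorm_congr_ae
      ((Represents.ae_eq le_top le_top (hV n) (hU n).1 (hVr n) (hU n).2).mono fun x hx => by
        simp only [hx])
  refine ⟨∑' j, c j, fun φ => ?_, hU⟩
  have h1 := tendsto_S X f φ
  have h2 := tendsto_integral_mul_mul_top (φ.memLp 1 volume)
    (BoundedContinuousFunction.memLp_top (∑' j, c j)) (memLp_top_const (1 : ℂ)) hV
    (fun _ => memLp_top_const (1 : ℂ)) hlim (by simp only [sub_self, eLpNorm_zero', tendsto_const_nhds_iff])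
  simp only [mul_one] at h2
  refine tendsto_nhds_unique h1 (h2.congr fun n => ?_)
  rw [hVr]

/-- The product estimate for bounded continuous functions in the critical Gevrey space. -/
lemma exists_pointwise_product_estimate (hd : 1 ≤ d) (X : Cutoff d) (hp : 1 < p) :
    ∃ C : ℝ≥0, ∀ a : ℝ, 0 ≤ a → ∀ (u v : Rd d →ᵇ ℂ) (f g F G : Tempered d),
      Represents u f → Represents v g → X.IsExp a f F → X.IsExp a g G →
      X.MemBesov (d / p) p F → X.MemBesov (d / p) p G →
      ∃ h H : Tempered d, Represents (u * v) h ∧ X.IsExp a h H ∧ X.MemBesov (d / p) p H ∧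
        X.besovNorm (d / p) p H ≤ C * X.besovNorm (d / p) p F * X.besovNorm (d / p) p G := by
  have hd0 : (0 : ℝ) < d := by exact_mod_cast hd
  have hp0 : 0 < p := by linarith
  -- For `s₁ = s₂ = d/p` the condition of the product estimate is automatic, as `max 0 (2/p - 1) <
  -- 2/p` and `d > 0`.
  have hs : d * max 0 (2 / p - 1) < d / p + d / p := by
    have h1 : max 0 (2 / p - 1) < 2 / p := max_lt (by positivity) (by linarith)
    calc (d : ℝ) * max 0 (2 / p - 1) < d * (2 / p) := by gcongr
      _ = _ := by ring
  obtain ⟨C, hC⟩ := exists_product_estimate hd X hp le_rfl le_rfl hs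
  refine ⟨C, fun a ha u v f g F G hu hv hf hg hF hG => ?_⟩
  obtain ⟨h, H, ⟨U, V, hU, hV, hUV⟩, hE, hH, hN⟩ := hC a ha f g F G hf hg hF hG
  rw [add_sub_cancel_right] at hH hN
  refine ⟨h, H, fun φ => ?_, hE, hH, hN⟩
  -- Since `e^{-aΛ₁}` is a contraction, `f` and `g` are themselves in the critical space, so `S_n f`
  -- and `S_n g` converge uniformly. The limit defining the product of distributions is then the
  -- pointwise product.
  obtain ⟨u', hu', hU'⟩ := (hf.memBesov ha hp hF).exists_boundedContinuous hp
  obtain ⟨v', hv', hV'⟩ := (hg.memBesov ha hp hG).exists_boundedContinuous hp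
  have e1 := Represents.ae_eq le_top le_top u.memLp_top u'.memLp_top hu hu'
  have e2 := Represents.ae_eq le_top le_top v.memLp_top v'.memLp_top hv hv'
  have h1 := tendsto_integral_mul_mul_top (φ.memLp 1 volume) u'.memLp_top v'.memLp_top
    (fun n => (hU n).1) (fun n => (hV n).1) (hU' U hU) (hV' V hV)
  rw [tendsto_nhds_unique (hUV φ) h1]
  refine integral_congr_ae ?_
  filter_upwards [e1, e2] with x hx1 hx2
  rw [← hx1, ← hx2]
  rfl

/-- The critical Gevrey space is an algebra. -/
lemma exists_nonUnitalSubalgebra (hd : 1 ≤ d) (X : Cutoff d) (hp : 1 < p) (ha : 0 ≤ a) :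
    ∃ A : NonUnitalSubalgebra ℂ (Rd d →ᵇ ℂ),
      (A : Set (Rd d →ᵇ ℂ)) = X.gevreyFunctions a (d / p) p := by
  obtain ⟨C, hC⟩ := exists_pointwise_product_estimate hd X hp
  -- The algebra has no unit coming from constants: `S_j` fixes them, so nonzero constants are not
  -- in `S'_h`.
  refine ⟨{ carrier := X.gevreyFunctions a (d / p) p
            add_mem' := ?_
            zero_mem' := ⟨0, ⟨memBesov_zero, 0, isExp_zero, memBesov_zero⟩, fun φ => by simp⟩
            mul_mem' := ?_
            smul_mem' := ?_ }, rfl⟩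
  · rintro u v ⟨f, ⟨hf, F, hfF, hF⟩, hu⟩ ⟨g, ⟨hg, G, hgG, hG⟩, hv⟩
    exact ⟨f + g, ⟨hf.add hp hg, F + G, hfF.add ha hgG, hF.add hp hG⟩,
      hu.add le_top le_top u.memLp_top v.memLp_top hv⟩
  · rintro u v ⟨f, ⟨hf, F, hfF, hF⟩, hu⟩ ⟨g, ⟨hg, G, hgG, hG⟩, hv⟩
    obtain ⟨h, H, hr, hE, hH, -⟩ := hC a ha u v f g F G hu hv hfF hgG hF hG
    exact ⟨h, ⟨hE.memBesov ha hp hH, H, hE, hH⟩, hr⟩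
  · rintro c u ⟨f, ⟨hf, F, hfF, hF⟩, hu⟩
    exact ⟨c • f, ⟨hf.const_smul hp c, c • F, hfF.const_smul c, hF.const_smul hp c⟩,
      hu.const_mul c⟩

end

end Cutoff

end GevreyBesov

end

theorem proposition2p3 (d : ℕ) (hd : 1 ≤ d) (X : GevreyBesov.Cutoff d) (p : ℝ) (hp : 1 < p) :
    -- the product estimate, uniformly in time
    (∀ s₁ s₂ : ℝ, s₁ ≤ d / p → s₂ ≤ d / p → d * max 0 (2 / p - 1) < s₁ + s₂ →
      ∃ C : ℝ≥0, ∀ c₀ : ℝ, 0 < c₀ → ∀ t : ℝ, 0 ≤ t →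
        ∀ f g F G : GevreyBesov.Tempered d,
          X.IsExp (√(c₀ * t)) f F → X.IsExp (√(c₀ * t)) g G →
          X.MemBesov s₁ p F → X.MemBesov s₂ p G →
          ∃ h H : GevreyBesov.Tempered d,
            X.IsProduct f g h ∧ X.IsExp (√(c₀ * t)) h H ∧
            X.MemBesov (s₁ + s₂ - d / p) p H ∧
            X.besovNorm (s₁ + s₂ - d / p) p H ≤
              C * X.besovNorm s₁ p F * X.besovNorm s₂ p G) ∧
    -- the Gevrey version of the critical Besov space consists of bounded continuous functions
    -- and is an algebra for the pointwise product, with a uniformly continuous product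
    (∃ C : ℝ≥0, ∀ c₀ : ℝ, 0 < c₀ → ∀ t : ℝ, 0 ≤ t →
      (∀ f : GevreyBesov.Tempered d, X.MemGevrey (√(c₀ * t)) (d / p) p f →
        ∃ u : BoundedContinuousFunction (GevreyBesov.Rd d) ℂ, GevreyBesov.Represents u f) ∧
      (∃ A : NonUnitalSubalgebra ℂ (BoundedContinuousFunction (GevreyBesov.Rd d) ℂ),
        (A : Set (BoundedContinuousFunction (GevreyBesov.Rd d) ℂ)) =
          X.gevreyFunctions (√(c₀ * t)) (d / p) p) ∧
      ∀ (u v : BoundedContinuousFunction (GevreyBesov.Rd d) ℂ)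
        (f g F G : GevreyBesov.Tempered d),
        GevreyBesov.Represents u f → GevreyBesov.Represents v g →
        X.IsExp (√(c₀ * t)) f F → X.IsExp (√(c₀ * t)) g G →
        X.MemBesov (d / p) p F → X.MemBesov (d / p) p G →
        ∃ h H : GevreyBesov.Tempered d, GevreyBesov.Represents (u * v) h ∧
          X.IsExp (√(c₀ * t)) h H ∧ X.MemBesov (d / p) p H ∧
          X.besovNorm (d / p) p H ≤ C * X.besovNorm (d / p) p F * X.besovNorm (d / p) p G) := by
  have ha : ∀ c₀ t : ℝ, 0 ≤ √(c₀ * t) := fun _ _ => Real.sqrt_nonneg _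
  refine ⟨fun s₁ s₂ h₁ h₂ hs => ?_, ?_⟩
  · obtain ⟨C, hC⟩ := GevreyBesov.Cutoff.exists_product_estimate hd X hp h₁ h₂ hs
    exact ⟨C, fun c₀ _ t _ => hC _ (ha c₀ t)⟩
  · obtain ⟨C, hC⟩ := GevreyBesov.Cutoff.exists_pointwise_product_estimate hd X hp
    refine ⟨C, fun c₀ _ t _ => ⟨fun f hf => ?_,
      GevreyBesov.Cutoff.exists_nonUnitalSubalgebra hd X hp (ha c₀ t), hC _ (ha c₀ t)⟩⟩
    obtain ⟨u, hu, -⟩ := hf.1.exists_boundedContinuous hp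
    exact ⟨u, hu⟩
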